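/- Let $C$ and $D$ be coalgebras over a field $k$. Write $\mathcal M^C$ and ${}^C\mathcal M$ for the categories of right and left $C$-comodules, ${}^C\mathcal M^D$ for the category of $(C,D)$-bicomodules, and $\square_C$ for the cotensor product. *Frobenius functors.* A $k$-linear Frobenius functor of the second kind from a $k$-linear category $\mathcal A$ to a $k$-linear category $\mathcal B$ is a quadruple $(F,G,\alpha,\beta)$ of $k$-linear functors $F:\mathcal A\to\mathcal B$, $G:\mathcal B\to\mathcal A$, $\alpha:\mathcal A\to\mathcal A$, $\beta:\mathcal B\to\mathcal B$, with $\alpha$ and $\beta$ equivalences of categories, such that $G$ is a right adjoint of $F$ and a left adjoint of $\beta F\alpha$. Two of them are isomorphic if their four components are naturally isomorphic. *Co-hom.* A right comodule $M$ over $C$ is quasifinite if $\mathrm{Hom}^C(W,M)$ is finite dimensional for every finite dimensional $W\in\mathcal M^C$, and similarly for left comodules. If $\Lambda\in{}^D\mathcal M^C$ is quasifinite as a right $C$-comodule, the functor $-\,\square_D\Lambda:\mathcal M^D\to\mathcal M^C$ has a left adjoint $h_C(\Lambda,-)$, and $h_C(\Lambda,C)$ is a $(C,D)$-bicomodule whose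 left coaction is induced by the comultiplication of $C$. If $X\in{}^C\mathcal M^D$ is quasifinite as a left $C$-comodule, ${}_Ch(X,-)$ denotes similarly the left adjoint of $X\,\square_D-:{}^D\mathcal M\to{}^C\mathcal M$, and ${}_Ch(X,C)$ is a $(D,C)$-bicomodule. *Contexts.* A strict Morita–Takeuchi context $(C,C,U,U',f,f')$ consists of $U,U'\in{}^C\mathcal M^C$ and isomorphisms of bicomodules $f:C\to U'\square_CU$ and $f':C\to U\square_CU'$ with $(f'^{-1}\square U)(U\square f)=U$ and $(U'\square f'^{-1})(f\square U')=U'$; contexts $(D,D,V,V',g,g')$ over $D$ are defined in the same way. An isomorphism of contexts is a pair of bicomodule isomorphisms (between the $U$'s and between the $U'$'s) compatible with $f$ and $f'$. *Fourtuples.* Consider fourtuples $(X,\Lambda,\underline U,\underline V)$ with $X\in{}^C\mathcal M^D$, $\Lambda\in{}^D\mathcal M^C$, and $\underline U=(C,C,U,U',f,f')$, $\underline V=(D,D,V,V',g,g')$ strict Morita–Takeuchi contexts. Two of them are isomorphic if their four components are isomorphic. **Theorem.** For every such fourtuple the following two conditions are equivalent: (i) $\Lambda$ and $X$ are quasifinite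 and injective, respectively as a right $C$-comodule and as a right $D$-comodule, and there are isomorphisms of bicomodules $$X\cong h_C(\Lambda,C)\quad\text{and}\quad \Lambda\cong h_D(U\square_CX\square_DV,\,D);$$ (ii) $\Lambda$ and $X$ are quasifinite and injective, respectively as a left $D$-comodule and as a left $C$-comodule, and there are isomorphisms of bicomodules $$\Lambda\cong{}_Ch(X,C)\quad\text{and}\quad U\square_CX\square_DV\cong{}_Dh(\Lambda,D).$$ Moreover, the assignment $$(X,\Lambda,\underline U,\underline V)\mapsto(-\square_CX,\;-\square_D\Lambda,\;-\square_CU,\;-\square_DV)$$ induces a one-to-one correspondence between the isomorphism classes of fourtuples satisfying these conditions and the isomorphism classes of $k$-linear Frobenius functors of the second kind from $\mathcal M^C$ to $\mathcal M^D$, and the assignment $$(X,\Lambda,\underline U,\underline V)\mapsto(\Lambda\square_C-,\;X\square_D-,\;U\square_C-,\;V\square_D-)$$ induces a one-to-one correspondence between the same isomorphism classes of fourtuples and the isomorphism classes of $k$-linear Frobenius functors of the second kind from ${}^C\mathcal M$ to ${}^D\mathcal M$. -/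

import Mathlib

open CategoryTheory TensorProduct

universe u

namespace FrobeniusComod

section Linear

variable {k : Type u} [Field k]
variable {C : Type u} [AddCommGroup C] [Module k C]
variable {D : Type u} [AddCommGroup D] [Module k D]
variable {M : Type u} [AddCommGroup M] [Module k M]
variable {N : Type u} [AddCommGroup N] [Module k N]

/-- A left `C`-coaction and a right `D`-coaction commute: `(l ⊗ D) r = (C ⊗ r) l`. -/
def CoactionsCommute (l : M →ₗ[k] C ⊗[k] M) (r : M →ₗ[k] M ⊗[k] D) : Prop :=
  (TensorProduct.assoc k C M D).toLinearMap ∘ₗ l.rTensor D ∘ₗ r = r.lTensor C ∘ₗ l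

/-- The cotensor product `M □_C N`, the equalizer of `r ⊗ N` and `M ⊗ l` inside `M ⊗ N`. -/
def cotensor (r : M →ₗ[k] M ⊗[k] C) (l : N →ₗ[k] C ⊗[k] N) : Submodule k (M ⊗[k] N) :=
  LinearMap.eqLocus ((TensorProduct.assoc k M C N).toLinearMap ∘ₗ r.rTensor N) (l.lTensor M)

theorem mem_cotensor {r : M →ₗ[k] M ⊗[k] C} {l : N →ₗ[k] C ⊗[k] N} {x : M ⊗[k] N} :
    x ∈ cotensor r l ↔ TensorProduct.assoc k M C N (r.rTensor N x) = l.lTensor M x := Iff.rfl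

/-- The right coaction `M ⊗ r` on `M ⊗ N`. -/
noncomputable def tensorRight (M : Type u) [AddCommGroup M] [Module k M]
    (r : N →ₗ[k] N ⊗[k] D) : M ⊗[k] N →ₗ[k] (M ⊗[k] N) ⊗[k] D :=
  (TensorProduct.assoc k M N D).symm.toLinearMap ∘ₗ r.lTensor M

/-- The left coaction `l ⊗ N` on `M ⊗ N`. -/
noncomputable def tensorLeft (N : Type u) [AddCommGroup N] [Module k N]
    (l : M →ₗ[k] C ⊗[k] M) : M ⊗[k] N →ₗ[k] C ⊗[k] (M ⊗[k] N) :=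
  (TensorProduct.assoc k C M N).toLinearMap ∘ₗ l.rTensor N

theorem tensor_coactionsCommute (l : M →ₗ[k] C ⊗[k] M) (r : N →ₗ[k] N ⊗[k] D) :
    CoactionsCommute (tensorLeft N l) (tensorRight M r) := by
  apply TensorProduct.ext'
  intro m n
  have key1 : ∀ z : N ⊗[k] D, TensorProduct.assoc k C (M ⊗[k] N) D
      ((tensorLeft N l).rTensor D ((TensorProduct.assoc k M N D).symm (m ⊗ₜ z)))
      = (TensorProduct.assoc k M N D).symm.toLinearMap.lTensor C
          (TensorProduct.assoc k C M (N ⊗[k] D) (l m ⊗ₜ z)) := by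
    intro z
    induction z with
    | zero => simp
    | add x y hx hy => simp only [TensorProduct.tmul_add, map_add, hx, hy]
    | tmul n d =>
      simp only [TensorProduct.assoc_symm_tmul, LinearMap.rTensor_tmul, tensorLeft,
        LinearMap.comp_apply, LinearEquiv.coe_coe]
      generalize l m = w
      induction w with
      | zero => simp
      | add x y hx hy => simp only [TensorProduct.add_tmul, map_add, hx, hy]
      | tmul a b => simp
  have key2 : ∀ w : C ⊗[k] M, (tensorRight M r).lTensor C (TensorProduct.assoc k C M N (w ⊗ₜ n))
      = (TensorProduct.assoc k M N D).symm.toLinearMap.lTensor C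
          (TensorProduct.assoc k C M (N ⊗[k] D) (w ⊗ₜ r n)) := by
    intro w
    induction w with
    | zero => simp
    | add x y hx hy => simp only [TensorProduct.add_tmul, map_add, hx, hy]
    | tmul c m => simp [tensorRight]
  have := (key1 (r n)).trans (key2 (l m)).symm
  simpa [tensorLeft, tensorRight] using this

/-- Commutation of coactions pulls back along injective maps. -/
theorem CoactionsCommute.of_injective {l : M →ₗ[k] C ⊗[k] M} {r : M →ₗ[k] M ⊗[k] D}
    {l' : N →ₗ[k] C ⊗[k] N} {r' : N →ₗ[k] N ⊗[k] D} (h : CoactionsCommute l' r')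
    (i : M →ₗ[k] N) (hi : Function.Injective i)
    (hl : i.lTensor C ∘ₗ l = l' ∘ₗ i) (hr : i.rTensor D ∘ₗ r = r' ∘ₗ i) :
    CoactionsCommute l r := by
  have hl' : ∀ x, i.lTensor C (l x) = l' (i x) := fun x => LinearMap.congr_fun hl x
  have hr' : ∀ x, i.rTensor D (r x) = r' (i x) := fun x => LinearMap.congr_fun hr x
  apply LinearMap.ext
  intro x
  apply Module.Flat.lTensor_preserves_injective_linearMap (M := C) _
    (Module.Flat.rTensor_preserves_injective_linearMap (M := D) i hi)
  have e := LinearMap.congr_fun h (i x)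
  simp only [LinearMap.comp_apply, LinearEquiv.coe_coe] at e ⊢
  have k1 : ∀ z : M ⊗[k] D, (i.rTensor D).lTensor C (TensorProduct.assoc k C M D (l.rTensor D z))
      = TensorProduct.assoc k C N D (l'.rTensor D (i.rTensor D z)) := by
    intro z
    induction z with
    | zero => simp
    | add x y hx hy => simp only [map_add, hx, hy]
    | tmul m d =>
      simp only [LinearMap.rTensor_tmul, ← hl']
      generalize l m = w
      induction w with
      | zero => simp
      | add x y hx hy => simp only [TensorProduct.add_tmul, map_add, hx, hy]
      | tmul a b => simp
  have k2 : ∀ z : C ⊗[k] M, (i.rTensor D).lTensor C (r.lTensor C z)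
      = r'.lTensor C (i.lTensor C z) := by
    intro z
    simp only [← LinearMap.comp_apply, ← LinearMap.lTensor_comp, hr]
  rw [k1, k2, hl', hr', e]

theorem range_rTensor_eqLocus (W : Type u) [AddCommGroup W] [Module k W]
    (f g : M →ₗ[k] N) (x : M ⊗[k] W) (hx : f.rTensor W x = g.rTensor W x) :
    x ∈ LinearMap.range ((LinearMap.eqLocus f g).subtype.rTensor W) := by
  have ex : Function.Exact (LinearMap.eqLocus f g).subtype (f - g) := by
    intro y
    simp [sub_eq_zero]
  apply (Module.Flat.rTensor_exact W ex x).1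
  rw [LinearMap.rTensor_sub, LinearMap.sub_apply, hx, sub_self]

theorem range_lTensor_eqLocus (W : Type u) [AddCommGroup W] [Module k W]
    (f g : M →ₗ[k] N) (x : W ⊗[k] M) (hx : f.lTensor W x = g.lTensor W x) :
    x ∈ LinearMap.range ((LinearMap.eqLocus f g).subtype.lTensor W) := by
  have ex : Function.Exact (LinearMap.eqLocus f g).subtype (f - g) := by
    intro y
    simp [sub_eq_zero]
  apply (Module.Flat.lTensor_exact W ex x).1
  rw [LinearMap.lTensor_sub, LinearMap.sub_apply, hx, sub_self]


section Naturality

variable {M' : Type u} [AddCommGroup M'] [Module k M']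
variable {N' : Type u} [AddCommGroup N'] [Module k N']

theorem tensorRight_lTensor {s : N →ₗ[k] N ⊗[k] D} {s' : N' →ₗ[k] N' ⊗[k] D} (f : N →ₗ[k] N')
    (h : f.rTensor D ∘ₗ s = s' ∘ₗ f) :
    (f.lTensor M).rTensor D ∘ₗ tensorRight M s = tensorRight M s' ∘ₗ f.lTensor M := by
  apply TensorProduct.ext'
  intro m n
  have h' : f.rTensor D (s n) = s' (f n) := LinearMap.congr_fun h n
  simp only [tensorRight, LinearMap.comp_apply, LinearMap.lTensor_tmul, LinearEquiv.coe_coe, ← h']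
  generalize s n = z
  induction z with
  | zero => simp
  | add x y hx hy => simp only [TensorProduct.tmul_add, map_add, hx, hy]
  | tmul a b => simp

theorem tensorRight_rTensor (s : N →ₗ[k] N ⊗[k] D) (f : M →ₗ[k] M') :
    (f.rTensor N).rTensor D ∘ₗ tensorRight M s = tensorRight M' s ∘ₗ f.rTensor N := by
  apply TensorProduct.ext'
  intro m n
  simp only [tensorRight, LinearMap.comp_apply, LinearMap.lTensor_tmul, LinearMap.rTensor_tmul,
    LinearEquiv.coe_coe]
  generalize s n = z
  induction z with
  | zero => simp
  | add x y hx hy => simp only [TensorProduct.tmul_add, map_add, hx, hy]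
  | tmul a b => simp

theorem tensorRight_assoc (s : N →ₗ[k] N ⊗[k] D) :
    (TensorProduct.assoc k M M' N).toLinearMap.rTensor D ∘ₗ tensorRight (M ⊗[k] M') s
      = tensorRight M (tensorRight M' s) ∘ₗ (TensorProduct.assoc k M M' N).toLinearMap := by
  apply TensorProduct.ext'
  intro m n
  induction m with
  | zero => simp
  | add x y hx hy => simp only [TensorProduct.add_tmul, map_add, hx, hy]
  | tmul m m' =>
    simp only [tensorRight, LinearMap.comp_apply, LinearMap.lTensor_tmul, LinearEquiv.coe_coe,
      TensorProduct.assoc_tmul]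
    generalize s n = z
    induction z with
    | zero => simp
    | add x y hx hy => simp only [TensorProduct.tmul_add, map_add, hx, hy]
    | tmul a b => simp

theorem tensorLeft_rTensor {l : M →ₗ[k] C ⊗[k] M} {l' : M' →ₗ[k] C ⊗[k] M'} (f : M →ₗ[k] M')
    (h : f.lTensor C ∘ₗ l = l' ∘ₗ f) :
    (f.rTensor N).lTensor C ∘ₗ tensorLeft N l = tensorLeft N l' ∘ₗ f.rTensor N := by
  apply TensorProduct.ext'
  intro m n
  have h' : f.lTensor C (l m) = l' (f m) := LinearMap.congr_fun h m
  simp only [tensorLeft, LinearMap.comp_apply, LinearMap.rTensor_tmul, LinearEquiv.coe_coe, ← h']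
  generalize l m = z
  induction z with
  | zero => simp
  | add x y hx hy => simp only [TensorProduct.add_tmul, map_add, hx, hy]
  | tmul a b => simp

theorem tensorLeft_lTensor (l : M →ₗ[k] C ⊗[k] M) (f : N →ₗ[k] N') :
    (f.lTensor M).lTensor C ∘ₗ tensorLeft N l = tensorLeft N' l ∘ₗ f.lTensor M := by
  apply TensorProduct.ext'
  intro m n
  simp only [tensorLeft, LinearMap.comp_apply, LinearMap.lTensor_tmul, LinearMap.rTensor_tmul,
    LinearEquiv.coe_coe]
  generalize l m = z
  induction z with
  | zero => simp
  | add x y hx hy => simp only [TensorProduct.add_tmul, map_add, hx, hy]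
  | tmul a b => simp

theorem tensorLeft_assoc (l : M →ₗ[k] C ⊗[k] M) :
    (TensorProduct.assoc k M N N').toLinearMap.lTensor C ∘ₗ tensorLeft N' (tensorLeft N l)
      = tensorLeft (N ⊗[k] N') l ∘ₗ (TensorProduct.assoc k M N N').toLinearMap := by
  apply TensorProduct.ext'
  intro m n'
  induction m with
  | zero => simp
  | add x y hx hy => simp only [TensorProduct.add_tmul, map_add, hx, hy]
  | tmul m n =>
    simp only [tensorLeft, LinearMap.comp_apply, LinearMap.rTensor_tmul, LinearEquiv.coe_coe,
      TensorProduct.assoc_tmul]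
    generalize l m = z
    induction z with
    | zero => simp
    | add x y hx hy => simp only [TensorProduct.add_tmul, map_add, hx, hy]
    | tmul a b => simp

end Naturality

theorem tensorRight_mem {r : M →ₗ[k] M ⊗[k] C} {l : N →ₗ[k] C ⊗[k] N} {s : N →ₗ[k] N ⊗[k] D}
    (h : CoactionsCommute l s) (x : cotensor r l) :
    (tensorRight M s ∘ₗ (cotensor r l).subtype) x
      ∈ LinearMap.range ((cotensor r l).subtype.rTensor D) := by
  apply range_rTensor_eqLocus
  have h1 : l.rTensor D ∘ₗ s = tensorRight C s ∘ₗ l := by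
    rw [tensorRight, LinearMap.comp_assoc, ← h, ← LinearMap.comp_assoc]
    ext; simp
  have e1 := LinearMap.congr_fun (tensorRight_lTensor (M := M) l h1) x
  have e2 := LinearMap.congr_fun (tensorRight_rTensor s r) x
  have e3 := LinearMap.congr_fun (tensorRight_assoc (M := M) (M' := C) s) (r.rTensor N x)
  have e4 := mem_cotensor.1 x.2
  simp only [LinearMap.comp_apply, LinearEquiv.coe_coe, LinearMap.rTensor_comp,
    Submodule.subtype_apply] at e1 e2 e3 ⊢
  rw [e1, e2, e3, e4]

theorem tensorLeft_mem {r : M →ₗ[k] M ⊗[k] D} {l : N →ₗ[k] D ⊗[k] N} {q : M →ₗ[k] C ⊗[k] M}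
    (h : CoactionsCommute q r) (x : cotensor r l) :
    (tensorLeft N q ∘ₗ (cotensor r l).subtype) x
      ∈ LinearMap.range ((cotensor r l).subtype.lTensor C) := by
  apply range_lTensor_eqLocus
  have h1 : r.lTensor C ∘ₗ q = tensorLeft D q ∘ₗ r := by
    rw [tensorLeft, LinearMap.comp_assoc, ← h]
  have e1 := LinearMap.congr_fun (tensorLeft_rTensor (N := N) r h1) x
  have e2 := LinearMap.congr_fun (tensorLeft_lTensor q l) x
  have e3 := LinearMap.congr_fun (tensorLeft_assoc (N := D) (N' := N) q) (r.rTensor N x)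
  have e4 := mem_cotensor.1 x.2
  simp only [LinearMap.comp_apply, LinearEquiv.coe_coe, LinearMap.lTensor_comp,
    Submodule.subtype_apply] at e1 e2 e3 ⊢
  rw [e1, e2, e3, e4]

/-- The right coaction `M ⊗ s`, restricted to `M □_C N`. -/
noncomputable def cotensorRightCoaction (r : M →ₗ[k] M ⊗[k] C) {l : N →ₗ[k] C ⊗[k] N}
    {s : N →ₗ[k] N ⊗[k] D} (h : CoactionsCommute l s) :
    cotensor r l →ₗ[k] cotensor r l ⊗[k] D :=
  (LinearEquiv.ofInjective ((cotensor r l).subtype.rTensor D)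
      (Module.Flat.rTensor_preserves_injective_linearMap _
        (Submodule.injective_subtype _))).symm.toLinearMap ∘ₗ
    (tensorRight M s ∘ₗ (cotensor r l).subtype).codRestrict _ (tensorRight_mem h)

theorem cotensorRightCoaction_spec (r : M →ₗ[k] M ⊗[k] C) {l : N →ₗ[k] C ⊗[k] N}
    {s : N →ₗ[k] N ⊗[k] D} (h : CoactionsCommute l s) :
    (cotensor r l).subtype.rTensor D ∘ₗ cotensorRightCoaction r h
      = tensorRight M s ∘ₗ (cotensor r l).subtype := by
  ext x
  exact congrArg Subtype.val (LinearEquiv.apply_symm_apply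
    (LinearEquiv.ofInjective ((cotensor r l).subtype.rTensor D)
      (Module.Flat.rTensor_preserves_injective_linearMap _ (Submodule.injective_subtype _))) _)

/-- The left coaction `q ⊗ N`, restricted to `M □_D N`. -/
noncomputable def cotensorLeftCoaction {r : M →ₗ[k] M ⊗[k] D} (l : N →ₗ[k] D ⊗[k] N)
    {q : M →ₗ[k] C ⊗[k] M} (h : CoactionsCommute q r) :
    cotensor r l →ₗ[k] C ⊗[k] cotensor r l :=
  (LinearEquiv.ofInjective ((cotensor r l).subtype.lTensor C)
      (Module.Flat.lTensor_preserves_injective_linearMap _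
        (Submodule.injective_subtype _))).symm.toLinearMap ∘ₗ
    (tensorLeft N q ∘ₗ (cotensor r l).subtype).codRestrict _ (tensorLeft_mem h)

theorem cotensorLeftCoaction_spec {r : M →ₗ[k] M ⊗[k] D} (l : N →ₗ[k] D ⊗[k] N)
    {q : M →ₗ[k] C ⊗[k] M} (h : CoactionsCommute q r) :
    (cotensor r l).subtype.lTensor C ∘ₗ cotensorLeftCoaction l h
      = tensorLeft N q ∘ₗ (cotensor r l).subtype := by
  ext x
  exact congrArg Subtype.val (LinearEquiv.apply_symm_apply
    (LinearEquiv.ofInjective ((cotensor r l).subtype.lTensor C)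
      (Module.Flat.lTensor_preserves_injective_linearMap _ (Submodule.injective_subtype _))) _)

/-- The map `f □ g : M □_C N → M' □_C N'`, the restriction of `f ⊗ g`. -/
noncomputable def cotensorMap {M' : Type u} [AddCommGroup M'] [Module k M']
    {N' : Type u} [AddCommGroup N'] [Module k N']
    {r : M →ₗ[k] M ⊗[k] C} {l : N →ₗ[k] C ⊗[k] N}
    {r' : M' →ₗ[k] M' ⊗[k] C} {l' : N' →ₗ[k] C ⊗[k] N'} (f : M →ₗ[k] M') (g : N →ₗ[k] N')
    (hf : f.rTensor C ∘ₗ r = r' ∘ₗ f) (hg : g.lTensor C ∘ₗ l = l' ∘ₗ g) :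
    cotensor r l →ₗ[k] cotensor r' l' :=
  (TensorProduct.map f g).restrict (fun x hx => by
    rw [mem_cotensor] at hx ⊢
    have k1 : ∀ z : M ⊗[k] N, TensorProduct.assoc k M' C N' (r'.rTensor N' (TensorProduct.map f g z))
        = TensorProduct.map f (TensorProduct.map LinearMap.id g)
            (TensorProduct.assoc k M C N (r.rTensor N z)) := by
      intro z
      induction z with
      | zero => simp
      | add x y hx hy => simp only [map_add, hx, hy]
      | tmul m n =>
        have h' : f.rTensor C (r m) = r' (f m) := LinearMap.congr_fun hf m
        simp only [TensorProduct.map_tmul, LinearMap.rTensor_tmul, ← h']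
        generalize r m = w
        induction w with
        | zero => simp
        | add x y hx hy => simp only [TensorProduct.add_tmul, map_add, hx, hy]
        | tmul a b => simp
    have k2 : ∀ z : M ⊗[k] N, l'.lTensor M' (TensorProduct.map f g z)
        = TensorProduct.map f (TensorProduct.map LinearMap.id g) (l.lTensor M z) := by
      intro z
      induction z with
      | zero => simp
      | add x y hx hy => simp only [map_add, hx, hy]
      | tmul m n =>
        have h' : g.lTensor C (l n) = l' (g n) := LinearMap.congr_fun hg n
        simp only [TensorProduct.map_tmul, LinearMap.lTensor_tmul, ← h']
        rfl
    rw [k1, k2, hx])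

theorem cotensorMap_rightColinear {M' : Type u} [AddCommGroup M'] [Module k M']
    {N' : Type u} [AddCommGroup N'] [Module k N']
    {r : M →ₗ[k] M ⊗[k] C} {l : N →ₗ[k] C ⊗[k] N} {s : N →ₗ[k] N ⊗[k] D}
    {r' : M' →ₗ[k] M' ⊗[k] C} {l' : N' →ₗ[k] C ⊗[k] N'} {s' : N' →ₗ[k] N' ⊗[k] D}
    (h : CoactionsCommute l s) (h' : CoactionsCommute l' s')
    (f : M →ₗ[k] M') (g : N →ₗ[k] N')
    (hf : f.rTensor C ∘ₗ r = r' ∘ₗ f) (hg : g.lTensor C ∘ₗ l = l' ∘ₗ g)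
    (hs : g.rTensor D ∘ₗ s = s' ∘ₗ g) :
    (cotensorMap f g hf hg).rTensor D ∘ₗ cotensorRightCoaction r h
      = cotensorRightCoaction r' h' ∘ₗ cotensorMap f g hf hg := by
  apply LinearMap.ext
  intro x
  apply Module.Flat.rTensor_preserves_injective_linearMap (M := D) _
    (Submodule.injective_subtype (cotensor r' l'))
  have e1 := LinearMap.congr_fun (cotensorRightCoaction_spec r h) x
  have e2 := LinearMap.congr_fun (cotensorRightCoaction_spec r' h') (cotensorMap f g hf hg x)
  have e3 := LinearMap.congr_fun (tensorRight_lTensor (M := M') g hs) (f.rTensor N x)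
  have e4 := LinearMap.congr_fun (tensorRight_rTensor s f) x
  have e5 : (cotensor r' l').subtype ∘ₗ cotensorMap f g hf hg
      = (g.lTensor M' ∘ₗ f.rTensor N) ∘ₗ (cotensor r l).subtype := by
    rw [LinearMap.lTensor_comp_rTensor]; rfl
  have e6 := LinearMap.congr_fun e5 x
  simp only [LinearMap.comp_apply, Submodule.subtype_apply] at e1 e2 e3 e4 e6 ⊢
  rw [e2, ← LinearMap.comp_apply, ← LinearMap.rTensor_comp, e5, LinearMap.rTensor_comp,
    LinearMap.comp_apply, e1, LinearMap.rTensor_comp, LinearMap.comp_apply, e4, e3, e6]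

theorem cotensorMap_leftColinear {M' : Type u} [AddCommGroup M'] [Module k M']
    {N' : Type u} [AddCommGroup N'] [Module k N']
    {r : M →ₗ[k] M ⊗[k] D} {l : N →ₗ[k] D ⊗[k] N} {q : M →ₗ[k] C ⊗[k] M}
    {r' : M' →ₗ[k] M' ⊗[k] D} {l' : N' →ₗ[k] D ⊗[k] N'} {q' : M' →ₗ[k] C ⊗[k] M'}
    (h : CoactionsCommute q r) (h' : CoactionsCommute q' r')
    (f : M →ₗ[k] M') (g : N →ₗ[k] N')
    (hf : f.rTensor D ∘ₗ r = r' ∘ₗ f) (hg : g.lTensor D ∘ₗ l = l' ∘ₗ g)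
    (hq : f.lTensor C ∘ₗ q = q' ∘ₗ f) :
    (cotensorMap f g hf hg).lTensor C ∘ₗ cotensorLeftCoaction l h
      = cotensorLeftCoaction l' h' ∘ₗ cotensorMap f g hf hg := by
  apply LinearMap.ext
  intro x
  apply Module.Flat.lTensor_preserves_injective_linearMap (M := C) _
    (Submodule.injective_subtype (cotensor r' l'))
  have e1 := LinearMap.congr_fun (cotensorLeftCoaction_spec l h) x
  have e2 := LinearMap.congr_fun (cotensorLeftCoaction_spec l' h') (cotensorMap f g hf hg x)
  have e3 := LinearMap.congr_fun (tensorLeft_rTensor (N := N') f hq) (g.lTensor M x)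
  have e4 := LinearMap.congr_fun (tensorLeft_lTensor q g) x
  have e5 : (cotensor r' l').subtype ∘ₗ cotensorMap f g hf hg
      = (f.rTensor N' ∘ₗ g.lTensor M) ∘ₗ (cotensor r l).subtype := by
    rw [LinearMap.rTensor_comp_lTensor]; rfl
  have e6 := LinearMap.congr_fun e5 x
  simp only [LinearMap.comp_apply, Submodule.subtype_apply] at e1 e2 e3 e4 e6 ⊢
  rw [e2, ← LinearMap.comp_apply, ← LinearMap.lTensor_comp, e5, LinearMap.lTensor_comp,
    LinearMap.comp_apply, e1, LinearMap.lTensor_comp, LinearMap.comp_apply, e4, e3, e6]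

variable {W : Type u} [AddCommGroup W] [Module k W]

theorem tensorCotensor_mem {N : Type u} [AddCommGroup N] [Module k N]
    {Y : Type u} [AddCommGroup Y] [Module k Y] (r : N →ₗ[k] N ⊗[k] D) (l : Y →ₗ[k] D ⊗[k] Y)
    (z : W ⊗[k] cotensor r l) :
    ((TensorProduct.assoc k W N Y).symm.toLinearMap ∘ₗ (cotensor r l).subtype.lTensor W) z
      ∈ cotensor (tensorRight W r) l := by
  induction z with
  | zero => simp
  | add x y hx hy => rw [map_add]; exact add_mem hx hy
  | tmul w x =>
    have k1 : ∀ z : N ⊗[k] Y, TensorProduct.assoc k (W ⊗[k] N) D Y ((tensorRight W r).rTensor Y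
          ((TensorProduct.assoc k W N Y).symm (w ⊗ₜ z)))
        = (TensorProduct.assoc k W N (D ⊗[k] Y)).symm
          (w ⊗ₜ TensorProduct.assoc k N D Y (r.rTensor Y z)) := by
      intro z
      induction z with
      | zero => simp
      | add x y hx hy => simp only [TensorProduct.tmul_add, map_add, hx, hy]
      | tmul n y =>
        simp only [TensorProduct.assoc_symm_tmul, LinearMap.rTensor_tmul, tensorRight,
          LinearMap.comp_apply, LinearMap.lTensor_tmul, LinearEquiv.coe_coe]
        generalize r n = v
        induction v with
        | zero => simp
        | add x y hx hy => simp only [TensorProduct.tmul_add, TensorProduct.add_tmul, map_add, hx, hy]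
        | tmul a b => simp
    have k2 : ∀ z : N ⊗[k] Y, l.lTensor (W ⊗[k] N) ((TensorProduct.assoc k W N Y).symm (w ⊗ₜ z))
        = (TensorProduct.assoc k W N (D ⊗[k] Y)).symm (w ⊗ₜ l.lTensor N z) := by
      intro z
      induction z with
      | zero => simp
      | add x y hx hy => simp only [TensorProduct.tmul_add, map_add, hx, hy]
      | tmul n y => simp
    rw [mem_cotensor]
    simp only [LinearMap.comp_apply, LinearMap.lTensor_tmul, LinearEquiv.coe_coe,
      Submodule.subtype_apply]
    rw [k1, k2, mem_cotensor.1 x.2]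

theorem tensorCotensor_colinear {N : Type u} [AddCommGroup N] [Module k N]
    {Y : Type u} [AddCommGroup Y] [Module k Y] (r : N →ₗ[k] N ⊗[k] D) {l : Y →ₗ[k] D ⊗[k] Y}
    {s : Y →ₗ[k] Y ⊗[k] C} (h : CoactionsCommute l s) :
    (((TensorProduct.assoc k W N Y).symm.toLinearMap ∘ₗ
        (cotensor r l).subtype.lTensor W).codRestrict _ (tensorCotensor_mem r l)).rTensor C ∘ₗ
        tensorRight W (cotensorRightCoaction r h)
      = cotensorRightCoaction (tensorRight W r) h ∘ₗ
        ((TensorProduct.assoc k W N Y).symm.toLinearMap ∘ₗ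
          (cotensor r l).subtype.lTensor W).codRestrict _ (tensorCotensor_mem r l) := by
  rw [← LinearMap.cancel_left (Module.Flat.rTensor_preserves_injective_linearMap (M := C) _
    (Submodule.injective_subtype (cotensor (tensorRight W r) l))), ← LinearMap.comp_assoc,
    ← LinearMap.comp_assoc, ← LinearMap.rTensor_comp, cotensorRightCoaction_spec,
    LinearMap.comp_assoc, LinearMap.subtype_comp_codRestrict, LinearMap.rTensor_comp,
    LinearMap.comp_assoc, tensorRight_lTensor _ (cotensorRightCoaction_spec r h)]
  have e := tensorRight_assoc (M := W) (M' := N) s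
  apply LinearMap.ext
  intro z
  have e' := LinearMap.congr_fun e
    ((TensorProduct.assoc k W N Y).symm ((cotensor r l).subtype.lTensor W z))
  simp only [LinearMap.comp_apply, LinearEquiv.coe_coe, LinearEquiv.apply_symm_apply] at e' ⊢
  rw [← e', ← LinearMap.comp_apply, ← LinearMap.rTensor_comp]
  simp

theorem coactionsCommute_of_colinear {l : W →ₗ[k] C ⊗[k] W} {r : W →ₗ[k] W ⊗[k] D}
    (h : l.rTensor D ∘ₗ r = tensorRight C r ∘ₗ l) : CoactionsCommute l r := by
  unfold CoactionsCommute
  rw [h, tensorRight, ← LinearMap.comp_assoc, ← LinearMap.comp_assoc]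
  ext
  simp

theorem cotensorTensor_mem {N : Type u} [AddCommGroup N] [Module k N]
    {Y : Type u} [AddCommGroup Y] [Module k Y] (r : Y →ₗ[k] Y ⊗[k] D) (l : N →ₗ[k] D ⊗[k] N)
    (z : cotensor r l ⊗[k] W) :
    ((TensorProduct.assoc k Y N W).toLinearMap ∘ₗ (cotensor r l).subtype.rTensor W) z
      ∈ cotensor r (tensorLeft W l) := by
  induction z with
  | zero => simp
  | add x y hx hy => rw [map_add]; exact add_mem hx hy
  | tmul x w =>
    have k1 : ∀ z : Y ⊗[k] N, (tensorLeft W l).lTensor Y (TensorProduct.assoc k Y N W (z ⊗ₜ w))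
        = (TensorProduct.assoc k D N W).toLinearMap.lTensor Y
          (TensorProduct.assoc k Y (D ⊗[k] N) W (l.lTensor Y z ⊗ₜ w)) := by
      intro z
      induction z with
      | zero => simp
      | add x y hx hy => simp only [TensorProduct.add_tmul, map_add, hx, hy]
      | tmul y n => simp [tensorLeft]
    have k2 : ∀ z : Y ⊗[k] N, TensorProduct.assoc k Y D (N ⊗[k] W)
          (r.rTensor (N ⊗[k] W) (TensorProduct.assoc k Y N W (z ⊗ₜ w)))
        = (TensorProduct.assoc k D N W).toLinearMap.lTensor Y
          (TensorProduct.assoc k Y (D ⊗[k] N) W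
            (TensorProduct.assoc k Y D N (r.rTensor N z) ⊗ₜ w)) := by
      intro z
      induction z with
      | zero => simp
      | add x y hx hy => simp only [TensorProduct.add_tmul, map_add, hx, hy]
      | tmul y n =>
        simp only [TensorProduct.assoc_tmul, LinearMap.rTensor_tmul]
        generalize r y = v
        induction v with
        | zero => simp
        | add x y hx hy => simp only [TensorProduct.add_tmul, map_add, hx, hy]
        | tmul a b => simp
    rw [mem_cotensor]
    simp only [LinearMap.comp_apply, LinearMap.rTensor_tmul, LinearEquiv.coe_coe,
      Submodule.subtype_apply]
    rw [k1, k2, mem_cotensor.1 x.2]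

theorem cotensorTensor_colinear {N : Type u} [AddCommGroup N] [Module k N]
    {Y : Type u} [AddCommGroup Y] [Module k Y] {r : Y →ₗ[k] Y ⊗[k] D} (l : N →ₗ[k] D ⊗[k] N)
    {q : Y →ₗ[k] C ⊗[k] Y} (h : CoactionsCommute q r) :
    (((TensorProduct.assoc k Y N W).toLinearMap ∘ₗ
        (cotensor r l).subtype.rTensor W).codRestrict _ (cotensorTensor_mem r l)).lTensor C ∘ₗ
        tensorLeft W (cotensorLeftCoaction l h)
      = cotensorLeftCoaction (tensorLeft W l) h ∘ₗ
        ((TensorProduct.assoc k Y N W).toLinearMap ∘ₗ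
          (cotensor r l).subtype.rTensor W).codRestrict _ (cotensorTensor_mem r l) := by
  rw [← LinearMap.cancel_left (Module.Flat.lTensor_preserves_injective_linearMap (M := C) _
    (Submodule.injective_subtype (cotensor r (tensorLeft W l)))), ← LinearMap.comp_assoc,
    ← LinearMap.comp_assoc, ← LinearMap.lTensor_comp, cotensorLeftCoaction_spec,
    LinearMap.comp_assoc, LinearMap.subtype_comp_codRestrict, LinearMap.lTensor_comp,
    LinearMap.comp_assoc, tensorLeft_rTensor _ (cotensorLeftCoaction_spec l h),
    ← LinearMap.comp_assoc, tensorLeft_assoc, LinearMap.comp_assoc]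

theorem coactionsCommute_of_leftColinear {l : W →ₗ[k] D ⊗[k] W} {r : W →ₗ[k] W ⊗[k] C}
    (h : r.lTensor D ∘ₗ l = tensorLeft C l ∘ₗ r) : CoactionsCommute l r := by
  unfold CoactionsCommute
  rw [h, tensorLeft, ← LinearMap.comp_assoc]

end Linear

section Coactions

variable {k : Type u} [Field k]
variable {C : Type u} [AddCommGroup C] [Module k C] [Coalgebra k C]
variable {D : Type u} [AddCommGroup D] [Module k D] [Coalgebra k D]
variable {M : Type u} [AddCommGroup M] [Module k M]
variable {N : Type u} [AddCommGroup N] [Module k N]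

/-- `r : M → M ⊗ C` is a coassociative and counital right coaction. -/
structure IsRightCoaction (r : M →ₗ[k] M ⊗[k] C) : Prop where
  coassoc : (TensorProduct.assoc k M C C).toLinearMap ∘ₗ r.rTensor C ∘ₗ r
    = (Coalgebra.comul (R := k) (A := C)).lTensor M ∘ₗ r
  counit : (Coalgebra.counit (R := k) (A := C)).lTensor M ∘ₗ r = (TensorProduct.mk k M k).flip 1

/-- `l : M → C ⊗ M` is a coassociative and counital left coaction. -/
structure IsLeftCoaction (l : M →ₗ[k] C ⊗[k] M) : Prop where
  coassoc : (TensorProduct.assoc k C C M).toLinearMap ∘ₗ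
      (Coalgebra.comul (R := k) (A := C)).rTensor M ∘ₗ l
    = l.lTensor C ∘ₗ l
  counit : (Coalgebra.counit (R := k) (A := C)).rTensor M ∘ₗ l = TensorProduct.mk k k M 1

theorem tensorRight_isRightCoaction {r : N →ₗ[k] N ⊗[k] D} (h : IsRightCoaction r) :
    IsRightCoaction (tensorRight M r) := by
  constructor
  · apply TensorProduct.ext'
    intro m n
    have e := LinearMap.congr_fun h.coassoc n
    have key : ∀ z : N ⊗[k] D,
        TensorProduct.assoc k (M ⊗[k] N) D D ((tensorRight M r).rTensor D
          ((TensorProduct.assoc k M N D).symm (m ⊗ₜ z)))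
        = (TensorProduct.assoc k M N (D ⊗[k] D)).symm
            (m ⊗ₜ (TensorProduct.assoc k N D D (r.rTensor D z))) := by
      intro z
      induction z with
      | zero => simp
      | add x y hx hy => simp only [TensorProduct.tmul_add, map_add, hx, hy]
      | tmul n d =>
        simp only [TensorProduct.assoc_symm_tmul, LinearMap.rTensor_tmul, tensorRight,
          LinearMap.comp_apply, LinearMap.lTensor_tmul, LinearEquiv.coe_coe]
        generalize r n = w
        induction w with
        | zero => simp
        | add x y hx hy => simp only [TensorProduct.tmul_add, TensorProduct.add_tmul, map_add, hx, hy]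
        | tmul a b => simp
    have key2 : ∀ z : N ⊗[k] D,
        (Coalgebra.comul (R := k) (A := D)).lTensor (M ⊗[k] N)
          ((TensorProduct.assoc k M N D).symm (m ⊗ₜ z))
        = (TensorProduct.assoc k M N (D ⊗[k] D)).symm
            (m ⊗ₜ ((Coalgebra.comul (R := k) (A := D)).lTensor N z)) := by
      intro z
      induction z with
      | zero => simp
      | add x y hx hy => simp only [TensorProduct.tmul_add, map_add, hx, hy]
      | tmul n d => simp
    have := key (r n)
    simp only [LinearMap.comp_apply, LinearEquiv.coe_coe] at e
    rw [e, ← key2] at this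
    simpa [tensorRight] using this
  · apply TensorProduct.ext'
    intro m n
    have e := LinearMap.congr_fun h.counit n
    have key2 : ∀ z : N ⊗[k] D,
        (Coalgebra.counit (R := k) (A := D)).lTensor (M ⊗[k] N)
          ((TensorProduct.assoc k M N D).symm (m ⊗ₜ z))
        = (TensorProduct.assoc k M N k).symm
            (m ⊗ₜ ((Coalgebra.counit (R := k) (A := D)).lTensor N z)) := by
      intro z
      induction z with
      | zero => simp
      | add x y hx hy => simp only [TensorProduct.tmul_add, map_add, hx, hy]
      | tmul n d => simp
    simp only [LinearMap.comp_apply] at e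
    have := key2 (r n)
    rw [e] at this
    simpa [tensorRight] using this

theorem tensorLeft_isLeftCoaction {l : M →ₗ[k] C ⊗[k] M} (h : IsLeftCoaction l) :
    IsLeftCoaction (tensorLeft N l) := by
  constructor
  · apply TensorProduct.ext'
    intro m n
    have e := LinearMap.congr_fun h.coassoc m
    have key : ∀ z : C ⊗[k] M,
        (tensorLeft N l).lTensor C (TensorProduct.assoc k C M N (z ⊗ₜ n))
        = (TensorProduct.assoc k C C (M ⊗[k] N)) (TensorProduct.assoc k (C ⊗[k] C) M N
            (((TensorProduct.assoc k C C M).symm (l.lTensor C z)) ⊗ₜ n)) := by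
      intro z
      induction z with
      | zero => simp
      | add x y hx hy => simp only [TensorProduct.add_tmul, map_add, hx, hy]
      | tmul c m =>
        simp only [TensorProduct.assoc_tmul, LinearMap.rTensor_tmul, tensorLeft,
          LinearMap.comp_apply, LinearMap.lTensor_tmul, LinearEquiv.coe_coe]
        generalize l m = w
        induction w with
        | zero => simp
        | add x y hx hy => simp only [TensorProduct.tmul_add, TensorProduct.add_tmul, map_add, hx, hy]
        | tmul a b => simp
    have key2 : ∀ z : C ⊗[k] M,
        (Coalgebra.comul (R := k) (A := C)).rTensor (M ⊗[k] N) (TensorProduct.assoc k C M N (z ⊗ₜ n))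
        = TensorProduct.assoc k (C ⊗[k] C) M N
            (((Coalgebra.comul (R := k) (A := C)).rTensor M z) ⊗ₜ n) := by
      intro z
      induction z with
      | zero => simp
      | add x y hx hy => simp only [TensorProduct.add_tmul, map_add, hx, hy]
      | tmul n d => simp
    have := key (l m)
    simp only [LinearMap.comp_apply, LinearEquiv.coe_coe] at e
    rw [← e, LinearEquiv.symm_apply_apply, ← key2] at this
    simpa [tensorLeft] using this.symm
  · apply TensorProduct.ext'
    intro m n
    have e := LinearMap.congr_fun h.counit m
    have key2 : ∀ z : C ⊗[k] M,
        (Coalgebra.counit (R := k) (A := C)).rTensor (M ⊗[k] N) (TensorProduct.assoc k C M N (z ⊗ₜ n))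
        = TensorProduct.assoc k k M N
            (((Coalgebra.counit (R := k) (A := C)).rTensor M z) ⊗ₜ n) := by
      intro z
      induction z with
      | zero => simp
      | add x y hx hy => simp only [TensorProduct.add_tmul, map_add, hx, hy]
      | tmul n d => simp
    simp only [LinearMap.comp_apply] at e
    have := key2 (l m)
    rw [e] at this
    simpa [tensorLeft] using this


/-- Coactions pull back along injective maps. -/
theorem IsRightCoaction.of_injective {t : M →ₗ[k] M ⊗[k] D} {s : N →ₗ[k] N ⊗[k] D}
    (h : IsRightCoaction s) (i : M →ₗ[k] N) (hi : Function.Injective i)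
    (hc : i.rTensor D ∘ₗ t = s ∘ₗ i) : IsRightCoaction t := by
  have hc' : ∀ x, i.rTensor D (t x) = s (i x) := fun x => LinearMap.congr_fun hc x
  constructor
  · ext x
    apply Module.Flat.rTensor_preserves_injective_linearMap (M := D ⊗[k] D) i hi
    have e := LinearMap.congr_fun h.coassoc (i x)
    simp only [LinearMap.comp_apply, LinearEquiv.coe_coe] at e ⊢
    have k1 : ∀ z : M ⊗[k] D, i.rTensor (D ⊗[k] D) (TensorProduct.assoc k M D D (t.rTensor D z))
        = TensorProduct.assoc k N D D (s.rTensor D (i.rTensor D z)) := by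
      intro z
      induction z with
      | zero => simp
      | add x y hx hy => simp only [map_add, hx, hy]
      | tmul m d =>
        simp only [LinearMap.rTensor_tmul, ← hc']
        generalize t m = w
        induction w with
        | zero => simp
        | add x y hx hy => simp only [TensorProduct.add_tmul, map_add, hx, hy]
        | tmul a b => simp
    have k2 : ∀ z : M ⊗[k] D, i.rTensor (D ⊗[k] D)
          ((Coalgebra.comul (R := k) (A := D)).lTensor M z)
        = (Coalgebra.comul (R := k) (A := D)).lTensor N (i.rTensor D z) := by
      intro z
      simp only [← LinearMap.comp_apply, LinearMap.rTensor_comp_lTensor,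
        LinearMap.lTensor_comp_rTensor]
    rw [k1, k2, hc', e]
  · ext x
    apply Module.Flat.rTensor_preserves_injective_linearMap (M := k) i hi
    have e := LinearMap.congr_fun h.counit (i x)
    simp only [LinearMap.comp_apply] at e ⊢
    rw [← LinearMap.comp_apply (i.rTensor k), LinearMap.rTensor_comp_lTensor,
      ← LinearMap.lTensor_comp_rTensor, LinearMap.comp_apply, hc', e]
    simp

/-- Coactions pull back along injective maps. -/
theorem IsLeftCoaction.of_injective {t : M →ₗ[k] C ⊗[k] M} {s : N →ₗ[k] C ⊗[k] N}
    (h : IsLeftCoaction s) (i : M →ₗ[k] N) (hi : Function.Injective i)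
    (hc : i.lTensor C ∘ₗ t = s ∘ₗ i) : IsLeftCoaction t := by
  have hc' : ∀ x, i.lTensor C (t x) = s (i x) := fun x => LinearMap.congr_fun hc x
  constructor
  · ext x
    apply Module.Flat.lTensor_preserves_injective_linearMap (M := C) _
      (Module.Flat.lTensor_preserves_injective_linearMap (M := C) i hi)
    have e := LinearMap.congr_fun h.coassoc (i x)
    simp only [LinearMap.comp_apply, LinearEquiv.coe_coe] at e ⊢
    have k1 : ∀ z : C ⊗[k] M, (i.lTensor C).lTensor C (t.lTensor C z)
        = s.lTensor C (i.lTensor C z) := by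
      intro z
      simp only [← LinearMap.comp_apply, ← LinearMap.lTensor_comp, hc]
    have k2 : ∀ z : C ⊗[k] M, (i.lTensor C).lTensor C (TensorProduct.assoc k C C M
          ((Coalgebra.comul (R := k) (A := C)).rTensor M z))
        = TensorProduct.assoc k C C N
          ((Coalgebra.comul (R := k) (A := C)).rTensor N (i.lTensor C z)) := by
      intro z
      induction z with
      | zero => simp
      | add x y hx hy => simp only [map_add, hx, hy]
      | tmul c m =>
        simp only [LinearMap.rTensor_tmul, LinearMap.lTensor_tmul]
        generalize Coalgebra.comul (R := k) c = w
        induction w with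
        | zero => simp
        | add x y hx hy => simp only [TensorProduct.add_tmul, map_add, hx, hy]
        | tmul a b => simp
    rw [k1, k2, hc', e]
  · ext x
    apply Module.Flat.lTensor_preserves_injective_linearMap (M := k) i hi
    have e := LinearMap.congr_fun h.counit (i x)
    simp only [LinearMap.comp_apply] at e ⊢
    rw [← LinearMap.comp_apply (i.lTensor k), LinearMap.lTensor_comp_rTensor,
      ← LinearMap.rTensor_comp_lTensor, LinearMap.comp_apply, hc', e]
    simp

end Coactions


section Categories

variable (k : Type u) [Field k]
variable (C : Type u) [AddCommGroup C] [Module k C] [Coalgebra k C]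
variable (D : Type u) [AddCommGroup D] [Module k D] [Coalgebra k D]
variable (E : Type u) [AddCommGroup E] [Module k E] [Coalgebra k E]

/-- A right `C`-comodule. -/
structure RightComod where
  carrier : Type u
  [addCommGroup : AddCommGroup carrier]
  [module : Module k carrier]
  coact : carrier →ₗ[k] carrier ⊗[k] C
  isCoaction : IsRightCoaction coact

/-- A left `C`-comodule. -/
structure LeftComod where
  carrier : Type u
  [addCommGroup : AddCommGroup carrier]
  [module : Module k carrier]
  coact : carrier →ₗ[k] C ⊗[k] carrier
  isCoaction : IsLeftCoaction coact

/-- A `(C, D)`-bicomodule: a left `C`-comodule and right `D`-comodule with commuting coactions. -/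
structure Bicomod where
  carrier : Type u
  [addCommGroup : AddCommGroup carrier]
  [module : Module k carrier]
  coactLeft : carrier →ₗ[k] C ⊗[k] carrier
  coactRight : carrier →ₗ[k] carrier ⊗[k] D
  isLeftCoaction : IsLeftCoaction coactLeft
  isRightCoaction : IsRightCoaction coactRight
  commute : CoactionsCommute coactLeft coactRight

attribute [instance] RightComod.addCommGroup RightComod.module LeftComod.addCommGroup
  LeftComod.module Bicomod.addCommGroup Bicomod.module

variable {k C D E}

/-- The `k`-space of right `C`-colinear maps. -/
def RightComod.colinearMaps (M N : RightComod k C) :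
    Submodule k (M.carrier →ₗ[k] N.carrier) where
  carrier := {f | f.rTensor C ∘ₗ M.coact = N.coact ∘ₗ f}
  add_mem' {f g} hf hg := by
    simp only [Set.mem_ofPred_eq] at *
    rw [LinearMap.rTensor_add, LinearMap.add_comp, LinearMap.comp_add, hf, hg]
  zero_mem' := by simp
  smul_mem' c f hf := by
    simp only [Set.mem_ofPred_eq] at *
    rw [LinearMap.rTensor_smul, LinearMap.smul_comp, LinearMap.comp_smul, hf]

/-- The `k`-space of left `C`-colinear maps. -/
def LeftComod.colinearMaps (M N : LeftComod k C) :
    Submodule k (M.carrier →ₗ[k] N.carrier) where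
  carrier := {f | f.lTensor C ∘ₗ M.coact = N.coact ∘ₗ f}
  add_mem' {f g} hf hg := by
    simp only [Set.mem_ofPred_eq] at *
    rw [LinearMap.lTensor_add, LinearMap.add_comp, LinearMap.comp_add, hf, hg]
  zero_mem' := by simp
  smul_mem' c f hf := by
    simp only [Set.mem_ofPred_eq] at *
    rw [LinearMap.lTensor_smul, LinearMap.smul_comp, LinearMap.comp_smul, hf]

/-- The category of right `C`-comodules and right `C`-colinear maps. -/
instance : Category (RightComod k C) where
  Hom M N := RightComod.colinearMaps M N
  id M := ⟨LinearMap.id, show LinearMap.rTensor C LinearMap.id ∘ₗ M.coact = _ by simp⟩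
  comp {L M N} f g := ⟨g.1 ∘ₗ f.1, show LinearMap.rTensor C (g.1 ∘ₗ f.1) ∘ₗ L.coact = _ by
    rw [LinearMap.rTensor_comp, LinearMap.comp_assoc, show f.1.rTensor C ∘ₗ L.coact = _ from f.2,
      ← LinearMap.comp_assoc, show g.1.rTensor C ∘ₗ M.coact = _ from g.2, LinearMap.comp_assoc]⟩

/-- The category of left `C`-comodules and left `C`-colinear maps. -/
instance : Category (LeftComod k C) where
  Hom M N := LeftComod.colinearMaps M N
  id M := ⟨LinearMap.id, show LinearMap.lTensor C LinearMap.id ∘ₗ M.coact = _ by simp⟩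
  comp {L M N} f g := ⟨g.1 ∘ₗ f.1, show LinearMap.lTensor C (g.1 ∘ₗ f.1) ∘ₗ L.coact = _ by
    rw [LinearMap.lTensor_comp, LinearMap.comp_assoc, show f.1.lTensor C ∘ₗ L.coact = _ from f.2,
      ← LinearMap.comp_assoc, show g.1.lTensor C ∘ₗ M.coact = _ from g.2, LinearMap.comp_assoc]⟩

/-- The category of `(C, D)`-bicomodules and bicolinear maps. -/
instance : Category (Bicomod k C D) where
  Hom M N := {f : M.carrier →ₗ[k] N.carrier //
    f.lTensor C ∘ₗ M.coactLeft = N.coactLeft ∘ₗ f ∧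
    f.rTensor D ∘ₗ M.coactRight = N.coactRight ∘ₗ f}
  id M := ⟨LinearMap.id, by simp, by simp⟩
  comp f g := ⟨g.1 ∘ₗ f.1,
    by rw [LinearMap.lTensor_comp, LinearMap.comp_assoc, f.2.1, ← LinearMap.comp_assoc, g.2.1,
      LinearMap.comp_assoc],
    by rw [LinearMap.rTensor_comp, LinearMap.comp_assoc, f.2.2, ← LinearMap.comp_assoc, g.2.2,
      LinearMap.comp_assoc]⟩

instance : Preadditive (RightComod k C) where
  homGroup M N := inferInstanceAs (AddCommGroup (RightComod.colinearMaps M N))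
  add_comp _ _ _ f g h := Subtype.ext (LinearMap.comp_add f.1 g.1 h.1)
  comp_add _ _ _ f g h := Subtype.ext (LinearMap.add_comp f.1 h.1 g.1)

instance : Preadditive (LeftComod k C) where
  homGroup M N := inferInstanceAs (AddCommGroup (LeftComod.colinearMaps M N))
  add_comp _ _ _ f g h := Subtype.ext (LinearMap.comp_add f.1 g.1 h.1)
  comp_add _ _ _ f g h := Subtype.ext (LinearMap.add_comp f.1 h.1 g.1)

instance : Linear k (RightComod k C) where
  homModule M N := inferInstanceAs (Module k (RightComod.colinearMaps M N))
  smul_comp _ _ _ c f g := Subtype.ext (LinearMap.comp_smul g.1 c f.1)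
  comp_smul _ _ _ f c g := Subtype.ext (LinearMap.smul_comp c g.1 f.1)

instance : Linear k (LeftComod k C) where
  homModule M N := inferInstanceAs (Module k (LeftComod.colinearMaps M N))
  smul_comp _ _ _ c f g := Subtype.ext (LinearMap.comp_smul g.1 c f.1)
  comp_smul _ _ _ f c g := Subtype.ext (LinearMap.smul_comp c g.1 f.1)

theorem RightComod.hom_ext {M N : RightComod k C} {f g : M ⟶ N} (h : ∀ x, f.1 x = g.1 x) : f = g :=
  Subtype.ext (LinearMap.ext h)

theorem LeftComod.hom_ext {M N : LeftComod k C} {f g : M ⟶ N} (h : ∀ x, f.1 x = g.1 x) : f = g :=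
  Subtype.ext (LinearMap.ext h)

/-- The left comodule underlying a bicomodule. -/
@[simps] def Bicomod.toLeft (X : Bicomod k C D) : LeftComod k C where
  carrier := X.carrier
  coact := X.coactLeft
  isCoaction := X.isLeftCoaction

/-- The right comodule underlying a bicomodule. -/
@[simps] def Bicomod.toRight (X : Bicomod k C D) : RightComod k D where
  carrier := X.carrier
  coact := X.coactRight
  isCoaction := X.isRightCoaction

variable (k C) in
/-- The coalgebra `C` as a `(C, C)`-bicomodule. -/
def Bicomod.regular : Bicomod k C C where
  carrier := C
  coactLeft := Coalgebra.comul
  coactRight := Coalgebra.comul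
  isLeftCoaction := ⟨Coalgebra.coassoc, Coalgebra.rTensor_counit_comp_comul⟩
  isRightCoaction := ⟨Coalgebra.coassoc, Coalgebra.lTensor_counit_comp_comul⟩
  commute := Coalgebra.coassoc

variable (k C D) in
/-- The zero bicomodule. -/
def Bicomod.zero : Bicomod k C D where
  carrier := PUnit
  coactLeft := 0
  coactRight := 0
  isLeftCoaction := ⟨by simp, LinearMap.ext fun _ => Subsingleton.elim _ _⟩
  isRightCoaction := ⟨by simp, LinearMap.ext fun _ => Subsingleton.elim _ _⟩
  commute := by simp [CoactionsCommute]

/-- The right `D`-comodule `M □_C X`. -/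
noncomputable def RightComod.cotensor (M : RightComod k C) (X : Bicomod k C D) :
    RightComod k D where
  carrier := FrobeniusComod.cotensor M.coact X.coactLeft
  coact := cotensorRightCoaction M.coact X.commute
  isCoaction := (tensorRight_isRightCoaction X.isRightCoaction).of_injective _
    (Submodule.injective_subtype _) (cotensorRightCoaction_spec M.coact X.commute)

/-- The left `C`-comodule `X □_D M`. -/
noncomputable def LeftComod.cotensor (X : Bicomod k C D) (M : LeftComod k D) :
    LeftComod k C where
  carrier := FrobeniusComod.cotensor X.coactRight M.coact
  coact := cotensorLeftCoaction M.coact X.commute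
  isCoaction := (tensorLeft_isLeftCoaction X.isLeftCoaction).of_injective _
    (Submodule.injective_subtype _) (cotensorLeftCoaction_spec M.coact X.commute)

/-- The functor `- □_C X` from right `C`-comodules to right `D`-comodules. -/
noncomputable def cotensorRightFunctor (X : Bicomod k C D) : RightComod k C ⥤ RightComod k D where
  obj M := M.cotensor X
  map f := ⟨cotensorMap f.1 LinearMap.id f.2 (by simp),
    cotensorMap_rightColinear X.commute X.commute _ _ _ _ (by simp)⟩
  map_id _ := Subtype.ext (LinearMap.ext fun x => Subtype.ext
    (LinearMap.congr_fun (TensorProduct.map_id (R := k)) x.1))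
  map_comp f g := Subtype.ext (LinearMap.ext fun x => Subtype.ext
    (LinearMap.congr_fun (TensorProduct.map_comp g.1 LinearMap.id f.1 LinearMap.id) x.1))

/-- The functor `X □_D -` from left `D`-comodules to left `C`-comodules. -/
noncomputable def cotensorLeftFunctor (X : Bicomod k C D) : LeftComod k D ⥤ LeftComod k C where
  obj M := LeftComod.cotensor X M
  map f := ⟨cotensorMap LinearMap.id f.1 (by simp) f.2,
    cotensorMap_leftColinear X.commute X.commute _ _ _ _ (by simp)⟩
  map_id _ := Subtype.ext (LinearMap.ext fun x => Subtype.ext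
    (LinearMap.congr_fun (TensorProduct.map_id (R := k)) x.1))
  map_comp f g := Subtype.ext (LinearMap.ext fun x => Subtype.ext
    (LinearMap.congr_fun (TensorProduct.map_comp LinearMap.id g.1 LinearMap.id f.1) x.1))

/-- The bicomodule `X □_D Y`. -/
noncomputable def Bicomod.cotensor (X : Bicomod k C D) (Y : Bicomod k D E) : Bicomod k C E where
  carrier := FrobeniusComod.cotensor X.coactRight Y.coactLeft
  coactLeft := cotensorLeftCoaction Y.coactLeft X.commute
  coactRight := cotensorRightCoaction X.coactRight Y.commute
  isLeftCoaction := (tensorLeft_isLeftCoaction X.isLeftCoaction).of_injective _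
    (Submodule.injective_subtype _) (cotensorLeftCoaction_spec Y.coactLeft X.commute)
  isRightCoaction := (tensorRight_isRightCoaction Y.isRightCoaction).of_injective _
    (Submodule.injective_subtype _) (cotensorRightCoaction_spec X.coactRight Y.commute)
  commute := (tensor_coactionsCommute X.coactLeft Y.coactRight).of_injective _
    (Submodule.injective_subtype _) (cotensorLeftCoaction_spec Y.coactLeft X.commute)
    (cotensorRightCoaction_spec X.coactRight Y.commute)

/-- The bicolinear map `f □ g`. -/
noncomputable def Bicomod.cotensorMap {X X' : Bicomod k C D} {Y Y' : Bicomod k D E}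
    (f : X ⟶ X') (g : Y ⟶ Y') : X.cotensor Y ⟶ X'.cotensor Y' :=
  ⟨FrobeniusComod.cotensorMap f.1 g.1 f.2.2 g.2.1,
    cotensorMap_leftColinear X.commute X'.commute _ _ _ _ f.2.1,
    cotensorMap_rightColinear Y.commute Y'.commute _ _ _ _ g.2.2⟩

end Categories
section CoHom

variable {k : Type u} [Field k]
variable {C : Type u} [AddCommGroup C] [Module k C] [Coalgebra k C]
variable {D : Type u} [AddCommGroup D] [Module k D] [Coalgebra k D]
variable {W W' : Type u} [AddCommGroup W] [Module k W] [AddCommGroup W'] [Module k W']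

variable (W) in
/-- For a vector space `W`, the functor `W ⊗ -` on right comodules. -/
noncomputable def RightComod.tensor : RightComod k C ⥤ RightComod k C where
  obj M :=
    { carrier := W ⊗[k] M.carrier
      coact := tensorRight W M.coact
      isCoaction := tensorRight_isRightCoaction M.isCoaction }
  map f := ⟨f.1.lTensor W, tensorRight_lTensor f.1 f.2⟩
  map_id M := Subtype.ext (LinearMap.lTensor_id W M.carrier)
  map_comp f g := Subtype.ext (LinearMap.lTensor_comp W g.1 f.1)

/-- The colinear map `W ⊗ M → W' ⊗ M` induced by a linear map `W → W'`. -/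
noncomputable def RightComod.tensorMap (f : W →ₗ[k] W') (M : RightComod k C) :
    (RightComod.tensor W).obj M ⟶ (RightComod.tensor W').obj M :=
  ⟨f.rTensor M.carrier, tensorRight_rTensor M.coact f⟩

/-- The associativity map `(W ⊗ W') ⊗ M → W ⊗ (W' ⊗ M)`. -/
noncomputable def RightComod.tensorAssoc (W W' : Type u) [AddCommGroup W] [Module k W]
    [AddCommGroup W'] [Module k W'] (M : RightComod k C) : (RightComod.tensor (W ⊗[k] W')).obj M ⟶
      (RightComod.tensor W).obj ((RightComod.tensor W').obj M) :=
  ⟨(TensorProduct.assoc k W W' M.carrier).toLinearMap, tensorRight_assoc M.coact⟩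

/-- The colinear map `m ↦ 1 ⊗ m`. -/
noncomputable def RightComod.tensorUnit (M : RightComod k C) :
    M ⟶ (RightComod.tensor k).obj M :=
  ⟨TensorProduct.mk k k M.carrier 1, by
    apply LinearMap.ext
    intro m
    change (TensorProduct.mk k k M.carrier 1).rTensor C (M.coact m) =
      (TensorProduct.assoc k k M.carrier C).symm (1 ⊗ₜ[k] M.coact m)
    generalize M.coact m = z
    induction z with
    | zero => simp
    | add x y hx hy => simp only [TensorProduct.tmul_add, map_add, hx, hy]
    | tmul a b => simp⟩

theorem comul_colinear : (Coalgebra.comul (R := k) (A := C)).rTensor C ∘ₗ Coalgebra.comul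
    = tensorRight C Coalgebra.comul ∘ₗ Coalgebra.comul := by
  rw [tensorRight, LinearMap.comp_assoc]
  exact Coalgebra.coassoc_symm.symm

/-- The comultiplication, as a colinear map `C → C ⊗ C` of right comodules. -/
noncomputable def RightComod.comulHom : (Bicomod.regular k C).toRight ⟶
    (RightComod.tensor C).obj (Bicomod.regular k C).toRight :=
  ⟨(Coalgebra.comul : C →ₗ[k] C ⊗[k] C), comul_colinear (k := k) (C := C)⟩

/-- The canonical map `W ⊗ (N □_D Y) → (W ⊗ N) □_D Y`, `w ⊗ (n ⊗ y) ↦ (w ⊗ n) ⊗ y`. -/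
noncomputable def tensorCotensor (W : Type u) [AddCommGroup W] [Module k W] (Y : Bicomod k D C)
    (N : RightComod k D) : (RightComod.tensor W).obj ((cotensorRightFunctor Y).obj N) ⟶
      (cotensorRightFunctor Y).obj ((RightComod.tensor W).obj N) :=
  ⟨((TensorProduct.assoc k W N.carrier Y.carrier).symm.toLinearMap ∘ₗ
      (cotensor N.coact Y.coactLeft).subtype.lTensor W).codRestrict _
      (tensorCotensor_mem N.coact Y.coactLeft),
    tensorCotensor_colinear N.coact Y.commute⟩

theorem tensorCotensor_val (Y : Bicomod k D C) (N : RightComod k D)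
    (z : W ⊗[k] cotensor N.coact Y.coactLeft) :
    ((tensorCotensor W Y N).1 z).1 = (TensorProduct.assoc k W N.carrier Y.carrier).symm
      ((cotensor N.coact Y.coactLeft).subtype.lTensor W z) := rfl

theorem tensorCotensor_natural (Y : Bicomod k D C) {N N' : RightComod k D} (f : N ⟶ N') :
    tensorCotensor W Y N ≫ (cotensorRightFunctor Y).map ((RightComod.tensor W).map f)
      = (RightComod.tensor W).map ((cotensorRightFunctor Y).map f) ≫ tensorCotensor W Y N' := by
  refine Subtype.ext (TensorProduct.ext' fun w x => Subtype.ext ?_)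
  change TensorProduct.map (f.1.lTensor W) LinearMap.id
      ((TensorProduct.assoc k W N.carrier Y.carrier).symm (w ⊗ₜ x.1))
    = (TensorProduct.assoc k W N'.carrier Y.carrier).symm
      (w ⊗ₜ TensorProduct.map f.1 LinearMap.id x.1)
  generalize x.1 = z
  induction z with
  | zero => simp
  | add x y hx hy => simp only [TensorProduct.tmul_add, map_add, hx, hy]
  | tmul a b => simp

theorem tensorCotensor_natural_left (Y : Bicomod k D C) (N : RightComod k D) (f : W →ₗ[k] W') :
    tensorCotensor W Y N ≫ (cotensorRightFunctor Y).map (RightComod.tensorMap f N)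
      = RightComod.tensorMap f ((cotensorRightFunctor Y).obj N) ≫ tensorCotensor W' Y N := by
  refine Subtype.ext (TensorProduct.ext' fun w x => Subtype.ext ?_)
  change TensorProduct.map (f.rTensor N.carrier) LinearMap.id
      ((TensorProduct.assoc k W N.carrier Y.carrier).symm (w ⊗ₜ x.1))
    = (TensorProduct.assoc k W' N.carrier Y.carrier).symm (f w ⊗ₜ x.1)
  generalize x.1 = z
  induction z with
  | zero => simp
  | add x y hx hy => simp only [TensorProduct.tmul_add, map_add, hx, hy]
  | tmul a b => simp

theorem tensorCotensor_unit (Y : Bicomod k D C) (N : RightComod k D) :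
    RightComod.tensorUnit ((cotensorRightFunctor Y).obj N) ≫ tensorCotensor k Y N
      = (cotensorRightFunctor Y).map (RightComod.tensorUnit N) := by
  refine Subtype.ext (LinearMap.ext fun x => Subtype.ext ?_)
  change (TensorProduct.assoc k k N.carrier Y.carrier).symm (1 ⊗ₜ x.1)
    = TensorProduct.map (TensorProduct.mk k k N.carrier 1) LinearMap.id x.1
  generalize x.1 = z
  induction z with
  | zero => simp
  | add x y hx hy => simp only [TensorProduct.tmul_add, map_add, hx, hy]
  | tmul a b => simp

theorem tensorCotensor_assoc (Y : Bicomod k D C) (N : RightComod k D) :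
    tensorCotensor (W ⊗[k] W') Y N ≫ (cotensorRightFunctor Y).map (RightComod.tensorAssoc W W' N)
      = RightComod.tensorAssoc W W' ((cotensorRightFunctor Y).obj N) ≫
        (RightComod.tensor W).map (tensorCotensor W' Y N) ≫
        tensorCotensor W Y ((RightComod.tensor W').obj N) := by
  refine Subtype.ext (TensorProduct.ext_threefold fun w w' x => Subtype.ext ?_)
  change TensorProduct.map (TensorProduct.assoc k W W' N.carrier).toLinearMap LinearMap.id
      ((TensorProduct.assoc k (W ⊗[k] W') N.carrier Y.carrier).symm ((w ⊗ₜ w') ⊗ₜ x.1))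
    = (TensorProduct.assoc k W (W' ⊗[k] N.carrier) Y.carrier).symm
      (w ⊗ₜ (TensorProduct.assoc k W' N.carrier Y.carrier).symm (w' ⊗ₜ x.1))
  generalize x.1 = z
  induction z with
  | zero => simp
  | add x y hx hy => simp only [TensorProduct.tmul_add, map_add, hx, hy]
  | tmul a b => simp

/-- The unit of the adjunction `F ⊣ - □_D Y` at `C`, as a map `C → F(C) □_D Y`. -/
noncomputable def coHomUnit (Y : Bicomod k D C) {F : RightComod k C ⥤ RightComod k D}
    (adj : F ⊣ cotensorRightFunctor Y) : (Bicomod.regular k C).toRight ⟶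
      (cotensorRightFunctor Y).obj (F.obj (Bicomod.regular k C).toRight) :=
  adj.unit.app (Bicomod.regular k C).toRight

/-- Given a left adjoint `F` of `- □_D Y`, the left coaction `F(C) → C ⊗ F(C)`: the colinear map
whose transpose is `C → C ⊗ C → C ⊗ (F(C) □_D Y) → (C ⊗ F(C)) □_D Y`. -/
noncomputable def coHomCoaction (Y : Bicomod k D C) {F : RightComod k C ⥤ RightComod k D}
    (adj : F ⊣ cotensorRightFunctor Y) : F.obj (Bicomod.regular k C).toRight ⟶
      (RightComod.tensor C).obj (F.obj (Bicomod.regular k C).toRight) :=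
  (adj.homEquiv _ _).symm (RightComod.comulHom ≫ (RightComod.tensor C).map (coHomUnit Y adj) ≫
      tensorCotensor C Y (F.obj (Bicomod.regular k C).toRight))

theorem coHomUnit_comp (Y : Bicomod k D C) {F : RightComod k C ⥤ RightComod k D}
    (adj : F ⊣ cotensorRightFunctor Y) {N : RightComod k D}
    (f : F.obj (Bicomod.regular k C).toRight ⟶ N) :
    adj.homEquiv _ _ f = coHomUnit Y adj ≫ (cotensorRightFunctor Y).map f :=
  Adjunction.homEquiv_unit ..

theorem coHomUnit_coHomCoaction (Y : Bicomod k D C) {F : RightComod k C ⥤ RightComod k D}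
    (adj : F ⊣ cotensorRightFunctor Y) :
    coHomUnit Y adj ≫ (cotensorRightFunctor Y).map (coHomCoaction Y adj) =
      RightComod.comulHom ≫ (RightComod.tensor C).map (coHomUnit Y adj) ≫
        tensorCotensor C Y (F.obj (Bicomod.regular k C).toRight) := by
  rw [← coHomUnit_comp, coHomCoaction, Equiv.apply_symm_apply]

theorem coHomCoaction_counit (Y : Bicomod k D C) {F : RightComod k C ⥤ RightComod k D}
    (adj : F ⊣ cotensorRightFunctor Y) :
    coHomCoaction Y adj ≫ RightComod.tensorMap Coalgebra.counit _ = RightComod.tensorUnit _ := by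
  apply (adj.homEquiv _ _).injective
  have h1 : (RightComod.comulHom (k := k) (C := C)) ≫
      RightComod.tensorMap Coalgebra.counit _ = RightComod.tensorUnit _ :=
    Subtype.ext (Coalgebra.rTensor_counit_comp_comul (R := k) (A := C))
  have h2 : ∀ {M N : RightComod k C} (f : M ⟶ N), (RightComod.tensor C).map f ≫
      RightComod.tensorMap (W' := k) Coalgebra.counit _
        = RightComod.tensorMap Coalgebra.counit _ ≫ (RightComod.tensor k).map f := by
    intro M N f
    exact Subtype.ext (TensorProduct.ext' fun c m => rfl)
  have h3 : ∀ {M N : RightComod k C} (f : M ⟶ N), RightComod.tensorUnit M ≫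
      (RightComod.tensor k).map f = f ≫ RightComod.tensorUnit N := by
    intro M N f
    exact Subtype.ext (LinearMap.ext fun m => rfl)
  rw [coHomUnit_comp, coHomUnit_comp, Functor.map_comp, reassoc_of% coHomUnit_coHomCoaction Y adj,
    tensorCotensor_natural_left, ← tensorCotensor_unit, reassoc_of% h2, reassoc_of% h1,
    reassoc_of% h3]

theorem coHomCoaction_coassoc (Y : Bicomod k D C) {F : RightComod k C ⥤ RightComod k D}
    (adj : F ⊣ cotensorRightFunctor Y) :
    coHomCoaction Y adj ≫ RightComod.tensorMap Coalgebra.comul _ ≫ RightComod.tensorAssoc C C _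
      = coHomCoaction Y adj ≫ (RightComod.tensor C).map (coHomCoaction Y adj) := by
  apply (adj.homEquiv _ _).injective
  have h1 : (RightComod.comulHom (k := k) (C := C)) ≫
      RightComod.tensorMap Coalgebra.comul _ ≫ RightComod.tensorAssoc C C _ =
      RightComod.comulHom ≫ (RightComod.tensor C).map RightComod.comulHom :=
    Subtype.ext (Coalgebra.coassoc (R := k) (A := C))
  have h2 : ∀ {M N : RightComod k C} (f : M ⟶ N), (RightComod.tensor C).map f ≫
      RightComod.tensorMap (W' := C ⊗[k] C) Coalgebra.comul _
        = RightComod.tensorMap Coalgebra.comul _ ≫ (RightComod.tensor (C ⊗[k] C)).map f := by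
    intro M N f
    exact Subtype.ext (TensorProduct.ext' fun c m => rfl)
  have h3 : ∀ {M N : RightComod k C} (f : M ⟶ N), (RightComod.tensor (C ⊗[k] C)).map f ≫
      RightComod.tensorAssoc C C N = RightComod.tensorAssoc C C M ≫
        (RightComod.tensor C).map ((RightComod.tensor C).map f) := by
    intro M N f
    exact Subtype.ext (TensorProduct.ext_threefold fun c c' m => rfl)
  have h4 := coHomUnit_coHomCoaction Y adj
  rw [coHomUnit_comp, coHomUnit_comp, Functor.map_comp, Functor.map_comp, Functor.map_comp,
    reassoc_of% h4, reassoc_of% h4, tensorCotensor_natural,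
    reassoc_of% (tensorCotensor_natural_left Y), tensorCotensor_assoc, reassoc_of% h2,
    reassoc_of% h3, reassoc_of% h1, ← Functor.map_comp_assoc, ← Functor.map_comp_assoc,
    ← Functor.map_comp_assoc, h4]
  simp only [Category.assoc]

/-- The `(C, D)`-bicomodule `F(C)`, for a left adjoint `F` of `- □_D Y`. -/
noncomputable def coHomOfAdjunction (Y : Bicomod k D C) {F : RightComod k C ⥤ RightComod k D}
    (adj : F ⊣ cotensorRightFunctor Y) : Bicomod k C D where
  carrier := (F.obj (Bicomod.regular k C).toRight).carrier
  coactLeft := (coHomCoaction Y adj).1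
  coactRight := (F.obj (Bicomod.regular k C).toRight).coact
  isLeftCoaction := ⟨congrArg Subtype.val (coHomCoaction_coassoc Y adj),
    congrArg Subtype.val (coHomCoaction_counit Y adj)⟩
  isRightCoaction := (F.obj (Bicomod.regular k C).toRight).isCoaction
  commute := coactionsCommute_of_colinear (coHomCoaction Y adj).2

end CoHom

section LeftCoHom

variable {k : Type u} [Field k]
variable {C : Type u} [AddCommGroup C] [Module k C] [Coalgebra k C]
variable {D : Type u} [AddCommGroup D] [Module k D] [Coalgebra k D]
variable {W W' : Type u} [AddCommGroup W] [Module k W] [AddCommGroup W'] [Module k W']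

variable (W) in
/-- For a vector space `W`, the functor `- ⊗ W` on left comodules. -/
noncomputable def LeftComod.tensor : LeftComod k C ⥤ LeftComod k C where
  obj M :=
    { carrier := M.carrier ⊗[k] W
      coact := tensorLeft W M.coact
      isCoaction := tensorLeft_isLeftCoaction M.isCoaction }
  map f := ⟨f.1.rTensor W, tensorLeft_rTensor f.1 f.2⟩
  map_id M := Subtype.ext (LinearMap.rTensor_id W M.carrier)
  map_comp f g := Subtype.ext (LinearMap.rTensor_comp W g.1 f.1)

/-- The colinear map `M ⊗ W → M ⊗ W'` induced by a linear map `W → W'`. -/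
noncomputable def LeftComod.tensorMap (f : W →ₗ[k] W') (M : LeftComod k C) :
    (LeftComod.tensor W).obj M ⟶ (LeftComod.tensor W').obj M :=
  ⟨f.lTensor M.carrier, tensorLeft_lTensor M.coact f⟩

/-- The associativity map `(M ⊗ W) ⊗ W' → M ⊗ (W ⊗ W')`. -/
noncomputable def LeftComod.tensorAssoc (W W' : Type u) [AddCommGroup W] [Module k W]
    [AddCommGroup W'] [Module k W'] (M : LeftComod k C) :
    (LeftComod.tensor W').obj ((LeftComod.tensor W).obj M) ⟶
      (LeftComod.tensor (W ⊗[k] W')).obj M :=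
  ⟨(TensorProduct.assoc k M.carrier W W').toLinearMap, tensorLeft_assoc M.coact⟩

/-- The colinear map `m ↦ m ⊗ 1`. -/
noncomputable def LeftComod.tensorUnit (M : LeftComod k C) :
    M ⟶ (LeftComod.tensor k).obj M :=
  ⟨(TensorProduct.mk k M.carrier k).flip 1, by
    apply LinearMap.ext
    intro m
    change ((TensorProduct.mk k M.carrier k).flip 1).lTensor C (M.coact m) =
      (TensorProduct.assoc k C M.carrier k) (M.coact m ⊗ₜ[k] 1)
    generalize M.coact m = z
    induction z with
    | zero => simp
    | add x y hx hy => simp only [TensorProduct.add_tmul, map_add, hx, hy]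
    | tmul a b => simp⟩

/-- The comultiplication, as a colinear map `C → C ⊗ C` of left comodules. -/
noncomputable def LeftComod.comulHom : (Bicomod.regular k C).toLeft ⟶
    (LeftComod.tensor C).obj (Bicomod.regular k C).toLeft :=
  ⟨(Coalgebra.comul : C →ₗ[k] C ⊗[k] C), (Coalgebra.coassoc (R := k) (A := C)).symm⟩

/-- The canonical map `(Y □_D N) ⊗ W → Y □_D (N ⊗ W)`, `(y ⊗ n) ⊗ w ↦ y ⊗ (n ⊗ w)`. -/
noncomputable def cotensorTensor (W : Type u) [AddCommGroup W] [Module k W] (Y : Bicomod k C D)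
    (N : LeftComod k D) : (LeftComod.tensor W).obj ((cotensorLeftFunctor Y).obj N) ⟶
      (cotensorLeftFunctor Y).obj ((LeftComod.tensor W).obj N) :=
  ⟨((TensorProduct.assoc k Y.carrier N.carrier W).toLinearMap ∘ₗ
      (cotensor Y.coactRight N.coact).subtype.rTensor W).codRestrict _
      (cotensorTensor_mem Y.coactRight N.coact),
    cotensorTensor_colinear N.coact Y.commute⟩

theorem cotensorTensor_natural (Y : Bicomod k C D) {N N' : LeftComod k D} (f : N ⟶ N') :
    cotensorTensor W Y N ≫ (cotensorLeftFunctor Y).map ((LeftComod.tensor W).map f)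
      = (LeftComod.tensor W).map ((cotensorLeftFunctor Y).map f) ≫ cotensorTensor W Y N' := by
  refine Subtype.ext (TensorProduct.ext' fun x w => Subtype.ext ?_)
  change TensorProduct.map LinearMap.id (f.1.rTensor W)
      (TensorProduct.assoc k Y.carrier N.carrier W (x.1 ⊗ₜ w))
    = TensorProduct.assoc k Y.carrier N'.carrier W
      (TensorProduct.map LinearMap.id f.1 x.1 ⊗ₜ w)
  generalize x.1 = z
  induction z with
  | zero => simp
  | add x y hx hy => simp only [TensorProduct.add_tmul, map_add, hx, hy]
  | tmul a b => simp

theorem cotensorTensor_natural_right (Y : Bicomod k C D) (N : LeftComod k D) (f : W →ₗ[k] W') :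
    cotensorTensor W Y N ≫ (cotensorLeftFunctor Y).map (LeftComod.tensorMap f N)
      = LeftComod.tensorMap f ((cotensorLeftFunctor Y).obj N) ≫ cotensorTensor W' Y N := by
  refine Subtype.ext (TensorProduct.ext' fun x w => Subtype.ext ?_)
  change TensorProduct.map LinearMap.id (f.lTensor N.carrier)
      (TensorProduct.assoc k Y.carrier N.carrier W (x.1 ⊗ₜ w))
    = TensorProduct.assoc k Y.carrier N.carrier W' (x.1 ⊗ₜ f w)
  generalize x.1 = z
  induction z with
  | zero => simp
  | add x y hx hy => simp only [TensorProduct.add_tmul, map_add, hx, hy]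
  | tmul a b => simp

theorem cotensorTensor_unit (Y : Bicomod k C D) (N : LeftComod k D) :
    LeftComod.tensorUnit ((cotensorLeftFunctor Y).obj N) ≫ cotensorTensor k Y N
      = (cotensorLeftFunctor Y).map (LeftComod.tensorUnit N) := by
  refine Subtype.ext (LinearMap.ext fun x => Subtype.ext ?_)
  change TensorProduct.assoc k Y.carrier N.carrier k (x.1 ⊗ₜ 1)
    = TensorProduct.map LinearMap.id ((TensorProduct.mk k N.carrier k).flip 1) x.1
  generalize x.1 = z
  induction z with
  | zero => simp
  | add x y hx hy => simp only [TensorProduct.add_tmul, map_add, hx, hy]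
  | tmul a b => simp

theorem cotensorTensor_assoc (Y : Bicomod k C D) (N : LeftComod k D) :
    (LeftComod.tensor W').map (cotensorTensor W Y N) ≫
        cotensorTensor W' Y ((LeftComod.tensor W).obj N) ≫
        (cotensorLeftFunctor Y).map (LeftComod.tensorAssoc W W' N)
      = LeftComod.tensorAssoc W W' ((cotensorLeftFunctor Y).obj N) ≫
        cotensorTensor (W ⊗[k] W') Y N := by
  refine Subtype.ext (TensorProduct.ext_threefold fun x w w' => Subtype.ext ?_)
  change TensorProduct.map LinearMap.id (TensorProduct.assoc k N.carrier W W').toLinearMap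
      (TensorProduct.assoc k Y.carrier (N.carrier ⊗[k] W) W'
        (TensorProduct.assoc k Y.carrier N.carrier W (x.1 ⊗ₜ w) ⊗ₜ w'))
    = TensorProduct.assoc k Y.carrier N.carrier (W ⊗[k] W') (x.1 ⊗ₜ (w ⊗ₜ w'))
  generalize x.1 = z
  induction z with
  | zero => simp
  | add x y hx hy => simp only [TensorProduct.add_tmul, map_add, hx, hy]
  | tmul a b => simp

/-- The unit of the adjunction `F ⊣ Y □_D -` at `C`, as a map `C → Y □_D F(C)`. -/
noncomputable def leftCoHomUnit (Y : Bicomod k C D) {F : LeftComod k C ⥤ LeftComod k D}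
    (adj : F ⊣ cotensorLeftFunctor Y) : (Bicomod.regular k C).toLeft ⟶
      (cotensorLeftFunctor Y).obj (F.obj (Bicomod.regular k C).toLeft) :=
  adj.unit.app (Bicomod.regular k C).toLeft

/-- Given a left adjoint `F` of `Y □_D -`, the right coaction `F(C) → F(C) ⊗ C`: the colinear map
whose transpose is `C → C ⊗ C → (Y □_D F(C)) ⊗ C → Y □_D (F(C) ⊗ C)`. -/
noncomputable def leftCoHomCoaction (Y : Bicomod k C D) {F : LeftComod k C ⥤ LeftComod k D}
    (adj : F ⊣ cotensorLeftFunctor Y) : F.obj (Bicomod.regular k C).toLeft ⟶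
      (LeftComod.tensor C).obj (F.obj (Bicomod.regular k C).toLeft) :=
  (adj.homEquiv _ _).symm (LeftComod.comulHom ≫ (LeftComod.tensor C).map (leftCoHomUnit Y adj) ≫
      cotensorTensor C Y (F.obj (Bicomod.regular k C).toLeft))

theorem leftCoHomUnit_comp (Y : Bicomod k C D) {F : LeftComod k C ⥤ LeftComod k D}
    (adj : F ⊣ cotensorLeftFunctor Y) {N : LeftComod k D}
    (f : F.obj (Bicomod.regular k C).toLeft ⟶ N) :
    adj.homEquiv _ _ f = leftCoHomUnit Y adj ≫ (cotensorLeftFunctor Y).map f :=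
  Adjunction.homEquiv_unit ..

theorem leftCoHomUnit_leftCoHomCoaction (Y : Bicomod k C D)
    {F : LeftComod k C ⥤ LeftComod k D} (adj : F ⊣ cotensorLeftFunctor Y) :
    leftCoHomUnit Y adj ≫ (cotensorLeftFunctor Y).map (leftCoHomCoaction Y adj) =
      LeftComod.comulHom ≫ (LeftComod.tensor C).map (leftCoHomUnit Y adj) ≫
        cotensorTensor C Y (F.obj (Bicomod.regular k C).toLeft) := by
  rw [← leftCoHomUnit_comp, leftCoHomCoaction, Equiv.apply_symm_apply]

theorem leftCoHomCoaction_counit (Y : Bicomod k C D) {F : LeftComod k C ⥤ LeftComod k D}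
    (adj : F ⊣ cotensorLeftFunctor Y) :
    leftCoHomCoaction Y adj ≫ LeftComod.tensorMap Coalgebra.counit _
      = LeftComod.tensorUnit _ := by
  apply (adj.homEquiv _ _).injective
  have h1 : (LeftComod.comulHom (k := k) (C := C)) ≫
      LeftComod.tensorMap Coalgebra.counit _ = LeftComod.tensorUnit _ :=
    Subtype.ext (Coalgebra.lTensor_counit_comp_comul (R := k) (A := C))
  have h2 : ∀ {M N : LeftComod k C} (f : M ⟶ N), (LeftComod.tensor C).map f ≫
      LeftComod.tensorMap (W' := k) Coalgebra.counit _
        = LeftComod.tensorMap Coalgebra.counit _ ≫ (LeftComod.tensor k).map f := by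
    intro M N f
    exact Subtype.ext (TensorProduct.ext' fun c m => rfl)
  have h3 : ∀ {M N : LeftComod k C} (f : M ⟶ N), LeftComod.tensorUnit M ≫
      (LeftComod.tensor k).map f = f ≫ LeftComod.tensorUnit N := by
    intro M N f
    exact Subtype.ext (LinearMap.ext fun m => rfl)
  rw [leftCoHomUnit_comp, leftCoHomUnit_comp, Functor.map_comp,
    reassoc_of% leftCoHomUnit_leftCoHomCoaction Y adj, cotensorTensor_natural_right,
    ← cotensorTensor_unit, reassoc_of% h2, reassoc_of% h1, reassoc_of% h3]

theorem leftCoHomCoaction_coassoc (Y : Bicomod k C D) {F : LeftComod k C ⥤ LeftComod k D}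
    (adj : F ⊣ cotensorLeftFunctor Y) :
    leftCoHomCoaction Y adj ≫ (LeftComod.tensor C).map (leftCoHomCoaction Y adj) ≫
      LeftComod.tensorAssoc C C _ = leftCoHomCoaction Y adj ≫
        LeftComod.tensorMap Coalgebra.comul _ := by
  apply (adj.homEquiv _ _).injective
  have h1 : (LeftComod.comulHom (k := k) (C := C)) ≫
      (LeftComod.tensor C).map LeftComod.comulHom ≫ LeftComod.tensorAssoc C C _ =
      LeftComod.comulHom ≫ LeftComod.tensorMap Coalgebra.comul _ :=
    Subtype.ext (Coalgebra.coassoc (R := k) (A := C))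
  have h2 : ∀ {M N : LeftComod k C} (f : M ⟶ N), (LeftComod.tensor C).map f ≫
      LeftComod.tensorMap (W' := C ⊗[k] C) Coalgebra.comul _
        = LeftComod.tensorMap Coalgebra.comul _ ≫ (LeftComod.tensor (C ⊗[k] C)).map f := by
    intro M N f
    exact Subtype.ext (TensorProduct.ext' fun c m => rfl)
  have h3 : ∀ {M N : LeftComod k C} (f : M ⟶ N),
      (LeftComod.tensor C).map ((LeftComod.tensor C).map f) ≫ LeftComod.tensorAssoc C C N =
        LeftComod.tensorAssoc C C M ≫ (LeftComod.tensor (C ⊗[k] C)).map f := by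
    intro M N f
    exact Subtype.ext (TensorProduct.ext_threefold fun c c' m => rfl)
  have h4 := leftCoHomUnit_leftCoHomCoaction Y adj
  rw [leftCoHomUnit_comp, leftCoHomUnit_comp, Functor.map_comp, Functor.map_comp,
    Functor.map_comp, reassoc_of% h4, reassoc_of% h4, cotensorTensor_natural_right,
    reassoc_of% (cotensorTensor_natural Y), reassoc_of% h2, ← reassoc_of% h1, ← reassoc_of% h3,
    ← cotensorTensor_assoc, ← Functor.map_comp_assoc, ← Functor.map_comp_assoc,
    ← Functor.map_comp_assoc, h4]
  simp only [Category.assoc, Functor.map_comp]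

/-- The `(D, C)`-bicomodule `F(C)`, for a left adjoint `F` of `Y □_D -`. -/
noncomputable def leftCoHomOfAdjunction (Y : Bicomod k C D)
    {F : LeftComod k C ⥤ LeftComod k D} (adj : F ⊣ cotensorLeftFunctor Y) : Bicomod k D C where
  carrier := (F.obj (Bicomod.regular k C).toLeft).carrier
  coactLeft := (F.obj (Bicomod.regular k C).toLeft).coact
  coactRight := (leftCoHomCoaction Y adj).1
  isLeftCoaction := (F.obj (Bicomod.regular k C).toLeft).isCoaction
  isRightCoaction := ⟨congrArg Subtype.val (leftCoHomCoaction_coassoc Y adj),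
    congrArg Subtype.val (leftCoHomCoaction_counit Y adj)⟩
  commute := coactionsCommute_of_leftColinear (leftCoHomCoaction Y adj).2

end LeftCoHom

section Main

variable {k : Type u} [Field k]
variable {C : Type u} [AddCommGroup C] [Module k C] [Coalgebra k C]
variable {D : Type u} [AddCommGroup D] [Module k D] [Coalgebra k D]
variable {E : Type u} [AddCommGroup E] [Module k E] [Coalgebra k E]

/-- `M` is quasifinite: `Hom^C(V, M)` is finite dimensional for all finite dimensional `V`. -/
def RightComod.Quasifinite (M : RightComod k C) : Prop :=
  ∀ V : RightComod k C, Module.Finite k V.carrier → Module.Finite k (V ⟶ M)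

/-- `M` is quasifinite: `Hom(V, M)` is finite dimensional for all finite dimensional `V`. -/
def LeftComod.Quasifinite (M : LeftComod k C) : Prop :=
  ∀ V : LeftComod k C, Module.Finite k V.carrier → Module.Finite k (V ⟶ M)

open Classical in
/-- The bicomodule `h_C(Y, C)`, where `h_C(Y, -)` is the left adjoint of `- □_D Y`. The left
adjoint exists if (and only if) `Y` is quasifinite as a right `C`-comodule; if it does not exist,
the value is `0` by convention. -/
noncomputable def coHom (Y : Bicomod k D C) : Bicomod k C D :=
  if h : (cotensorRightFunctor Y).IsRightAdjoint then
    haveI := h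
    coHomOfAdjunction Y (Adjunction.ofIsRightAdjoint (cotensorRightFunctor Y))
  else Bicomod.zero k C D

open Classical in
/-- The bicomodule `_C h(Y, C)`, where `_C h(Y, -)` is the left adjoint of `Y □_D -`. The left
adjoint exists if (and only if) `Y` is quasifinite as a left `C`-comodule; if it does not exist,
the value is `0` by convention. -/
noncomputable def leftCoHom (Y : Bicomod k C D) : Bicomod k D C :=
  if h : (cotensorLeftFunctor Y).IsRightAdjoint then
    haveI := h
    leftCoHomOfAdjunction Y (Adjunction.ofIsRightAdjoint (cotensorLeftFunctor Y))
  else Bicomod.zero k D C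

/-- A map of bicomodules `C → X □ Y`, as a linear map `C → X ⊗ Y`. -/
def Bicomod.toTensor {X : Bicomod k C D} {Y : Bicomod k D C}
    (f : Bicomod.regular k C ⟶ X.cotensor Y) : C →ₗ[k] X.carrier ⊗[k] Y.carrier :=
  (FrobeniusComod.cotensor X.coactRight Y.coactLeft).subtype ∘ₗ f.1

variable (k C D) in
/-- A strict Morita–Takeuchi context `(C, D, P, Q, f, g)`, where `f : C → Q □_D P` and
`g : D → P □_C Q` are bicolinear isomorphisms. With `ω = g⁻¹`, the two equations say that
`(ω □ P) (P □ f) = P` and `(Q □ ω) (f □ Q) = Q`; they are written inside `P ⊗ Q ⊗ P` and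
`Q ⊗ P ⊗ Q`, with `P = P □_C C = D □_D P` and `Q = Q □_D D = C □_C Q`. -/
structure StrictContext where
  P : Bicomod k D C
  Q : Bicomod k C D
  f : Bicomod.regular k C ≅ Q.cotensor P
  g : Bicomod.regular k D ≅ P.cotensor Q
  eq_P : ∀ p : P.carrier, (Bicomod.toTensor f.hom).lTensor P.carrier (P.coactRight p) =
    TensorProduct.assoc k P.carrier Q.carrier P.carrier
      ((Bicomod.toTensor g.hom).rTensor P.carrier (P.coactLeft p))
  eq_Q : ∀ q : Q.carrier, TensorProduct.assoc k Q.carrier P.carrier Q.carrier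
      ((Bicomod.toTensor f.hom).rTensor Q.carrier (Q.coactLeft q)) =
    (Bicomod.toTensor g.hom).lTensor Q.carrier (Q.coactRight q)

/-- An isomorphism of strict Morita–Takeuchi contexts over fixed coalgebras. -/
structure StrictContext.Iso (S T : StrictContext k C D) where
  p : S.P ≅ T.P
  q : S.Q ≅ T.Q
  comm_f : S.f.hom ≫ Bicomod.cotensorMap q.hom p.hom = T.f.hom
  comm_g : S.g.hom ≫ Bicomod.cotensorMap p.hom q.hom = T.g.hom

theorem Bicomod.cotensorMap_id (X : Bicomod k C D) (Y : Bicomod k D E) :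
    Bicomod.cotensorMap (𝟙 X) (𝟙 Y) = 𝟙 (X.cotensor Y) :=
  Subtype.ext (LinearMap.ext fun x => Subtype.ext
    (LinearMap.congr_fun (TensorProduct.map_id (R := k)) x.1))

theorem Bicomod.cotensorMap_comp {X X' X'' : Bicomod k C D} {Y Y' Y'' : Bicomod k D E}
    (f : X ⟶ X') (f' : X' ⟶ X'') (g : Y ⟶ Y') (g' : Y' ⟶ Y'') :
    Bicomod.cotensorMap (f ≫ f') (g ≫ g')
      = Bicomod.cotensorMap f g ≫ Bicomod.cotensorMap f' g' :=
  Subtype.ext (LinearMap.ext fun x => Subtype.ext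
    (LinearMap.congr_fun (TensorProduct.map_comp f'.1 g'.1 f.1 g.1) x.1))

/-- The identity isomorphism. -/
def StrictContext.Iso.refl (S : StrictContext k C D) : S.Iso S where
  p := CategoryTheory.Iso.refl _
  q := CategoryTheory.Iso.refl _
  comm_f := by simp [Bicomod.cotensorMap_id]
  comm_g := by simp [Bicomod.cotensorMap_id]

/-- The inverse isomorphism. -/
def StrictContext.Iso.symm {S T : StrictContext k C D} (e : S.Iso T) : T.Iso S where
  p := e.p.symm
  q := e.q.symm
  comm_f := by
    rw [← e.comm_f, Category.assoc, ← Bicomod.cotensorMap_comp]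
    simp [Bicomod.cotensorMap_id]
  comm_g := by
    rw [← e.comm_g, Category.assoc, ← Bicomod.cotensorMap_comp]
    simp [Bicomod.cotensorMap_id]

/-- The composite isomorphism. -/
def StrictContext.Iso.trans {S T R : StrictContext k C D} (e : S.Iso T) (e' : T.Iso R) :
    S.Iso R where
  p := e.p ≪≫ e'.p
  q := e.q ≪≫ e'.q
  comm_f := by
    rw [← e'.comm_f, ← e.comm_f, Category.assoc, ← Bicomod.cotensorMap_comp]
    rfl
  comm_g := by
    rw [← e'.comm_g, ← e.comm_g, Category.assoc, ← Bicomod.cotensorMap_comp]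
    rfl

variable (k C D) in
/-- A fourtuple `(X, Λ, U, V)`. The bicomodules called `U` and `V` are `U.P` and `V.P`. -/
structure FourTuple where
  X : Bicomod k C D
  L : Bicomod k D C
  U : StrictContext k C C
  V : StrictContext k D D

namespace FourTuple

/-- The bicomodule `U □_C X □_D V`. -/
noncomputable def UXV (q : FourTuple k C D) : Bicomod k C D :=
  (q.U.P.cotensor q.X).cotensor q.V.P

/-- `Λ` and `X` are quasifinite and injective as right comodules, with bicolinear isomorphisms
`X ≅ h_C(Λ, C)` and `Λ ≅ h_D(U □ X □ V, D)`. -/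
def RightCondition (q : FourTuple k C D) : Prop :=
  q.L.toRight.Quasifinite ∧ Injective q.L.toRight ∧
  q.X.toRight.Quasifinite ∧ Injective q.X.toRight ∧
  Nonempty (q.X ≅ coHom q.L) ∧ Nonempty (q.L ≅ coHom q.UXV)

/-- `Λ` and `X` are quasifinite and injective as left comodules, with bicolinear isomorphisms
`Λ ≅ _C h(X, C)` and `U □ X □ V ≅ _D h(Λ, D)`. -/
def LeftCondition (q : FourTuple k C D) : Prop :=
  q.L.toLeft.Quasifinite ∧ Injective q.L.toLeft ∧
  q.X.toLeft.Quasifinite ∧ Injective q.X.toLeft ∧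
  Nonempty (q.L ≅ leftCoHom q.X) ∧ Nonempty (q.UXV ≅ leftCoHom q.L)

variable (k C D) in
/-- Componentwise isomorphism of fourtuples. -/
def setoid : Setoid (FourTuple k C D) where
  r q q' := Nonempty (q.X ≅ q'.X) ∧ Nonempty (q.L ≅ q'.L) ∧
    Nonempty (q.U.Iso q'.U) ∧ Nonempty (q.V.Iso q'.V)
  iseqv :=
    { refl := fun _ => ⟨⟨Iso.refl _⟩, ⟨Iso.refl _⟩, ⟨.refl _⟩, ⟨.refl _⟩⟩
      symm := fun ⟨⟨a⟩, ⟨b⟩, ⟨c⟩, ⟨d⟩⟩ => ⟨⟨a.symm⟩, ⟨b.symm⟩, ⟨c.symm⟩, ⟨d.symm⟩⟩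
      trans := fun ⟨⟨a⟩, ⟨b⟩, ⟨c⟩, ⟨d⟩⟩ ⟨⟨a'⟩, ⟨b'⟩, ⟨c'⟩, ⟨d'⟩⟩ =>
        ⟨⟨a ≪≫ a'⟩, ⟨b ≪≫ b'⟩, ⟨c.trans c'⟩, ⟨d.trans d'⟩⟩ }

end FourTuple

end Main

section Frobenius

universe v₁ v₂ u₁ u₂

variable (k : Type u) [Field k]
variable (𝒜 : Type u₁) [Category.{v₁} 𝒜] [Preadditive 𝒜] [Linear k 𝒜]
variable (ℬ : Type u₂) [Category.{v₂} ℬ] [Preadditive ℬ] [Linear k ℬ]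

/-- A `k`-linear Frobenius functor of the second kind from `𝒜` to `ℬ`, with its data: `k`-linear
functors `F` and `G` and `k`-linear autoequivalences `α` and `β`, such that `G` is a right adjoint
of `F` and a left adjoint of `β F α`. -/
structure FrobeniusSecondKind where
  F : 𝒜 ⥤ ℬ
  G : ℬ ⥤ 𝒜
  α : 𝒜 ⥤ 𝒜
  β : ℬ ⥤ ℬ
  additive_F : F.Additive
  additive_G : G.Additive
  additive_α : α.Additive
  additive_β : β.Additive
  linear_F : F.Linear k
  linear_G : G.Linear k
  linear_α : α.Linear k
  linear_β : β.Linear k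
  isEquivalence_α : α.IsEquivalence
  isEquivalence_β : β.IsEquivalence
  adj : Nonempty (F ⊣ G)
  adj' : Nonempty (G ⊣ α ⋙ F ⋙ β)

/-- Componentwise natural isomorphism of Frobenius functors of the second kind. -/
def FrobeniusSecondKind.setoid : Setoid (FrobeniusSecondKind k 𝒜 ℬ) where
  r S T := Nonempty (S.F ≅ T.F) ∧ Nonempty (S.G ≅ T.G) ∧ Nonempty (S.α ≅ T.α) ∧
    Nonempty (S.β ≅ T.β)
  iseqv :=
    { refl := fun _ => ⟨⟨Iso.refl _⟩, ⟨Iso.refl _⟩, ⟨Iso.refl _⟩, ⟨Iso.refl _⟩⟩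
      symm := fun ⟨⟨a⟩, ⟨b⟩, ⟨c⟩, ⟨d⟩⟩ => ⟨⟨a.symm⟩, ⟨b.symm⟩, ⟨c.symm⟩, ⟨d.symm⟩⟩
      trans := fun ⟨⟨a⟩, ⟨b⟩, ⟨c⟩, ⟨d⟩⟩ ⟨⟨a'⟩, ⟨b'⟩, ⟨c'⟩, ⟨d'⟩⟩ =>
        ⟨⟨a ≪≫ a'⟩, ⟨b ≪≫ b'⟩, ⟨c ≪≫ c'⟩, ⟨d ≪≫ d'⟩⟩ }

/-- Isomorphism classes of `k`-linear Frobenius functors of the second kind from `𝒜` to `ℬ`. -/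
abbrev FrobeniusSecondKind.Classes := Quotient (FrobeniusSecondKind.setoid k 𝒜 ℬ)

/-- The isomorphism class of a Frobenius functor of the second kind. -/
def FrobeniusSecondKind.cls {k : Type u} [Field k]
    {𝒜 : Type u₁} [Category.{v₁} 𝒜] [Preadditive 𝒜] [Linear k 𝒜]
    {ℬ : Type u₂} [Category.{v₂} ℬ] [Preadditive ℬ] [Linear k ℬ]
    (S : FrobeniusSecondKind k 𝒜 ℬ) : FrobeniusSecondKind.Classes k 𝒜 ℬ :=
  Quotient.mk (FrobeniusSecondKind.setoid k 𝒜 ℬ) S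

end Frobenius

section Classes

variable (k : Type u) [Field k]
variable (C : Type u) [AddCommGroup C] [Module k C] [Coalgebra k C]
variable (D : Type u) [AddCommGroup D] [Module k D] [Coalgebra k D]

/-- The fourtuples satisfying the condition on right comodules. -/
abbrev FrobeniusFourTuple := {q : FourTuple k C D // q.RightCondition}

/-- Isomorphism classes of fourtuples satisfying the condition on right comodules. -/
abbrev FrobeniusFourTuple.Classes :=
  Quotient ((FourTuple.setoid k C D).comap (Subtype.val : FrobeniusFourTuple k C D → _))

variable {k C D} in
/-- The isomorphism class of a fourtuple. -/
def FrobeniusFourTuple.cls (q : FrobeniusFourTuple k C D) : FrobeniusFourTuple.Classes k C D :=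
  Quotient.mk ((FourTuple.setoid k C D).comap Subtype.val) q

end Classes

end FrobeniusComod

/-! Everything is reduced to one self-dual notion. A duality `CoDual X L` consists of a unit `C → X
□_D L` and a counit `L □_C X → D` satisfying the triangle identities. A colinear map into `D` is
recovered from its composite with the counit of `D`, so the counit is stored as a linear form `e`
extended to all of `L ⊗ X`, and the triangle identities become contractions of tensors. Such a
duality amounts to an adjunction `- □_C X ⊣ - □_D L` (`CoDual.adjunction`,
`nonempty_coDual_of_adjunction`). For a fourtuple, `IsDual` asks that `X` be a dual of `Λ` and `Λ` a
dual of `U □ X □ V`; for cotensor functors these are the two adjunctions of a Frobenius functor of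
the second kind.

Condition (i) is equivalent to `IsDual` because `h_C(Λ, C)` carries a universal unit (`IsCoHom`). If
`Λ` is injective, a retraction of its coaction `Λ → Λ ⊗ C` turns a universal unit into a duality.
Conversely a duality has a universal unit, which gives the isomorphism with the co-hom. It makes `Λ`
quasifinite, since a colinear map `V → Λ` is then determined by a functional on a finite dimensional
space, and injective, since `- □_D Λ` is then right adjoint to a functor preserving monomorphisms.

The correspondence rests on a theorem of Eilenberg–Watts type, `exists_cotensorRightFunctor_iso`: a
linear functor `F` with a left adjoint and a linear right adjoint is `- □_C F(C)`. The right adjoint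
makes `F` commute with tensoring by vector spaces, and the left adjoint makes it preserve the
equalizer `M → M ⊗ C ⇉ M ⊗ C ⊗ C`. In a Frobenius functor of the second kind all four functors have
adjoints on both sides, because the equivalences `α` and `β` can be moved across an adjunction. A
bicomodule is recovered from its cotensor functor (`nonempty_iso_of_cotensorRightFunctor_iso`), a
bicomodule whose functor is an equivalence completes to a strict context
(`exists_strictContext_of_isEquivalence`), and a strict context is determined up to isomorphism by
that bicomodule (`StrictContext.nonempty_iso`).

The left-hand statements are mirror images. Left `C`-comodules are right comodules over the
coopposite coalgebra; mirroring exchanges `X` and `Λ`, reverses cotensor products and preserves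
dualities (`CoDual.mirror`, `FourTuple.isDual_mirror_iff`). Hence condition (ii) is also equivalent
to `IsDual`, and the left correspondence is obtained from the right one by conjugation. -/

namespace FrobeniusComod

/-! ### Contractions of tensors along a bilinear form, and naturality of associators. -/

section Contractions

variable {k : Type u} [Field k]
variable {C : Type u} [AddCommGroup C] [Module k C]
variable {D : Type u} [AddCommGroup D] [Module k D]
variable {L : Type u} [AddCommGroup L] [Module k L]
variable {X : Type u} [AddCommGroup X] [Module k X]
variable {V : Type u} [AddCommGroup V] [Module k V]
variable {V' : Type u} [AddCommGroup V'] [Module k V']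
variable {W : Type u} [AddCommGroup W] [Module k W]
variable {W' : Type u} [AddCommGroup W'] [Module k W']

variable (V) in
/-- The contraction `l ⊗ (x ⊗ v) ↦ e (l ⊗ x) v`. -/
noncomputable def contractLeft (e : L ⊗[k] X →ₗ[k] k) : L ⊗[k] (X ⊗[k] V) →ₗ[k] V :=
  (TensorProduct.lid k V).toLinearMap ∘ₗ e.rTensor V ∘ₗ (TensorProduct.assoc k L X V).symm.toLinearMap

variable (W) in
/-- The contraction `(w ⊗ l) ⊗ x ↦ e (l ⊗ x) w`. -/
noncomputable def contractRight (e : L ⊗[k] X →ₗ[k] k) : (W ⊗[k] L) ⊗[k] X →ₗ[k] W :=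
  (TensorProduct.rid k W).toLinearMap ∘ₗ e.lTensor W ∘ₗ (TensorProduct.assoc k W L X).toLinearMap

@[simp] theorem contractLeft_tmul (e : L ⊗[k] X →ₗ[k] k) (l : L) (x : X) (v : V) :
    contractLeft V e (l ⊗ₜ (x ⊗ₜ v)) = e (l ⊗ₜ x) • v := by
  simp [contractLeft]

@[simp] theorem contractRight_tmul (e : L ⊗[k] X →ₗ[k] k) (w : W) (l : L) (x : X) :
    contractRight W e ((w ⊗ₜ l) ⊗ₜ x) = e (l ⊗ₜ x) • w := by
  simp [contractRight]

theorem contractRight_rTensor (e : L ⊗[k] X →ₗ[k] k) (f : W →ₗ[k] W') (z : (W ⊗[k] L) ⊗[k] X) :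
    contractRight W' e ((f.rTensor L).rTensor X z) = f (contractRight W e z) := by
  have : contractRight W' e ∘ₗ (f.rTensor L).rTensor X = f ∘ₗ contractRight W e := by
    ext l x v; simp
  exact LinearMap.congr_fun this z

/-- Contracting the two inner factors of `(w ⊗ l) ⊗ (x ⊗ v)`. -/
theorem contractRight_rTensor_assoc_symm (e : L ⊗[k] X →ₗ[k] k) (w : W) (l : L)
    (z : X ⊗[k] V) :
    (contractRight W e).rTensor V ((TensorProduct.assoc k (W ⊗[k] L) X V).symm ((w ⊗ₜ l) ⊗ₜ z))
      = w ⊗ₜ contractLeft V e (l ⊗ₜ z) := by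
  induction z with
  | zero => simp
  | add a b ha hb => simp only [TensorProduct.tmul_add, map_add, ha, hb]
  | tmul x v => simp [TensorProduct.smul_tmul]

/-- The contraction with `η` on the right: `w ⊗ (l ⊗ c) ↦ w ⊗ e (l ⊗ η(c)ˣ) η(c)ᵛ`. -/
theorem contractRight_lTensor_assoc_symm (e : L ⊗[k] X →ₗ[k] k) (η : C →ₗ[k] X ⊗[k] V)
    (z : W ⊗[k] (L ⊗[k] C)) :
    (contractRight W e).rTensor V ((TensorProduct.assoc k (W ⊗[k] L) X V).symm
        (η.lTensor (W ⊗[k] L) ((TensorProduct.assoc k W L C).symm z)))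
      = (contractLeft V e ∘ₗ η.lTensor L).lTensor W z := by
  have : (contractRight W e).rTensor V ∘ₗ (TensorProduct.assoc k (W ⊗[k] L) X V).symm.toLinearMap ∘ₗ
      η.lTensor (W ⊗[k] L) ∘ₗ (TensorProduct.assoc k W L C).symm.toLinearMap
      = (contractLeft V e ∘ₗ η.lTensor L).lTensor W := by
    ext w l c
    simp [contractRight_rTensor_assoc_symm]
  exact LinearMap.congr_fun this z

/-- The tensor product of the map `x ↦ (W ⊗ e)(f(x₋₁) ⊗ x₀)` with `V`. -/
theorem rTensor_contractRight (e : L ⊗[k] X →ₗ[k] k) (f : C →ₗ[k] W ⊗[k] L)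
    (lX : X →ₗ[k] C ⊗[k] X) (z : X ⊗[k] V) :
    (contractRight W e ∘ₗ f.rTensor X ∘ₗ lX).rTensor V z
      = (contractRight W e).rTensor V ((TensorProduct.assoc k (W ⊗[k] L) X V).symm
          (f.rTensor (X ⊗[k] V) (tensorLeft V lX z))) := by
  have : (contractRight W e ∘ₗ f.rTensor X ∘ₗ lX).rTensor V
      = (contractRight W e).rTensor V ∘ₗ (TensorProduct.assoc k (W ⊗[k] L) X V).symm.toLinearMap ∘ₗ
          f.rTensor (X ⊗[k] V) ∘ₗ tensorLeft V lX := by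
    apply TensorProduct.ext'
    intro x v
    simp only [LinearMap.rTensor_tmul, LinearMap.comp_apply, tensorLeft, LinearEquiv.coe_coe]
    generalize lX x = y
    induction y with
    | zero => simp
    | add a b ha hb => simp only [TensorProduct.add_tmul, map_add, ha, hb]
    | tmul c x' =>
      simp only [LinearMap.rTensor_tmul, TensorProduct.assoc_tmul]
      generalize f c = y
      induction y with
      | zero => simp
      | add a b ha hb => simp only [TensorProduct.add_tmul, map_add, ha, hb]
      | tmul w l => simp
  exact LinearMap.congr_fun this z

theorem assoc_rTensor_lTensor (f : V →ₗ[k] V') (z : (C ⊗[k] V) ⊗[k] W) :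
    TensorProduct.assoc k C V' W ((f.lTensor C).rTensor W z)
      = (f.rTensor W).lTensor C (TensorProduct.assoc k C V W z) := by
  have : (TensorProduct.assoc k C V' W).toLinearMap ∘ₗ (f.lTensor C).rTensor W
      = (f.rTensor W).lTensor C ∘ₗ (TensorProduct.assoc k C V W).toLinearMap := by
    ext; simp
  exact LinearMap.congr_fun this z

theorem assoc_rTensor_rTensor (f : V →ₗ[k] V') (z : (V ⊗[k] D) ⊗[k] W) :
    TensorProduct.assoc k V' D W ((f.rTensor D).rTensor W z)
      = f.rTensor (D ⊗[k] W) (TensorProduct.assoc k V D W z) := by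
  have : (TensorProduct.assoc k V' D W).toLinearMap ∘ₗ (f.rTensor D).rTensor W
      = f.rTensor (D ⊗[k] W) ∘ₗ (TensorProduct.assoc k V D W).toLinearMap := by
    ext; simp
  exact LinearMap.congr_fun this z

theorem assoc_lTensor (f : V →ₗ[k] V') (z : (C ⊗[k] D) ⊗[k] V) :
    TensorProduct.assoc k C D V' (f.lTensor (C ⊗[k] D) z)
      = (f.lTensor D).lTensor C (TensorProduct.assoc k C D V z) := by
  have : (TensorProduct.assoc k C D V').toLinearMap ∘ₗ f.lTensor (C ⊗[k] D)
      = (f.lTensor D).lTensor C ∘ₗ (TensorProduct.assoc k C D V).toLinearMap := by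
    ext; simp
  exact LinearMap.congr_fun this z

theorem lTensor_rTensor_comm (f : C →ₗ[k] W) (g : D →ₗ[k] V) (z : C ⊗[k] D) :
    g.lTensor W (f.rTensor D z) = f.rTensor V (g.lTensor C z) := by
  rw [← LinearMap.comp_apply, ← LinearMap.comp_apply, LinearMap.lTensor_comp_rTensor,
    LinearMap.rTensor_comp_lTensor]

theorem assoc_tensorRight_rTensor {W N Y : Type u} [AddCommGroup W] [Module k W]
    [AddCommGroup N] [Module k N] [AddCommGroup Y] [Module k Y] (r : N →ₗ[k] N ⊗[k] D) (z : (W ⊗[k] N) ⊗[k] Y) :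
    TensorProduct.assoc k W N (D ⊗[k] Y) (TensorProduct.assoc k (W ⊗[k] N) D Y
        ((tensorRight W r).rTensor Y z))
      = ((TensorProduct.assoc k N D Y).toLinearMap ∘ₗ r.rTensor Y).lTensor W
        (TensorProduct.assoc k W N Y z) := by
  have : (TensorProduct.assoc k W N (D ⊗[k] Y)).toLinearMap ∘ₗ
      (TensorProduct.assoc k (W ⊗[k] N) D Y).toLinearMap ∘ₗ (tensorRight W r).rTensor Y
      = ((TensorProduct.assoc k N D Y).toLinearMap ∘ₗ r.rTensor Y).lTensor W ∘ₗ
        (TensorProduct.assoc k W N Y).toLinearMap := by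
    apply TensorProduct.ext_threefold
    intro w n y
    simp only [LinearMap.comp_apply, LinearMap.rTensor_tmul, LinearEquiv.coe_coe, tensorRight,
      LinearMap.lTensor_tmul, TensorProduct.assoc_tmul]
    generalize r n = v
    induction v with
    | zero => simp
    | add a b ha hb => simp only [TensorProduct.add_tmul, TensorProduct.tmul_add, map_add, ha, hb]
    | tmul c x' => simp
  exact LinearMap.congr_fun this z

end Contractions

/-! ### Dualities of bicomodules and universal units. -/

section CoDual

variable {k : Type u} [Field k]
variable {C : Type u} [AddCommGroup C] [Module k C] [Coalgebra k C]
variable {D : Type u} [AddCommGroup D] [Module k D] [Coalgebra k D]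

/-- The linear map underlying a bicolinear map `C → X □_D L`. -/
structure IsUnitMap (X : Bicomod k C D) (L : Bicomod k D C)
    (η : C →ₗ[k] X.carrier ⊗[k] L.carrier) : Prop where
  mem : ∀ c, η c ∈ cotensor X.coactRight L.coactLeft
  left : ∀ c, tensorLeft L.carrier X.coactLeft (η c) = η.lTensor C (Coalgebra.comul (R := k) c)
  right : ∀ c, tensorRight X.carrier L.coactRight (η c) = η.rTensor C (Coalgebra.comul (R := k) c)

/-- A unit `C → X □_D L` and a (linear extension of a) counit `L □_C X → D → k` that satisfy the
triangle identities, exhibiting `X` as a dual of `L`. -/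
structure CoDual (X : Bicomod k C D) (L : Bicomod k D C) where
  η : C →ₗ[k] X.carrier ⊗[k] L.carrier
  e : L.carrier ⊗[k] X.carrier →ₗ[k] k
  isUnitMap : IsUnitMap X L η
  triangle_left : ∀ l, contractLeft L.carrier e (η.lTensor L.carrier (L.coactRight l)) = l
  triangle_right : ∀ x, contractRight X.carrier e (η.rTensor X.carrier (X.coactLeft x)) = x

/-- `η : C → X ⊗ L` is universal among the right colinear maps `C → W ⊗ L`. -/
structure IsCoHom (X : Bicomod k C D) (L : Bicomod k D C)
    (η : C →ₗ[k] X.carrier ⊗[k] L.carrier) : Prop extends IsUnitMap X L η where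
  exists_map : ∀ (W : Type u) [AddCommGroup W] [Module k W] (f : C →ₗ[k] W ⊗[k] L.carrier),
    (∀ c, tensorRight W L.coactRight (f c) = f.rTensor C (Coalgebra.comul (R := k) c)) →
    ∃ g : X.carrier →ₗ[k] W, ∀ c, g.rTensor L.carrier (η c) = f c
  unique : ∀ (W : Type u) [AddCommGroup W] [Module k W] (g g' : X.carrier →ₗ[k] W),
    (∀ c, g.rTensor L.carrier (η c) = g'.rTensor L.carrier (η c)) → g = g'

variable {X X' : Bicomod k C D} {L L' : Bicomod k D C}

/-- The map induced by `f` is `x ↦ (W ⊗ e)(f(x₋₁) ⊗ x₀)`. Composed with the unit, it reduces to the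
first triangle identity once left colinearity of `η` and right colinearity of `f` have moved the
coactions onto `L`. The second triangle identity recovers any `g` from its composite with `η`,
whence uniqueness. -/
theorem CoDual.isCoHom (a : CoDual X L) : IsCoHom X L a.η where
  toIsUnitMap := a.isUnitMap
  exists_map W _ _ f hf := by
    refine ⟨contractRight W a.e ∘ₗ f.rTensor X.carrier ∘ₗ X.coactLeft, fun c => ?_⟩
    rw [rTensor_contractRight, a.isUnitMap.left, ← lTensor_rTensor_comm, ← hf, tensorRight,
      LinearMap.comp_apply, LinearEquiv.coe_coe, contractRight_lTensor_assoc_symm,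
      ← LinearMap.comp_apply, ← LinearMap.lTensor_comp]
    have : (contractLeft L.carrier a.e ∘ₗ a.η.lTensor L.carrier) ∘ₗ L.coactRight = LinearMap.id :=
      LinearMap.ext a.triangle_left
    rw [this, LinearMap.lTensor_id, LinearMap.id_apply]
  unique W _ _ g g' h := by
    have key : ∀ g : X.carrier →ₗ[k] W, ∀ x, g x = contractRight W a.e
        ((g.rTensor L.carrier ∘ₗ a.η).rTensor X.carrier (X.coactLeft x)) := by
      intro g x
      rw [LinearMap.rTensor_comp, LinearMap.comp_apply, contractRight_rTensor, a.triangle_right]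
    ext x
    rw [key, key g', LinearMap.ext (f := g.rTensor L.carrier ∘ₗ a.η) (g := g'.rTensor L.carrier ∘ₗ a.η) h]

/-- Bicomodules with a universal unit are unique up to an isomorphism compatible with the units. -/
theorem IsCoHom.exists_iso {η : C →ₗ[k] X.carrier ⊗[k] L.carrier}
    {η' : C →ₗ[k] X'.carrier ⊗[k] L.carrier} (h : IsCoHom X L η) (h' : IsCoHom X' L η') :
    ∃ i : X ≅ X', ∀ c, i.hom.1.rTensor L.carrier (η c) = η' c := by
  -- A comparison morphism exists in each direction; the two are inverse to each other by
  -- uniqueness.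
  have aux : ∀ {X X' : Bicomod k C D} {η : C →ₗ[k] X.carrier ⊗[k] L.carrier}
      {η' : C →ₗ[k] X'.carrier ⊗[k] L.carrier}, IsCoHom X L η → IsCoHom X' L η' →
      ∃ i : X ⟶ X', ∀ c, i.1.rTensor L.carrier (η c) = η' c := by
    intro X X' η η' h h'
    obtain ⟨g, hg⟩ := h.exists_map X'.carrier η' h'.right
    have hg' : g.rTensor L.carrier ∘ₗ η = η' := LinearMap.ext hg
    refine ⟨⟨g, ?_, ?_⟩, hg⟩
    -- Left colinearity of `g` is an equality of two linear maps out of `X`, so it may be tested on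
    -- the unit, where it becomes left colinearity of `η` and `η'`.
    · apply h.unique
      intro c
      apply (TensorProduct.assoc k C X'.carrier L.carrier).injective
      rw [LinearMap.rTensor_comp, LinearMap.comp_apply, assoc_rTensor_lTensor,
        LinearMap.rTensor_comp, LinearMap.comp_apply, hg]
      have e1 : ∀ y, (g.rTensor L.carrier).lTensor C (η.lTensor C y) = η'.lTensor C y := fun y => by
        rw [← LinearMap.comp_apply, ← LinearMap.lTensor_comp, hg']
      exact ((congrArg ((g.rTensor L.carrier).lTensor C) (h.left c)).trans (e1 _)).trans
        (h'.left c).symm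
    -- Tested on the unit, right colinearity of `g` becomes the membership of `η c` and `η' c` in
    -- the cotensor products.
    · apply h.unique
      intro c
      apply (TensorProduct.assoc k X'.carrier D L.carrier).injective
      rw [LinearMap.rTensor_comp, LinearMap.comp_apply, assoc_rTensor_rTensor,
        LinearMap.rTensor_comp, LinearMap.comp_apply, hg, mem_cotensor.1 (h.mem c),
        mem_cotensor.1 (h'.mem c), ← hg c, lTensor_rTensor_comm]
  obtain ⟨i, hi⟩ := aux h h'
  obtain ⟨j, hj⟩ := aux h' h
  refine ⟨⟨i, j, Subtype.ext (h.unique _ _ _ fun c => ?_),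
    Subtype.ext (h'.unique _ _ _ fun c => ?_)⟩, hi⟩
  · change (j.1 ∘ₗ i.1).rTensor L.carrier (η c) = (LinearMap.id).rTensor L.carrier (η c)
    rw [LinearMap.rTensor_comp, LinearMap.comp_apply, hi, hj, LinearMap.rTensor_id, LinearMap.id_apply]
  · change (i.1 ∘ₗ j.1).rTensor L.carrier (η' c) = (LinearMap.id).rTensor L.carrier (η' c)
    rw [LinearMap.rTensor_comp, LinearMap.comp_apply, hj, hi, LinearMap.rTensor_id, LinearMap.id_apply]

/-- A universal unit for an injective comodule is the unit of a duality. -/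
theorem IsCoHom.nonempty_coDual {η : C →ₗ[k] X.carrier ⊗[k] L.carrier} (h : IsCoHom X L η)
    (t : L.carrier ⊗[k] C →ₗ[k] L.carrier)
    (ht : ∀ z, L.coactRight (t z) = t.rTensor C (tensorRight L.carrier Coalgebra.comul z))
    (htr : ∀ l, t (L.coactRight l) = l) : Nonempty (CoDual X L) := by
  -- For fixed `l` the map `c ↦ t (l ⊗ c)` is right colinear from `C` to `L = k ⊗ L`, so
  -- universality with `W = k` yields a functional on `X`. These functionals, assembled over `l`,
  -- form `e`.
  have hex : ∀ l : L.carrier, ∃ g : X.carrier →ₗ[k] k, ∀ c,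
      g.rTensor L.carrier (η c) = 1 ⊗ₜ t (l ⊗ₜ c) := by
    intro l
    refine h.exists_map k (TensorProduct.mk k k L.carrier 1 ∘ₗ t ∘ₗ TensorProduct.mk k L.carrier C l)
      fun c => ?_
    simp only [LinearMap.comp_apply, TensorProduct.mk_apply, LinearMap.rTensor_comp]
    simp only [tensorRight, LinearMap.comp_apply, LinearMap.lTensor_tmul, LinearEquiv.coe_coe, ht]
    generalize (Coalgebra.comul (R := k) c) = y
    induction y with
    | zero => simp
    | add a b ha hb => simp only [TensorProduct.tmul_add, map_add, ha, hb]
    | tmul c x' => simp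
  choose g hg using hex
  let G : L.carrier →ₗ[k] (X.carrier →ₗ[k] k) :=
    { toFun := g
      map_add' := fun l l' => h.unique _ _ _ fun c => by
        rw [hg, LinearMap.rTensor_add, LinearMap.add_apply, hg, hg, TensorProduct.add_tmul, map_add,
          TensorProduct.tmul_add]
      map_smul' := fun a l => h.unique _ _ _ fun c => by
        rw [hg, RingHom.id_apply, LinearMap.rTensor_smul, LinearMap.smul_apply, hg,
          ← TensorProduct.smul_tmul', map_smul, TensorProduct.tmul_smul] }
  -- Inserting `η` and contracting with the form is `t` itself, so `htr` is the first triangle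
  -- identity.
  have key : ∀ z : L.carrier ⊗[k] C,
      contractLeft L.carrier (TensorProduct.lift G) (η.lTensor L.carrier z) = t z := by
    have : contractLeft L.carrier (TensorProduct.lift G) ∘ₗ η.lTensor L.carrier = t := by
      apply TensorProduct.ext'
      intro l c
      have e1 : ∀ y : X.carrier ⊗[k] L.carrier, contractLeft L.carrier (TensorProduct.lift G) (l ⊗ₜ y)
          = TensorProduct.lid k L.carrier ((g l).rTensor L.carrier y) := by
        intro y
        induction y with
        | zero => simp
        | add a b ha hb => simp only [TensorProduct.tmul_add, map_add, ha, hb]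
        | tmul c x' => simp [G]
      rw [LinearMap.comp_apply, LinearMap.lTensor_tmul, e1, hg, TensorProduct.lid_tmul, one_smul]
    exact LinearMap.congr_fun this
  refine ⟨⟨η, TensorProduct.lift G, h.toIsUnitMap, fun l => by rw [key, htr], ?_⟩⟩
  -- The second triangle identity compares endomorphisms of `X`; tested on the unit, it follows from
  -- the first.
  suffices contractRight X.carrier (TensorProduct.lift G) ∘ₗ η.rTensor X.carrier ∘ₗ X.coactLeft
      = LinearMap.id from LinearMap.congr_fun this
  apply h.unique
  intro c
  rw [rTensor_contractRight, h.left, ← lTensor_rTensor_comm, ← h.right, tensorRight,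
    LinearMap.comp_apply, LinearEquiv.coe_coe, contractRight_lTensor_assoc_symm,
    ← LinearMap.comp_apply, ← LinearMap.lTensor_comp]
  have : (contractLeft L.carrier (TensorProduct.lift G) ∘ₗ η.lTensor L.carrier) ∘ₗ L.coactRight
      = LinearMap.id := LinearMap.ext fun l => by simp [key, htr]
  rw [this, LinearMap.lTensor_id, LinearMap.rTensor_id]

end CoDual

/-! ### Right comodules: monomorphisms, cofree comodules, injectives. -/

section RightComodules

variable {k : Type u} [Field k]
variable {C : Type u} [AddCommGroup C] [Module k C] [Coalgebra k C]
variable {D : Type u} [AddCommGroup D] [Module k D] [Coalgebra k D]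

theorem RightComod.hom_coact {M N : RightComod k C} (f : M ⟶ N) (m : M.carrier) :
    N.coact (f.1 m) = f.1.rTensor C (M.coact m) := (LinearMap.congr_fun f.2 m).symm

theorem RightComod.coact_injective (M : RightComod k C) : Function.Injective M.coact := by
  intro x y h
  have := fun z => LinearMap.congr_fun M.isCoaction.counit z
  simp only [LinearMap.comp_apply, LinearMap.flip_apply, TensorProduct.mk_apply] at this
  have e := (this x).symm.trans ((congrArg _ h).trans (this y))
  simpa using congrArg (TensorProduct.rid k M.carrier) e

theorem RightComod.rid_counit_coact (M : RightComod k C) (m : M.carrier) :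
    TensorProduct.rid k M.carrier ((Coalgebra.counit (R := k) (A := C)).lTensor M.carrier (M.coact m))
      = m := by
  have := LinearMap.congr_fun M.isCoaction.counit m
  simp only [LinearMap.comp_apply, LinearMap.flip_apply, TensorProduct.mk_apply] at this
  rw [this]; simp

/-- A bijective colinear map is an isomorphism. -/
noncomputable def RightComod.isoOfBijective {M N : RightComod k C} (f : M ⟶ N)
    (hf : Function.Bijective f.1) : M ≅ N where
  hom := f
  inv := ⟨(LinearEquiv.ofBijective f.1 hf).symm.toLinearMap, by
    apply LinearMap.ext
    intro n
    obtain ⟨m, rfl⟩ := hf.2 n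
    have e : (LinearEquiv.ofBijective f.1 hf).symm.toLinearMap ∘ₗ f.1 = LinearMap.id :=
      LinearMap.ext fun x => (LinearEquiv.ofBijective f.1 hf).symm_apply_apply x
    have e' := LinearMap.congr_fun e m
    simp only [LinearMap.comp_apply] at e' ⊢
    rw [e', RightComod.hom_coact, ← LinearMap.comp_apply, ← LinearMap.rTensor_comp, e]
    simp⟩
  hom_inv_id := Subtype.ext (LinearMap.ext fun x =>
    (LinearEquiv.ofBijective f.1 hf).symm_apply_apply x)
  inv_hom_id := Subtype.ext (LinearMap.ext fun x =>
    (LinearEquiv.ofBijective f.1 hf).apply_symm_apply x)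

@[simp] theorem RightComod.isoOfBijective_hom {M N : RightComod k C} (f : M ⟶ N)
    (hf : Function.Bijective f.1) : (RightComod.isoOfBijective f hf).hom = f := rfl

theorem RightComod.bijective_of_iso {M N : RightComod k C} (i : M ≅ N) :
    Function.Bijective i.hom.1 :=
  Function.bijective_iff_has_inverse.2 ⟨i.inv.1,
    fun x => LinearMap.congr_fun (congrArg Subtype.val i.hom_inv_id) x,
    fun x => LinearMap.congr_fun (congrArg Subtype.val i.inv_hom_id) x⟩

/-- A bijective bicolinear map is an isomorphism. -/
noncomputable def Bicomod.isoOfBijective {M N : Bicomod k C D} (f : M ⟶ N)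
    (hf : Function.Bijective f.1) : M ≅ N where
  hom := f
  inv := ⟨(LinearEquiv.ofBijective f.1 hf).symm.toLinearMap, by
      apply LinearMap.ext
      intro n
      obtain ⟨m, rfl⟩ := hf.2 n
      have e : (LinearEquiv.ofBijective f.1 hf).symm.toLinearMap ∘ₗ f.1 = LinearMap.id :=
        LinearMap.ext fun x => (LinearEquiv.ofBijective f.1 hf).symm_apply_apply x
      have e' := LinearMap.congr_fun e m
      simp only [LinearMap.comp_apply] at e' ⊢
      rw [e', ← LinearMap.comp_apply N.coactLeft, ← f.2.1, LinearMap.comp_apply,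
        ← LinearMap.comp_apply, ← LinearMap.lTensor_comp, e]
      simp, by
      apply LinearMap.ext
      intro n
      obtain ⟨m, rfl⟩ := hf.2 n
      have e : (LinearEquiv.ofBijective f.1 hf).symm.toLinearMap ∘ₗ f.1 = LinearMap.id :=
        LinearMap.ext fun x => (LinearEquiv.ofBijective f.1 hf).symm_apply_apply x
      have e' := LinearMap.congr_fun e m
      simp only [LinearMap.comp_apply] at e' ⊢
      rw [e', ← LinearMap.comp_apply N.coactRight, ← f.2.2, LinearMap.comp_apply,
        ← LinearMap.comp_apply, ← LinearMap.rTensor_comp, e]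
      simp⟩
  hom_inv_id := Subtype.ext (LinearMap.ext fun x =>
    (LinearEquiv.ofBijective f.1 hf).symm_apply_apply x)
  inv_hom_id := Subtype.ext (LinearMap.ext fun x =>
    (LinearEquiv.ofBijective f.1 hf).apply_symm_apply x)

theorem Bicomod.bijective_of_iso {M N : Bicomod k C D} (i : M ≅ N) :
    Function.Bijective i.hom.1 :=
  Function.bijective_iff_has_inverse.2 ⟨i.inv.1,
    fun x => LinearMap.congr_fun (congrArg Subtype.val i.hom_inv_id) x,
    fun x => LinearMap.congr_fun (congrArg Subtype.val i.inv_hom_id) x⟩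

/-- The kernel of a colinear map, the coaction being restricted. -/
noncomputable def RightComod.kernel {M N : RightComod k C} (f : M ⟶ N) : RightComod k C :=
  have hmem : ∀ x : LinearMap.eqLocus f.1 0, (M.coact ∘ₗ (LinearMap.eqLocus f.1 0).subtype) x
      ∈ LinearMap.range ((LinearMap.eqLocus f.1 0).subtype.rTensor C) := fun x => by
    apply range_rTensor_eqLocus
    have hx : f.1 x.1 = 0 := x.2
    rw [LinearMap.comp_apply, Submodule.subtype_apply, ← RightComod.hom_coact, hx]
    simp
  let i := (LinearMap.eqLocus f.1 0).subtype.rTensor C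
  have hi : Function.Injective i := Module.Flat.rTensor_preserves_injective_linearMap _
    (Submodule.injective_subtype _)
  { carrier := LinearMap.eqLocus f.1 0
    coact := (LinearEquiv.ofInjective i hi).symm.toLinearMap ∘ₗ
      (M.coact ∘ₗ (LinearMap.eqLocus f.1 0).subtype).codRestrict _ hmem
    isCoaction := M.isCoaction.of_injective _ (Submodule.injective_subtype _) (by
      ext x
      exact congrArg Subtype.val (LinearEquiv.apply_symm_apply (LinearEquiv.ofInjective i hi) _)) }

/-- The inclusion of the kernel. -/
noncomputable def RightComod.kernelι {M N : RightComod k C} (f : M ⟶ N) :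
    RightComod.kernel f ⟶ M :=
  ⟨(LinearMap.eqLocus f.1 0).subtype, by
    refine LinearMap.ext fun x => ?_
    exact congrArg Subtype.val (LinearEquiv.apply_symm_apply (LinearEquiv.ofInjective
      ((LinearMap.eqLocus f.1 0).subtype.rTensor C) (Module.Flat.rTensor_preserves_injective_linearMap _
    (Submodule.injective_subtype _))) _)⟩

/-- The linear kernel is a subcomodule because `- ⊗ C` is exact over a field. Its inclusion is
killed by the monomorphism `f`, hence is zero. -/
theorem RightComod.injective_of_mono {M N : RightComod k C} (f : M ⟶ N) [Mono f] :
    Function.Injective f.1 := by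
  rw [injective_iff_map_eq_zero]
  intro x hx
  have h : RightComod.kernelι f = 0 := by
    rw [← cancel_mono f, Limits.zero_comp]
    exact RightComod.hom_ext fun y => y.2
  exact LinearMap.congr_fun (congrArg Subtype.val h) (⟨x, hx⟩ : LinearMap.eqLocus f.1 0)

theorem RightComod.mono_of_injective {M N : RightComod k C} (f : M ⟶ N)
    (h : Function.Injective f.1) : Mono f :=
  ⟨fun g g' e => RightComod.hom_ext fun x => h (LinearMap.congr_fun (congrArg Subtype.val e) x)⟩

variable (k C) in
/-- The cofree right comodule `W ⊗ C`. -/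
noncomputable abbrev RightComod.cofree (W : Type u) [AddCommGroup W] [Module k W] : RightComod k C :=
  (RightComod.tensor W).obj (Bicomod.regular k C).toRight

/-- The colinear map into a cofree comodule that extends a linear map. -/
noncomputable def RightComod.toCofree (M : RightComod k C) {W : Type u} [AddCommGroup W] [Module k W]
    (f : M.carrier →ₗ[k] W) : M ⟶ RightComod.cofree k C W :=
  ⟨f.rTensor C ∘ₗ M.coact, by
    refine LinearMap.ext fun m => ?_
    have e := LinearMap.congr_fun M.isCoaction.coassoc m
    simp only [LinearMap.comp_apply, LinearEquiv.coe_coe] at e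
    change (f.rTensor C ∘ₗ M.coact).rTensor C (M.coact m)
      = (TensorProduct.assoc k W C C).symm
        ((Coalgebra.comul (R := k) (A := C)).lTensor W (f.rTensor C (M.coact m)))
    rw [lTensor_rTensor_comm, ← e, LinearEquiv.eq_symm_apply, LinearMap.rTensor_comp,
      LinearMap.comp_apply, assoc_rTensor_rTensor]⟩

theorem RightComod.toCofree_apply (M : RightComod k C) {W : Type u} [AddCommGroup W] [Module k W]
    (f : M.carrier →ₗ[k] W) (m : M.carrier) :
    (M.toCofree f).1 m = f.rTensor C (M.coact m) := rfl

variable (k C) in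
/-- The linear map `W ⊗ C → W` induced by the counit. -/
noncomputable def counitMap (W : Type u) [AddCommGroup W] [Module k W] : W ⊗[k] C →ₗ[k] W :=
  (TensorProduct.rid k W).toLinearMap ∘ₗ (Coalgebra.counit (R := k) (A := C)).lTensor W

@[simp] theorem counitMap_tmul {W : Type u} [AddCommGroup W] [Module k W] (w : W) (c : C) :
    counitMap k C W (w ⊗ₜ c) = Coalgebra.counit (R := k) c • w := by
  simp [counitMap]

theorem RightComod.counitMap_coact (M : RightComod k C) (m : M.carrier) :
    counitMap k C M.carrier (M.coact m) = m := M.rid_counit_coact m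

theorem counitMap_rTensor {W W' : Type u} [AddCommGroup W] [Module k W] [AddCommGroup W']
    [Module k W'] (f : W →ₗ[k] W') (z : W ⊗[k] C) :
    counitMap k C W' (f.rTensor C z) = f (counitMap k C W z) := by
  have : counitMap k C W' ∘ₗ f.rTensor C = f ∘ₗ counitMap k C W := by ext; simp
  exact LinearMap.congr_fun this z

theorem RightComod.counitMap_toCofree (M : RightComod k C) {W : Type u} [AddCommGroup W]
    [Module k W] (f : M.carrier →ₗ[k] W) (m : M.carrier) :
    counitMap k C W ((M.toCofree f).1 m) = f m := by
  rw [RightComod.toCofree_apply, counitMap_rTensor, RightComod.counitMap_coact]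

theorem rTensor_counitMap_tensorRight {W : Type u} [AddCommGroup W] [Module k W] (z : W ⊗[k] C) :
    (counitMap k C W).rTensor C (tensorRight W (Coalgebra.comul (R := k) (A := C)) z) = z := by
  have : (counitMap k C W).rTensor C ∘ₗ
    tensorRight W (Coalgebra.comul (R := k) (A := C)) = LinearMap.id := by
    apply TensorProduct.ext'
    intro w c
    have h := LinearMap.congr_fun (Coalgebra.rTensor_counit_comp_comul (R := k) (A := C)) c
    simp only [LinearMap.comp_apply, TensorProduct.mk_apply] at h
    have h2 : ∀ y : C ⊗[k] C, (counitMap k C W).rTensor C ((TensorProduct.assoc k W C C).symm (w ⊗ₜ y))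
        = w ⊗ₜ TensorProduct.lid k C ((Coalgebra.counit (R := k) (A := C)).rTensor C y) := by
      intro y
      induction y with
      | zero => simp
      | add a b ha hb => simp only [TensorProduct.tmul_add, map_add, ha, hb]
      | tmul c x' => simp [TensorProduct.smul_tmul]
    simp [tensorRight, h2, h]
  exact LinearMap.congr_fun this z

theorem rTensor_counitMap_comp {M W : Type u} [AddCommGroup M] [Module k M] [AddCommGroup W]
    [Module k W] {r : M →ₗ[k] M ⊗[k] C} (g : M →ₗ[k] W ⊗[k] C) (m : M)
    (h : tensorRight W (Coalgebra.comul (R := k) (A := C)) (g m) = g.rTensor C (r m)) :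
    (counitMap k C W ∘ₗ g).rTensor C (r m) = g m := by
  rw [LinearMap.rTensor_comp, LinearMap.comp_apply, ← h, rTensor_counitMap_tensorRight]

/-- Applying `W ⊗ ε ⊗ C` to the colinearity equation returns `g`. With `counitMap_toCofree` this is
the universal property of `W ⊗ C` as the cofree comodule on `W`. -/
theorem RightComod.eq_toCofree {M : RightComod k C} {W : Type u} [AddCommGroup W]
    [Module k W] (g : M ⟶ RightComod.cofree k C W) : g = M.toCofree (counitMap k C W ∘ₗ g.1) :=
  RightComod.hom_ext fun m => (@rTensor_counitMap_comp k _ C _ _ _ M.carrier W _ _ _ _ M.coact g.1 m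
    (RightComod.hom_coact g m)).symm

theorem RightComod.cofree_hom_ext {M : RightComod k C} {W : Type u} [AddCommGroup W]
    [Module k W] {g g' : M ⟶ RightComod.cofree k C W}
    (h : ∀ m, counitMap k C W (g.1 m) = counitMap k C W (g'.1 m)) : g = g' := by
  rw [RightComod.eq_toCofree g, RightComod.eq_toCofree g', LinearMap.ext (f := counitMap k C W ∘ₗ g.1)
    (g := counitMap k C W ∘ₗ g'.1) h]

/-- Colinear maps into `W ⊗ C` are linear maps into `W`, and over a field these extend along every
injection. -/
instance RightComod.injective_cofree (W : Type u) [AddCommGroup W] [Module k W] :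
    Injective (RightComod.cofree k C W) where
  factors {A B} g f hf := by
    obtain ⟨s, hs⟩ := f.1.exists_leftInverse_of_injective
      (LinearMap.ker_eq_bot.2 (RightComod.injective_of_mono f))
    refine ⟨B.toCofree (counitMap k C W ∘ₗ g.1 ∘ₗ s), RightComod.cofree_hom_ext fun m => ?_⟩
    have := LinearMap.congr_fun hs m
    simp only [LinearMap.comp_apply, LinearMap.id_apply] at this
    exact (RightComod.counitMap_toCofree _ _ _).trans
      (congrArg (fun a => counitMap k C W (g.1 a)) this)

/-- The coaction, as a colinear map to a cofree comodule. -/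
noncomputable def RightComod.coactHom (M : RightComod k C) : M ⟶ RightComod.cofree k C M.carrier :=
  M.toCofree LinearMap.id

theorem RightComod.coactHom_apply (M : RightComod k C) (m : M.carrier) :
    M.coactHom.1 m = M.coact m :=
  LinearMap.congr_fun (LinearMap.rTensor_id C M.carrier) (M.coact m)

instance (M : RightComod k C) : Mono M.coactHom :=
  RightComod.mono_of_injective _ fun x y h => M.coact_injective
    ((M.coactHom_apply x).symm.trans (h.trans (M.coactHom_apply y)))

/-- An injective comodule is a retract of a cofree one. -/
noncomputable def RightComod.retractCofree (M : RightComod k C) [Injective M] :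
    Retract M (RightComod.cofree k C M.carrier) where
  i := M.coactHom
  r := Injective.factorThru (𝟙 M) M.coactHom
  retract := Injective.comp_factorThru _ _

/-- An injective comodule is a retract of a cofree one, and `W ⊗ (M ⊗ C) ≅ (W ⊗ M) ⊗ C` is again
cofree. -/
theorem RightComod.injective_tensor (M : RightComod k C) [Injective M] (W : Type u)
    [AddCommGroup W] [Module k W] : Injective ((RightComod.tensor W).obj M) := by
  have i : (RightComod.tensor W).obj (RightComod.cofree k C M.carrier)
      ≅ RightComod.cofree k C (W ⊗[k] M.carrier) :=
    (RightComod.isoOfBijective (RightComod.tensorAssoc W M.carrier (Bicomod.regular k C).toRight)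
      (TensorProduct.assoc k W M.carrier C).bijective).symm
  have := Injective.of_iso i.symm inferInstance
  exact (M.retractCofree.map (RightComod.tensor W)).injective

end RightComodules

/-! ### Cotensor functors on right comodules and the unit isomorphisms. -/

section CotensorFunctors

variable {k : Type u} [Field k]
variable {C : Type u} [AddCommGroup C] [Module k C] [Coalgebra k C]
variable {D : Type u} [AddCommGroup D] [Module k D] [Coalgebra k D]
variable {E : Type u} [AddCommGroup E] [Module k E] [Coalgebra k E]

instance (X : Bicomod k C D) : (cotensorRightFunctor X).Additive where
  map_add {M N f g} := Subtype.ext (LinearMap.ext fun x => Subtype.ext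
    (LinearMap.congr_fun (TensorProduct.map_add_left f.1 g.1 LinearMap.id) x.1))

instance (X : Bicomod k C D) : (cotensorRightFunctor X).Linear k where
  map_smul {M N} f a := Subtype.ext (LinearMap.ext fun x => Subtype.ext
    (LinearMap.congr_fun (TensorProduct.map_smul_left a f.1 LinearMap.id) x.1))

/-- `M □_C X` is a subspace of `M ⊗ X`, and `- ⊗ X` is exact. Because of this, right adjoints of
cotensor functors preserve injectives. -/
instance (X : Bicomod k C D) : (cotensorRightFunctor X).PreservesMonomorphisms where
  preserves {M N} f hf := RightComod.mono_of_injective _ fun x y h => Subtype.ext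
    (Module.Flat.rTensor_preserves_injective_linearMap (M := X.carrier) f.1
      (RightComod.injective_of_mono f) (congrArg Subtype.val h))

/-- Tensoring with `W` is exact over a field, so it preserves the equalizer that defines `N □_D Y`.
-/
theorem tensorCotensor_bijective (W : Type u) [AddCommGroup W] [Module k W] (Y : Bicomod k D C)
    (N : RightComod k D) : Function.Bijective (tensorCotensor W Y N).1 := by
  constructor
  · intro x y h
    exact Module.Flat.lTensor_preserves_injective_linearMap (M := W) _
      (Submodule.injective_subtype _)
      ((TensorProduct.assoc k W N.carrier Y.carrier).symm.injective (congrArg Subtype.val h))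
  · intro z
    have hz := mem_cotensor.1 z.2
    have h1 := congrArg (TensorProduct.assoc k W N.carrier (D ⊗[k] Y.carrier)) hz
    have h2 : TensorProduct.assoc k W N.carrier Y.carrier z.1 ∈ LinearMap.range
        ((cotensor N.coact Y.coactLeft).subtype.lTensor W) := by
      apply range_lTensor_eqLocus
      exact ((assoc_tensorRight_rTensor N.coact z.1).symm.trans h1).trans (assoc_lTensor _ _)
    obtain ⟨y, hy⟩ := h2
    refine ⟨y, Subtype.ext ?_⟩
    change (TensorProduct.assoc k W N.carrier Y.carrier).symm
      ((cotensor N.coact Y.coactLeft).subtype.lTensor W y) = z.1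
    rw [hy]
    exact (TensorProduct.assoc k W N.carrier Y.carrier).symm_apply_apply z.1

/-- The isomorphism `W ⊗ (N □_D Y) ≅ (W ⊗ N) □_D Y`. -/
noncomputable def tensorCotensorIso (W : Type u) [AddCommGroup W] [Module k W] (Y : Bicomod k D C)
    (N : RightComod k D) : (RightComod.tensor W).obj ((cotensorRightFunctor Y).obj N) ≅
      (cotensorRightFunctor Y).obj ((RightComod.tensor W).obj N) :=
  RightComod.isoOfBijective _ (tensorCotensor_bijective W Y N)

/-- The inclusion `M □ N → M ⊗ N` stays injective after tensoring with `D`, so colinearity of a map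
into `M □ N` can be tested in `M ⊗ N`. -/
theorem rightColinear_codRestrict {A M N : Type u} [AddCommGroup A] [Module k A] [AddCommGroup M]
    [Module k M] [AddCommGroup N] [Module k N] (r : M →ₗ[k] M ⊗[k] C) {l : N →ₗ[k] C ⊗[k] N}
    {s : N →ₗ[k] N ⊗[k] D} (t : A →ₗ[k] A ⊗[k] D) (h : CoactionsCommute l s) (g : A →ₗ[k] M ⊗[k] N)
    (hg : ∀ a, g a ∈ cotensor r l) (hc : ∀ a, g.rTensor D (t a) = tensorRight M s (g a)) :
    (g.codRestrict (cotensor r l) hg).rTensor D ∘ₗ t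
      = cotensorRightCoaction r h ∘ₗ g.codRestrict (cotensor r l) hg := by
  rw [← LinearMap.cancel_left (Module.Flat.rTensor_preserves_injective_linearMap (M := D) _
      (Submodule.injective_subtype (cotensor r l))), ← LinearMap.comp_assoc, ← LinearMap.comp_assoc,
    cotensorRightCoaction_spec, ← LinearMap.rTensor_comp, LinearMap.subtype_comp_codRestrict,
    LinearMap.comp_assoc, LinearMap.subtype_comp_codRestrict]
  exact LinearMap.ext hc

theorem Bicomod.coactLeft_mem (Y : Bicomod k D C) (y : Y.carrier) :
    Y.coactLeft y ∈ FrobeniusComod.cotensor (Coalgebra.comul (R := k) (A := D)) Y.coactLeft :=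
  LinearMap.congr_fun Y.isLeftCoaction.coassoc y

/-- The colinear map `Y → D □_D Y` given by the coaction. -/
noncomputable def regularCotensorHom (Y : Bicomod k D C) :
    Y.toRight ⟶ (cotensorRightFunctor Y).obj (Bicomod.regular k D).toRight :=
  ⟨Y.coactLeft.codRestrict (cotensor (Coalgebra.comul (R := k) (A := D)) Y.coactLeft)
      Y.coactLeft_mem, by
    refine rightColinear_codRestrict _ _ Y.commute _ _ fun y => ?_
    exact (LinearEquiv.eq_symm_apply _).2 (LinearMap.congr_fun Y.commute y)⟩

variable (k C) in
/-- The linear map `C ⊗ W → W` induced by the counit. -/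
noncomputable def counitMapLeft (W : Type u) [AddCommGroup W] [Module k W] : C ⊗[k] W →ₗ[k] W :=
  (TensorProduct.lid k W).toLinearMap ∘ₗ (Coalgebra.counit (R := k) (A := C)).rTensor W

@[simp] theorem counitMapLeft_tmul {W : Type u} [AddCommGroup W] [Module k W] (w : W) (c : C) :
    counitMapLeft k C W (c ⊗ₜ w) = Coalgebra.counit (R := k) c • w := by
  simp [counitMapLeft]

theorem counitMapLeft_coactLeft (Y : Bicomod k D C) (y : Y.carrier) :
    counitMapLeft k D Y.carrier (Y.coactLeft y) = y := by
  have := LinearMap.congr_fun Y.isLeftCoaction.counit y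
  simp only [LinearMap.comp_apply, TensorProduct.mk_apply] at this
  simp [counitMapLeft, this]

theorem counitMapLeft_lTensor {W W' : Type u} [AddCommGroup W] [Module k W] [AddCommGroup W']
    [Module k W'] (f : W →ₗ[k] W') (z : C ⊗[k] W) :
    counitMapLeft k C W' (f.lTensor C z) = f (counitMapLeft k C W z) := by
  have : counitMapLeft k C W' ∘ₗ f.lTensor C = f ∘ₗ counitMapLeft k C W := by ext; simp
  exact LinearMap.congr_fun this z

theorem counitMapLeft_assoc {V W : Type u} [AddCommGroup V] [Module k V] [AddCommGroup W]
    [Module k W] (z : (V ⊗[k] C) ⊗[k] W) :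
    (counitMapLeft k C W).lTensor V (TensorProduct.assoc k V C W z)
      = (counitMap k C V).rTensor W z := by
  have : (counitMapLeft k C W).lTensor V ∘ₗ (TensorProduct.assoc k V C W).toLinearMap
      = (counitMap k C V).rTensor W := by
    ext v c w
    simp [TensorProduct.smul_tmul]
  exact LinearMap.congr_fun this z

/-- An element of `D □_D Y` is determined by its counit. -/
theorem coactLeft_counitMapLeft (Y : Bicomod k D C)
    (z : cotensor (Coalgebra.comul (R := k) (A := D)) Y.coactLeft) :
    Y.coactLeft (counitMapLeft k D Y.carrier z.1) = z.1 := by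
  rw [← counitMapLeft_lTensor, ← mem_cotensor.1 z.2]
  have e : ∀ y : D ⊗[k] Y.carrier, counitMapLeft k D (D ⊗[k] Y.carrier)
      (TensorProduct.assoc k D D Y.carrier ((Coalgebra.comul (R := k) (A := D)).rTensor Y.carrier y))
      = y := by
    have : counitMapLeft k D (D ⊗[k] Y.carrier) ∘ₗ (TensorProduct.assoc k D D Y.carrier).toLinearMap
        ∘ₗ (Coalgebra.comul (R := k) (A := D)).rTensor Y.carrier = LinearMap.id := by
      apply TensorProduct.ext'
      intro d y
      have h := LinearMap.congr_fun (Coalgebra.rTensor_counit_comp_comul (R := k) (A := D)) d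
      simp only [LinearMap.comp_apply, TensorProduct.mk_apply] at h
      have h2 : ∀ v : D ⊗[k] D, counitMapLeft k D (D ⊗[k] Y.carrier)
          (TensorProduct.assoc k D D Y.carrier (v ⊗ₜ y)) = TensorProduct.lid k D
            ((Coalgebra.counit (R := k) (A := D)).rTensor D v) ⊗ₜ y := by
        intro v
        induction v with
        | zero => simp
        | add a b ha hb => simp only [TensorProduct.add_tmul, map_add, ha, hb]
        | tmul c x' => simp [TensorProduct.smul_tmul']
      simp [h2, h]
    exact LinearMap.congr_fun this
  exact e _

/-- The inverse is the restriction of `ε ⊗ Y` to `D □_D Y`. -/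
theorem regularCotensorHom_bijective (Y : Bicomod k D C) :
    Function.Bijective (regularCotensorHom Y).1 := by
  constructor
  · intro x y h
    have := congrArg (fun z => counitMapLeft k D Y.carrier (Subtype.val z)) h
    exact (counitMapLeft_coactLeft Y x).symm.trans (this.trans (counitMapLeft_coactLeft Y y))
  · intro z
    exact ⟨counitMapLeft k D Y.carrier z.1, Subtype.ext (coactLeft_counitMapLeft Y z)⟩

/-- The isomorphism `Y ≅ D □_D Y` of right comodules. -/
noncomputable def regularCotensorIso (Y : Bicomod k D C) :
    Y.toRight ≅ (cotensorRightFunctor Y).obj (Bicomod.regular k D).toRight :=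
  RightComod.isoOfBijective _ (regularCotensorHom_bijective Y)

/-- If `X` is injective as a right comodule, then `- □_C X` preserves injective comodules. -/
theorem injective_cotensorRightFunctor_obj (X : Bicomod k C D) [Injective X.toRight]
    (M : RightComod k C) [Injective M] : Injective ((cotensorRightFunctor X).obj M) := by
  -- `M` is a retract of `M ⊗ C`, so `M □_C X` is a retract of `(M ⊗ C) □_C X ≅ M ⊗ X`, which is
  -- injective together with `X`.
  have h1 := X.toRight.injective_tensor M.carrier
  have h2 := Injective.of_iso
    ((RightComod.tensor M.carrier).mapIso (regularCotensorIso X) ≪≫ tensorCotensorIso M.carrier X _) h1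
  exact (M.retractCofree.map (cotensorRightFunctor X)).injective

theorem RightComod.cotensor_coact_val (X : Bicomod k C D) (M : RightComod k C)
    (z : FrobeniusComod.cotensor M.coact X.coactLeft) :
    (FrobeniusComod.cotensor M.coact X.coactLeft).subtype.rTensor D ((M.cotensor X).coact z)
      = tensorRight M.carrier X.coactRight z.1 :=
  LinearMap.congr_fun (cotensorRightCoaction_spec M.coact X.commute) z

/-- The natural transformation `- □_C f`. -/
noncomputable def cotensorRightMap {X Y : Bicomod k C D} (f : X ⟶ Y) :
    cotensorRightFunctor X ⟶ cotensorRightFunctor Y where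
  app M := ⟨cotensorMap LinearMap.id f.1 (by simp) f.2.1,
    cotensorMap_rightColinear X.commute Y.commute _ _ _ _ f.2.2⟩
  naturality M N g := RightComod.hom_ext fun z => Subtype.ext
    (lTensor_rTensor_comm g.1 f.1 z.1)

/-- Isomorphic bicomodules have isomorphic cotensor functors. -/
noncomputable def cotensorRightMapIso {X Y : Bicomod k C D} (f : X ≅ Y) :
    cotensorRightFunctor X ≅ cotensorRightFunctor Y where
  hom := cotensorRightMap f.hom
  inv := cotensorRightMap f.inv
  hom_inv_id := by
    ext M
    refine RightComod.hom_ext fun z => Subtype.ext ?_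
    change f.inv.1.lTensor M.carrier (f.hom.1.lTensor M.carrier z.1) = z.1
    rw [← LinearMap.comp_apply, ← LinearMap.lTensor_comp,
      show f.inv.1 ∘ₗ f.hom.1 = LinearMap.id from congrArg Subtype.val f.hom_inv_id]
    simp
  inv_hom_id := by
    ext M
    refine RightComod.hom_ext fun z => Subtype.ext ?_
    change f.hom.1.lTensor M.carrier (f.inv.1.lTensor M.carrier z.1) = z.1
    rw [← LinearMap.comp_apply, ← LinearMap.lTensor_comp,
      show f.hom.1 ∘ₗ f.inv.1 = LinearMap.id from congrArg Subtype.val f.inv_hom_id]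
    simp

theorem RightComod.coact_mem (M : RightComod k C) (m : M.carrier) :
    M.coact m ∈ FrobeniusComod.cotensor M.coact (Coalgebra.comul (R := k) (A := C)) :=
  LinearMap.congr_fun M.isCoaction.coassoc m

/-- The colinear map `M → M □_C C` given by the coaction. -/
noncomputable def cotensorRegularHom (M : RightComod k C) :
    M ⟶ (cotensorRightFunctor (Bicomod.regular k C)).obj M :=
  ⟨M.coact.codRestrict (cotensor M.coact (Coalgebra.comul (R := k) (A := C))) M.coact_mem, by
    refine rightColinear_codRestrict _ _ (Bicomod.regular k C).commute _ _ fun m => ?_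
    have e1 := RightComod.hom_coact M.coactHom m
    have e2 : M.coactHom.1 = M.coact := LinearMap.ext M.coactHom_apply
    rw [e2] at e1
    exact e1.symm⟩

/-- Contracting the last factor of the equation that defines `M □_C C` with the counit gives the
claim; thus `M ⊗ ε` inverts the coaction `M → M □_C C`. -/
theorem coact_counitMap (M : RightComod k C)
    (z : cotensor M.coact (Coalgebra.comul (R := k) (A := C))) :
    M.coact (counitMap k C M.carrier z.1) = z.1 := by
  rw [← counitMap_rTensor]
  have e : ∀ y : M.carrier ⊗[k] (C ⊗[k] C), counitMap k C (M.carrier ⊗[k] C)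
      ((TensorProduct.assoc k M.carrier C C).symm y) = (counitMap k C C).lTensor M.carrier y := by
    have : counitMap k C (M.carrier ⊗[k] C) ∘ₗ (TensorProduct.assoc k M.carrier C C).symm.toLinearMap
        = (counitMap k C C).lTensor M.carrier := by
      ext m c c'
      simp
    exact LinearMap.congr_fun this
  have h := (LinearEquiv.eq_symm_apply _).2 (mem_cotensor.1 z.2)
  have h3 : counitMap k C C ∘ₗ Coalgebra.comul = LinearMap.id :=
    LinearMap.ext (Bicomod.regular k C).toRight.counitMap_coact
  rw [h, e, ← LinearMap.comp_apply, ← LinearMap.lTensor_comp, h3]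
  simp

theorem cotensorRegularHom_bijective (M : RightComod k C) :
    Function.Bijective (cotensorRegularHom M).1 :=
  ⟨fun _ _ h => M.coact_injective (congrArg Subtype.val h), fun z =>
    ⟨counitMap k C M.carrier z.1, Subtype.ext (coact_counitMap M z)⟩⟩

variable (k C) in
/-- The isomorphism `id ≅ - □_C C`. -/
noncomputable def cotensorRegularIso :
    𝟭 (RightComod k C) ≅ cotensorRightFunctor (Bicomod.regular k C) :=
  NatIso.ofComponents (fun M => RightComod.isoOfBijective _ (cotensorRegularHom_bijective M))
    fun f => RightComod.hom_ext fun m => Subtype.ext (RightComod.hom_coact f m)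

end CotensorFunctors

/-! ### Associativity of the cotensor product. -/

section Associativity

variable {k : Type u} [Field k]

theorem rTensor_assoc_symm_lTensor {M X Y C : Type u} [AddCommGroup M] [Module k M] [AddCommGroup X]
    [Module k X] [AddCommGroup Y] [Module k Y] [AddCommGroup C] [Module k C]
    (r : M →ₗ[k] M ⊗[k] C) (w : (M ⊗[k] X) ⊗[k] Y) :
    (TensorProduct.assoc k C X Y).toLinearMap.lTensor M (TensorProduct.assoc k M (C ⊗[k] X) Y
        (((TensorProduct.assoc k M C X).toLinearMap ∘ₗ r.rTensor X).rTensor Y w))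
      = TensorProduct.assoc k M C (X ⊗[k] Y) (r.rTensor (X ⊗[k] Y) (TensorProduct.assoc k M X Y w)) := by
  have : (TensorProduct.assoc k C X Y).toLinearMap.lTensor M ∘ₗ
      (TensorProduct.assoc k M (C ⊗[k] X) Y).toLinearMap ∘ₗ
        ((TensorProduct.assoc k M C X).toLinearMap ∘ₗ r.rTensor X).rTensor Y
      = (TensorProduct.assoc k M C (X ⊗[k] Y)).toLinearMap ∘ₗ r.rTensor (X ⊗[k] Y) ∘ₗ
        (TensorProduct.assoc k M X Y).toLinearMap := by
    apply TensorProduct.ext_threefold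
    intro m x y
    simp only [LinearMap.comp_apply, LinearMap.rTensor_tmul, LinearEquiv.coe_coe,
      TensorProduct.assoc_tmul]
    generalize r m = v
    induction v with
    | zero => simp
    | add a b ha hb => simp only [TensorProduct.add_tmul, map_add, ha, hb]
    | tmul c x' => simp
  exact LinearMap.congr_fun this w

theorem rTensor_lTensor_tensorLeft {M X Y C : Type u} [AddCommGroup M] [Module k M] [AddCommGroup X]
    [Module k X] [AddCommGroup Y] [Module k Y] [AddCommGroup C] [Module k C]
    (l : X →ₗ[k] C ⊗[k] X) (w : (M ⊗[k] X) ⊗[k] Y) :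
    (TensorProduct.assoc k C X Y).toLinearMap.lTensor M (TensorProduct.assoc k M (C ⊗[k] X) Y
        ((l.lTensor M).rTensor Y w))
      = (tensorLeft Y l).lTensor M (TensorProduct.assoc k M X Y w) := by
  have : (TensorProduct.assoc k C X Y).toLinearMap.lTensor M ∘ₗ
      (TensorProduct.assoc k M (C ⊗[k] X) Y).toLinearMap ∘ₗ (l.lTensor M).rTensor Y
      = (tensorLeft Y l).lTensor M ∘ₗ (TensorProduct.assoc k M X Y).toLinearMap := by
    apply TensorProduct.ext_threefold
    intro m x y
    simp [tensorLeft]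
  exact LinearMap.congr_fun this w

/-- Submodules with the same image under injective maps are isomorphic. -/
theorem exists_linearEquiv_of_map_eq {A B E : Type u} [AddCommGroup A] [Module k A] [AddCommGroup B]
    [Module k B] [AddCommGroup E] [Module k E] (p : Submodule k A) (q : Submodule k B)
    (a : A →ₗ[k] E) (b : B →ₗ[k] E) (ha : Function.Injective a) (hb : Function.Injective b)
    (h : p.map a = q.map b) : ∃ e : p ≃ₗ[k] q, ∀ z, b (e z).1 = a z.1 := by
  refine ⟨(p.equivMapOfInjective a ha).trans ((LinearEquiv.ofEq _ _ h).trans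
    (q.equivMapOfInjective b hb).symm), fun z => ?_⟩
  have := Submodule.coe_equivMapOfInjective_apply b hb q
    ((q.equivMapOfInjective b hb).symm ((LinearEquiv.ofEq _ _ h) (p.equivMapOfInjective a ha z)))
  rw [LinearEquiv.apply_symm_apply] at this
  exact this.symm

section

variable {M X Y C D : Type u} [AddCommGroup M] [Module k M] [AddCommGroup X]
    [Module k X] [AddCommGroup Y] [Module k Y] [AddCommGroup C] [Module k C]
    [AddCommGroup D] [Module k D]
    (r : M →ₗ[k] M ⊗[k] C) {l : X →ₗ[k] C ⊗[k] X} {s : X →ₗ[k] X ⊗[k] D} (h : CoactionsCommute l s)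
    (l' : Y →ₗ[k] D ⊗[k] Y)

/-- The two bracketings are compared inside `(M ⊗ X) ⊗ Y`. There, membership in the outer cotensor
product is the equation defining `M □ X`, tensored with `Y`; nothing is lost, since all inclusions
stay injective after tensoring. -/
theorem mem_cotensor_cotensorLeftCoaction (z : M ⊗[k] cotensor s l') :
    z ∈ cotensor r (cotensorLeftCoaction l' h) ↔
      ((TensorProduct.assoc k M C X).toLinearMap ∘ₗ r.rTensor X).rTensor Y
        ((TensorProduct.assoc k M X Y).symm ((cotensor s l').subtype.lTensor M z))
      = (l.lTensor M).rTensor Y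
        ((TensorProduct.assoc k M X Y).symm ((cotensor s l').subtype.lTensor M z)) := by
  have hi : Function.Injective (((cotensor s l').subtype.lTensor C).lTensor M) :=
    Module.Flat.lTensor_preserves_injective_linearMap _
      (Module.Flat.lTensor_preserves_injective_linearMap _ (Submodule.injective_subtype _))
  have hj : Function.Injective ((TensorProduct.assoc k C X Y).toLinearMap.lTensor M) :=
    Module.Flat.lTensor_preserves_injective_linearMap _ (TensorProduct.assoc k C X Y).injective
  rw [mem_cotensor, ← hi.eq_iff, ← assoc_lTensor, lTensor_rTensor_comm,
    ← LinearMap.comp_apply (((cotensor s l').subtype.lTensor C).lTensor M),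
    ← LinearMap.lTensor_comp, cotensorLeftCoaction_spec, LinearMap.lTensor_comp,
    LinearMap.comp_apply, ← (TensorProduct.assoc k M (C ⊗[k] X) Y).injective.eq_iff, ← hj.eq_iff,
    rTensor_assoc_symm_lTensor, rTensor_lTensor_tensorLeft, LinearEquiv.apply_symm_apply]

theorem mem_cotensor_cotensorRightCoaction (z : cotensor r l ⊗[k] Y) :
    z ∈ cotensor (cotensorRightCoaction r h) l' ↔
      ((TensorProduct.assoc k X D Y).toLinearMap ∘ₗ s.rTensor Y).lTensor M
        (TensorProduct.assoc k M X Y ((cotensor r l).subtype.rTensor Y z))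
      = (l'.lTensor X).lTensor M
        (TensorProduct.assoc k M X Y ((cotensor r l).subtype.rTensor Y z)) := by
  have hi : Function.Injective ((cotensor r l).subtype.rTensor (D ⊗[k] Y)) :=
    Module.Flat.rTensor_preserves_injective_linearMap _ (Submodule.injective_subtype _)
  rw [mem_cotensor, ← hi.eq_iff, ← assoc_rTensor_rTensor,
    ← LinearMap.comp_apply (((cotensor r l).subtype.rTensor D).rTensor Y),
    ← LinearMap.rTensor_comp, cotensorRightCoaction_spec, LinearMap.rTensor_comp,
    LinearMap.comp_apply, ← lTensor_rTensor_comm,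
    ← (TensorProduct.assoc k M X (D ⊗[k] Y)).injective.eq_iff, assoc_tensorRight_rTensor,
    assoc_lTensor]

/-- The associativity isomorphism of the cotensor product. -/
theorem exists_cotensorAssoc : ∃ e : cotensor r (cotensorLeftCoaction l' h) ≃ₗ[k]
      cotensor (cotensorRightCoaction r h) l', ∀ z,
    (cotensor r l).subtype.rTensor Y (e z).1
      = (TensorProduct.assoc k M X Y).symm ((cotensor s l').subtype.lTensor M z.1) := by
  refine exists_linearEquiv_of_map_eq (cotensor r (cotensorLeftCoaction l' h))
    (cotensor (cotensorRightCoaction r h) l')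
    ((TensorProduct.assoc k M X Y).symm.toLinearMap ∘ₗ (cotensor s l').subtype.lTensor M)
    ((cotensor r l).subtype.rTensor Y)
    ((TensorProduct.assoc k M X Y).symm.injective.comp
      (Module.Flat.lTensor_preserves_injective_linearMap _ (Submodule.injective_subtype _)))
    (Module.Flat.rTensor_preserves_injective_linearMap _ (Submodule.injective_subtype _)) ?_
  -- Both images are the intersection of `(M □ X) ⊗ Y` with `M ⊗ (X □ Y)`, as tensoring over a field
  -- preserves either equalizer.
  ext w
  constructor
  · rintro ⟨z, hz, rfl⟩
    have h1 := (mem_cotensor_cotensorLeftCoaction r h l' z).1 hz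
    obtain ⟨y, hy⟩ := range_rTensor_eqLocus Y _ _ _ h1
    refine ⟨y, (mem_cotensor_cotensorRightCoaction r h l' y).2 ?_, hy⟩
    erw [hy]
    rw [LinearEquiv.apply_symm_apply, ← LinearMap.comp_apply, ← LinearMap.lTensor_comp,
      ← LinearMap.comp_apply, ← LinearMap.lTensor_comp]
    congr 2
    exact LinearMap.ext fun x => x.2
  · rintro ⟨y, hy, rfl⟩
    have h1 := (mem_cotensor_cotensorRightCoaction r h l' y).1 hy
    obtain ⟨z, hz⟩ := range_lTensor_eqLocus M _ _ _ h1
    have hz' : (TensorProduct.assoc k M X Y).symm ((cotensor s l').subtype.lTensor M z)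
        = (cotensor r l).subtype.rTensor Y y := (LinearEquiv.symm_apply_eq _).2 hz
    refine ⟨z, (mem_cotensor_cotensorLeftCoaction r h l' z).2 ?_, hz'⟩
    rw [hz', ← LinearMap.comp_apply, ← LinearMap.rTensor_comp,
      ← LinearMap.comp_apply, ← LinearMap.rTensor_comp]
    congr 2
    exact LinearMap.ext fun x => x.2

/-- The associativity isomorphism `M □ (X □ Y) ≃ (M □ X) □ Y`. -/
noncomputable def cotensorAssoc : cotensor r (cotensorLeftCoaction l' h) ≃ₗ[k]
    cotensor (cotensorRightCoaction r h) l' := (exists_cotensorAssoc r h l').choose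

theorem cotensorAssoc_spec (z : cotensor r (cotensorLeftCoaction l' h)) :
    (cotensor r l).subtype.rTensor Y (cotensorAssoc r h l' z).1
      = (TensorProduct.assoc k M X Y).symm ((cotensor s l').subtype.lTensor M z.1) :=
  (exists_cotensorAssoc r h l').choose_spec z

end

variable {C : Type u} [AddCommGroup C] [Module k C] [Coalgebra k C]
variable {D : Type u} [AddCommGroup D] [Module k D] [Coalgebra k D]
variable {E : Type u} [AddCommGroup E] [Module k E] [Coalgebra k E]

/-- Both coactions are restrictions of the coaction of `M ⊗ X ⊗ Y` coming from `t`, and the target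
embeds there even after tensoring with `E`. -/
theorem cotensorAssoc_colinear {M X Y : Type u} [AddCommGroup M] [Module k M] [AddCommGroup X]
    [Module k X] [AddCommGroup Y] [Module k Y]
    (r : M →ₗ[k] M ⊗[k] C) {l : X →ₗ[k] C ⊗[k] X} {s : X →ₗ[k] X ⊗[k] D} (h : CoactionsCommute l s)
    {l' : Y →ₗ[k] D ⊗[k] Y} {t : Y →ₗ[k] Y ⊗[k] E} (h' : CoactionsCommute l' t)
    (h'' : CoactionsCommute (cotensorLeftCoaction l' h) (cotensorRightCoaction s h')) :
    (cotensorAssoc r h l').toLinearMap.rTensor E ∘ₗ cotensorRightCoaction r h''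
      = cotensorRightCoaction (cotensorRightCoaction r h) h' ∘ₗ (cotensorAssoc r h l').toLinearMap := by
  have hi : Function.Injective (((cotensor r l).subtype.rTensor Y ∘ₗ
      (cotensor (cotensorRightCoaction r h) l').subtype).rTensor E) :=
    Module.Flat.rTensor_preserves_injective_linearMap _
      ((Module.Flat.rTensor_preserves_injective_linearMap _ (Submodule.injective_subtype _)).comp
        (Submodule.injective_subtype _))
  have e0 : ((cotensor r l).subtype.rTensor Y ∘ₗ
      (cotensor (cotensorRightCoaction r h) l').subtype) ∘ₗ (cotensorAssoc r h l').toLinearMap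
      = ((TensorProduct.assoc k M X Y).symm.toLinearMap ∘ₗ (cotensor s l').subtype.lTensor M) ∘ₗ
        (cotensor r (cotensorLeftCoaction l' h)).subtype :=
    LinearMap.ext (cotensorAssoc_spec r h l')
  have e1 := cotensorRightCoaction_spec r h''
  have e2 := cotensorRightCoaction_spec (cotensorRightCoaction r h) h'
  have e3 := tensorRight_rTensor t (cotensor r l).subtype
  have e4 := tensorRight_lTensor (M := M) _ (cotensorRightCoaction_spec s h')
  have e5 := tensorRight_assoc (M := M) (M' := X) t
  have e6 : tensorRight (M ⊗[k] X) t ∘ₗ (TensorProduct.assoc k M X Y).symm.toLinearMap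
      = (TensorProduct.assoc k M X Y).symm.toLinearMap.rTensor E ∘ₗ tensorRight M (tensorRight X t) := by
    apply LinearMap.ext
    intro v
    have := LinearMap.congr_fun e5 ((TensorProduct.assoc k M X Y).symm v)
    simp only [LinearMap.comp_apply, LinearEquiv.coe_coe, LinearEquiv.apply_symm_apply] at this
    simp only [LinearMap.comp_apply, LinearEquiv.coe_coe, ← this]
    rw [← LinearMap.comp_apply ((TensorProduct.assoc k M X Y).symm.toLinearMap.rTensor E),
      ← LinearMap.rTensor_comp]
    simp
  have hA : ((cotensor r l).subtype.rTensor Y ∘ₗ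
      (cotensor (cotensorRightCoaction r h) l').subtype).rTensor E ∘ₗ
        cotensorRightCoaction (cotensorRightCoaction r h) h'
      = tensorRight (M ⊗[k] X) t ∘ₗ ((cotensor r l).subtype.rTensor Y ∘ₗ
      (cotensor (cotensorRightCoaction r h) l').subtype) := by
    rw [LinearMap.rTensor_comp, LinearMap.comp_assoc, e2, ← LinearMap.comp_assoc, e3,
      LinearMap.comp_assoc]
  have hB : (((TensorProduct.assoc k M X Y).symm.toLinearMap ∘ₗ (cotensor s l').subtype.lTensor M) ∘ₗ
        (cotensor r (cotensorLeftCoaction l' h)).subtype).rTensor E ∘ₗ cotensorRightCoaction r h''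
      = tensorRight (M ⊗[k] X) t ∘ₗ ((TensorProduct.assoc k M X Y).symm.toLinearMap ∘ₗ
        (cotensor s l').subtype.lTensor M) ∘ₗ (cotensor r (cotensorLeftCoaction l' h)).subtype := by
    rw [LinearMap.rTensor_comp, LinearMap.comp_assoc, e1, LinearMap.rTensor_comp,
      LinearMap.comp_assoc, ← LinearMap.comp_assoc (cotensor r _).subtype, e4,
      ← LinearMap.comp_assoc, ← LinearMap.comp_assoc, ← e6]
    rfl
  rw [← LinearMap.cancel_left hi, ← LinearMap.comp_assoc, ← LinearMap.rTensor_comp, e0, hB,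
    ← LinearMap.comp_assoc (cotensorAssoc r h l').toLinearMap, hA]
  exact congrArg (fun g => tensorRight (M ⊗[k] X) t ∘ₗ g) e0.symm

/-- The isomorphism `- □ (X □ Y) ≅ (- □ X) □ Y`. -/
noncomputable def cotensorRightCompIso (X : Bicomod k C D) (Y : Bicomod k D E) :
    cotensorRightFunctor (X.cotensor Y) ≅ cotensorRightFunctor X ⋙ cotensorRightFunctor Y :=
  NatIso.ofComponents (fun M => RightComod.isoOfBijective
      ⟨(cotensorAssoc M.coact X.commute Y.coactLeft).toLinearMap,
        cotensorAssoc_colinear M.coact X.commute Y.commute (X.cotensor Y).commute⟩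
      (cotensorAssoc M.coact X.commute Y.coactLeft).bijective) fun {M N} f => by
    refine RightComod.hom_ext fun z => Subtype.ext ?_
    -- Naturality is tested in `(N ⊗ X) ⊗ Y`, where both legs act as `f ⊗ X ⊗ Y`.
    apply Module.Flat.rTensor_preserves_injective_linearMap (M := Y.carrier) _
      (Submodule.injective_subtype (cotensor N.coact X.coactLeft))
    refine (cotensorAssoc_spec N.coact X.commute Y.coactLeft _).trans ?_
    have e2 := cotensorAssoc_spec M.coact X.commute Y.coactLeft z
    have key : ∀ (g : cotensor M.coact X.coactLeft →ₗ[k] cotensor N.coact X.coactLeft)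
        (_ : (cotensor N.coact X.coactLeft).subtype ∘ₗ g
          = f.1.rTensor X.carrier ∘ₗ (cotensor M.coact X.coactLeft).subtype)
        (v : cotensor M.coact X.coactLeft ⊗[k] Y.carrier),
        (cotensor N.coact X.coactLeft).subtype.rTensor Y.carrier (g.rTensor Y.carrier v)
        = (f.1.rTensor X.carrier).rTensor Y.carrier
          ((cotensor M.coact X.coactLeft).subtype.rTensor Y.carrier v) := fun g hg v => by
      rw [← LinearMap.comp_apply, ← LinearMap.comp_apply, ← LinearMap.rTensor_comp,
        ← LinearMap.rTensor_comp, hg]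
    refine Eq.trans ?_ (key _ rfl _).symm
    refine Eq.trans ?_ (congrArg ((f.1.rTensor X.carrier).rTensor Y.carrier) e2).symm
    have key2 : ∀ v : M.carrier ⊗[k] (X.carrier ⊗[k] Y.carrier),
        (TensorProduct.assoc k N.carrier X.carrier Y.carrier).symm (f.1.rTensor _ v)
        = (f.1.rTensor X.carrier).rTensor Y.carrier
          ((TensorProduct.assoc k M.carrier X.carrier Y.carrier).symm v) := fun v => by
      rw [LinearEquiv.symm_apply_eq, assoc_rTensor_rTensor, LinearEquiv.apply_symm_apply]
    refine Eq.trans ?_ (key2 _)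
    exact congrArg _ (lTensor_rTensor_comm f.1 _ z.1)

end Associativity

/-! ### The bicolinear counit of a duality. -/

section Counit

variable {k : Type u} [Field k]
variable {C : Type u} [AddCommGroup C] [Module k C] [Coalgebra k C]
variable {D : Type u} [AddCommGroup D] [Module k D] [Coalgebra k D]
variable {X : Bicomod k C D} {L : Bicomod k D C}

theorem rTensor_eta_mem {η : C →ₗ[k] X.carrier ⊗[k] L.carrier} (h : IsUnitMap X L η) (c : C) :
    X.coactRight.rTensor L.carrier (η c)
      = (TensorProduct.assoc k X.carrier D L.carrier).symm (L.coactLeft.lTensor X.carrier (η c)) :=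
  (LinearEquiv.eq_symm_apply _).2 (mem_cotensor.1 (h.mem c))

/-- The map `l ⊗ x ↦ e (l ⊗ x₀) x₁`. -/
noncomputable def CoDual.counitRight (a : CoDual X L) : L.carrier ⊗[k] X.carrier →ₗ[k] D :=
  (TensorProduct.lid k D).toLinearMap ∘ₗ a.e.rTensor D ∘ₗ tensorRight L.carrier X.coactRight

/-- The map `l ⊗ x ↦ l₋₁ e (l₀ ⊗ x)`. -/
noncomputable def CoDual.counitLeft (a : CoDual X L) : L.carrier ⊗[k] X.carrier →ₗ[k] D :=
  (TensorProduct.rid k D).toLinearMap ∘ₗ a.e.lTensor D ∘ₗ tensorLeft X.carrier L.coactLeft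

/-- For `y = v ⊗ l'` both sides are `e'(l ⊗ v) e(l'₀ ⊗ x) l'₋₁`. -/
theorem lid_rTensor_contractRight {L X D V : Type u} [AddCommGroup L] [Module k L] [AddCommGroup X]
    [Module k X] [AddCommGroup D] [Module k D] [AddCommGroup V] [Module k V]
    (e : L ⊗[k] X →ₗ[k] k) (lL : L →ₗ[k] D ⊗[k] L) (l : L) (y : V ⊗[k] L) (x : X)
    (e' : L ⊗[k] V →ₗ[k] k) :
    TensorProduct.lid k D (e'.rTensor D ((TensorProduct.assoc k L V D).symm (l ⊗ₜ
      contractRight (V ⊗[k] D) e (((TensorProduct.assoc k V D L).symm (lL.lTensor V y)) ⊗ₜ x))))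
    = TensorProduct.rid k D (e.lTensor D (tensorLeft X lL (contractLeft L e' (l ⊗ₜ y) ⊗ₜ x))) := by
  induction y with
  | zero => simp
  | add a b ha hb => simp only [TensorProduct.tmul_add, TensorProduct.add_tmul, map_add, ha, hb]
  | tmul v l' =>
    simp only [LinearMap.lTensor_tmul, contractLeft_tmul, tensorLeft, LinearMap.comp_apply,
      LinearMap.rTensor_tmul, map_smul, LinearEquiv.coe_coe, ← TensorProduct.smul_tmul']
    generalize lL l' = w
    induction w with
    | zero => simp
    | add a b ha hb =>
      simp only [TensorProduct.tmul_add, TensorProduct.add_tmul, map_add, ha, hb, smul_add]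
    | tmul d l'' =>
      simp [smul_smul, mul_comm]

/-- In `e(l ⊗ x₀) x₁` the element `x` is replaced by means of the second triangle identity. The
coaction of `D` then falls on the `X`-factor of `η`, and membership of `η` in `X □_D L` moves it to
the `L`-factor. -/
theorem CoDual.counitRight_eq (a : CoDual X L) (z : L.carrier ⊗[k] X.carrier) :
    a.counitRight z = a.counitLeft ((contractLeft L.carrier a.e ∘ₗ a.η.lTensor L.carrier).rTensor _
      ((TensorProduct.assoc k L.carrier C X.carrier).symm (X.coactLeft.lTensor L.carrier z))) := by
  induction z with
  | zero => simp
  | add a b ha hb => simp only [map_add, ha, hb]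
  | tmul l x =>
    have key : ∀ y : C ⊗[k] X.carrier, TensorProduct.lid k D (a.e.rTensor D
          ((TensorProduct.assoc k L.carrier X.carrier D).symm
            (l ⊗ₜ X.coactRight (contractRight X.carrier a.e (a.η.rTensor X.carrier y)))))
        = a.counitLeft ((contractLeft L.carrier a.e ∘ₗ a.η.lTensor L.carrier).rTensor _
          ((TensorProduct.assoc k L.carrier C X.carrier).symm (l ⊗ₜ y))) := by
      intro y
      induction y with
      | zero => simp
      | add a b ha hb => simp only [TensorProduct.tmul_add, map_add, ha, hb]
      | tmul c x =>
        rw [← contractRight_rTensor, LinearMap.rTensor_tmul, LinearMap.rTensor_tmul,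
          rTensor_eta_mem a.isUnitMap, lid_rTensor_contractRight]
        simp [counitLeft]
    have := key (X.coactLeft x)
    rw [a.triangle_right] at this
    simpa [counitRight, tensorRight] using this

/-- On `L □_C X` the left coaction of `X` in `counitRight_eq` can be traded for the right coaction
of `L`, and the first triangle identity collapses the result. This makes the counit bicolinear: one
formula is right colinear by coassociativity, the other left colinear. -/
theorem CoDual.counitRight_eq_counitLeft (a : CoDual X L) (z : L.carrier ⊗[k] X.carrier)
    (hz : z ∈ cotensor L.coactRight X.coactLeft) : a.counitRight z = a.counitLeft z := by
  have h : (contractLeft L.carrier a.e ∘ₗ a.η.lTensor L.carrier) ∘ₗ L.coactRight = LinearMap.id :=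
    LinearMap.ext a.triangle_left
  rw [a.counitRight_eq, ← mem_cotensor.1 hz, LinearEquiv.symm_apply_apply]
  refine congrArg a.counitLeft ?_
  rw [← LinearMap.comp_apply, ← LinearMap.rTensor_comp, h, LinearMap.rTensor_id, LinearMap.id_apply]

theorem CoDual.counit_counitRight (a : CoDual X L) (z : L.carrier ⊗[k] X.carrier) :
    Coalgebra.counit (R := k) (a.counitRight z) = a.e z := by
  have h1 : ∀ w : (L.carrier ⊗[k] X.carrier) ⊗[k] D,
      Coalgebra.counit (R := k) (TensorProduct.lid k D (a.e.rTensor D w))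
        = a.e (counitMap k D _ w) := by
    intro w
    induction w with
    | zero => simp
    | add a b ha hb => simp only [map_add, ha, hb]
    | tmul l x => simp [mul_comm]
  exact (h1 _).trans (congrArg a.e ((RightComod.tensor L.carrier).obj X.toRight |>.counitMap_coact z))

theorem rightColinear_counitRight (e : L.carrier ⊗[k] X.carrier →ₗ[k] k)
    (z : L.carrier ⊗[k] X.carrier) :
    Coalgebra.comul (R := k) (TensorProduct.lid k D (e.rTensor D (tensorRight L.carrier X.coactRight z)))
      = ((TensorProduct.lid k D).toLinearMap ∘ₗ e.rTensor D ∘ₗ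
        tensorRight L.carrier X.coactRight).rTensor D (tensorRight L.carrier X.coactRight z) := by
  have h := LinearMap.congr_fun (tensorRight_isRightCoaction (M := L.carrier) X.isRightCoaction).coassoc z
  simp only [LinearMap.comp_apply, LinearEquiv.coe_coe] at h
  rw [LinearMap.rTensor_comp, LinearMap.rTensor_comp, LinearMap.comp_apply, LinearMap.comp_apply]
  have h' := (LinearEquiv.eq_symm_apply _).2 h
  rw [h']
  generalize tensorRight L.carrier X.coactRight z = w
  induction w with
  | zero => simp
  | add a b ha hb => simp only [map_add, ha, hb]
  | tmul l d =>
    simp only [LinearMap.lTensor_tmul, LinearMap.rTensor_tmul, TensorProduct.lid_tmul, map_smul]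
    generalize Coalgebra.comul (R := k) d = v
    induction v with
    | zero => simp
    | add a b ha hb => simp only [TensorProduct.tmul_add, map_add, ← ha, ← hb, smul_add]
    | tmul l d => simp [TensorProduct.smul_tmul']

theorem leftColinear_counitLeft (e : L.carrier ⊗[k] X.carrier →ₗ[k] k)
    (z : L.carrier ⊗[k] X.carrier) :
    Coalgebra.comul (R := k) (TensorProduct.rid k D (e.lTensor D (tensorLeft X.carrier L.coactLeft z)))
      = ((TensorProduct.rid k D).toLinearMap ∘ₗ e.lTensor D ∘ₗ
        tensorLeft X.carrier L.coactLeft).lTensor D (tensorLeft X.carrier L.coactLeft z) := by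
  have h := LinearMap.congr_fun (tensorLeft_isLeftCoaction (N := X.carrier) L.isLeftCoaction).coassoc z
  simp only [LinearMap.comp_apply, LinearEquiv.coe_coe] at h
  rw [LinearMap.lTensor_comp, LinearMap.lTensor_comp, LinearMap.comp_apply, LinearMap.comp_apply, ← h]
  generalize tensorLeft X.carrier L.coactLeft z = w
  induction w with
  | zero => simp
  | add a b ha hb => simp only [map_add, ha, hb]
  | tmul d l =>
    simp only [LinearMap.lTensor_tmul, LinearMap.rTensor_tmul, TensorProduct.rid_tmul, map_smul]
    generalize Coalgebra.comul (R := k) d = v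
    induction v with
    | zero => simp
    | add a b ha hb => simp only [TensorProduct.add_tmul, map_add, ← ha, ← hb, smul_add]
    | tmul l d => simp

/-- The counit `L □_C X → D`, as a bicolinear map. -/
noncomputable def CoDual.counit (a : CoDual X L) : L.cotensor X ⟶ Bicomod.regular k D :=
  ⟨a.counitRight ∘ₗ (cotensor L.coactRight X.coactLeft).subtype, by
    have e : a.counitRight ∘ₗ (cotensor L.coactRight X.coactLeft).subtype
        = a.counitLeft ∘ₗ (cotensor L.coactRight X.coactLeft).subtype :=
      LinearMap.ext fun z => a.counitRight_eq_counitLeft z.1 z.2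
    change LinearMap.lTensor D (a.counitRight ∘ₗ (cotensor L.coactRight X.coactLeft).subtype) ∘ₗ
      cotensorLeftCoaction X.coactLeft L.commute = Coalgebra.comul ∘ₗ
        (a.counitRight ∘ₗ (cotensor L.coactRight X.coactLeft).subtype)
    rw [e, LinearMap.lTensor_comp, LinearMap.comp_assoc, cotensorLeftCoaction_spec]
    exact LinearMap.ext fun z => (leftColinear_counitLeft a.e z.1).symm, by
    change LinearMap.rTensor D (a.counitRight ∘ₗ (cotensor L.coactRight X.coactLeft).subtype) ∘ₗ
      cotensorRightCoaction L.coactRight X.commute = Coalgebra.comul ∘ₗ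
        (a.counitRight ∘ₗ (cotensor L.coactRight X.coactLeft).subtype)
    rw [LinearMap.rTensor_comp, LinearMap.comp_assoc, cotensorRightCoaction_spec]
    exact LinearMap.ext fun z => (rightColinear_counitRight a.e z.1).symm⟩

/-- A unit map, as a bicolinear map. -/
noncomputable def IsUnitMap.hom {η : C →ₗ[k] X.carrier ⊗[k] L.carrier} (h : IsUnitMap X L η) :
    Bicomod.regular k C ⟶ X.cotensor L :=
  ⟨η.codRestrict (cotensor X.coactRight L.coactLeft) h.mem, by
    change LinearMap.lTensor C (η.codRestrict (cotensor X.coactRight L.coactLeft) h.mem) ∘ₗ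
      Coalgebra.comul = cotensorLeftCoaction L.coactLeft X.commute ∘ₗ
        η.codRestrict (cotensor X.coactRight L.coactLeft) h.mem
    rw [← LinearMap.cancel_left (Module.Flat.lTensor_preserves_injective_linearMap (M := C) _
        (Submodule.injective_subtype (cotensor X.coactRight L.coactLeft))), ← LinearMap.comp_assoc,
      ← LinearMap.comp_assoc, cotensorLeftCoaction_spec, ← LinearMap.lTensor_comp,
      LinearMap.subtype_comp_codRestrict, LinearMap.comp_assoc, LinearMap.subtype_comp_codRestrict]
    exact LinearMap.ext fun c => (h.left c).symm,
    rightColinear_codRestrict _ _ L.commute _ _ fun c => (h.right c).symm⟩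

theorem IsUnitMap.of_hom (f : Bicomod.regular k C ⟶ X.cotensor L) :
    IsUnitMap X L (Bicomod.toTensor f) where
  mem c := (f.1 c).2
  left c := by
    have h1 := LinearMap.congr_fun (cotensorLeftCoaction_spec L.coactLeft X.commute) (f.1 c)
    have h2 := LinearMap.congr_fun f.2.1 c
    refine h1.symm.trans ?_
    refine (congrArg ((cotensor X.coactRight L.coactLeft).subtype.lTensor C) h2.symm).trans ?_
    exact (LinearMap.congr_fun (LinearMap.lTensor_comp C (cotensor X.coactRight L.coactLeft).subtype
      (f.1 : C →ₗ[k] cotensor X.coactRight L.coactLeft)) _).symm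
  right c := by
    have h1 := LinearMap.congr_fun (cotensorRightCoaction_spec X.coactRight L.commute) (f.1 c)
    have h2 := LinearMap.congr_fun f.2.2 c
    refine h1.symm.trans ?_
    refine (congrArg ((cotensor X.coactRight L.coactLeft).subtype.rTensor C) h2.symm).trans ?_
    exact (LinearMap.congr_fun (LinearMap.rTensor_comp C (cotensor X.coactRight L.coactLeft).subtype
      (f.1 : C →ₗ[k] cotensor X.coactRight L.coactLeft)) _).symm

end Counit

/-! ### From a duality to an adjunction of cotensor functors. -/

section Adjunction

variable {k : Type u} [Field k]
variable {C : Type u} [AddCommGroup C] [Module k C] [Coalgebra k C]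
variable {D : Type u} [AddCommGroup D] [Module k D] [Coalgebra k D]
variable {X : Bicomod k C D} {L : Bicomod k D C}

/-- The unit of the adjunction between `- □_C X` and `- □_D L`. -/
noncomputable def CoDual.unitNat (a : CoDual X L) :
    𝟭 (RightComod k C) ⟶ cotensorRightFunctor X ⋙ cotensorRightFunctor L :=
  (cotensorRegularIso k C).hom ≫ cotensorRightMap a.isUnitMap.hom ≫ (cotensorRightCompIso X L).hom

/-- The counit of the adjunction between `- □_C X` and `- □_D L`. -/
noncomputable def CoDual.counitNat (a : CoDual X L) :
    cotensorRightFunctor L ⋙ cotensorRightFunctor X ⟶ 𝟭 (RightComod k D) :=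
  (cotensorRightCompIso L X).inv ≫ cotensorRightMap a.counit ≫ (cotensorRegularIso k D).inv

/-- The associativity isomorphism is known only through its values in the full tensor product. There
the unit of the adjunction is `m ↦ m₀ ⊗ η(m₁)`, the form in which the triangle identities can be
computed. -/
theorem CoDual.unitNat_val (a : CoDual X L) (M : RightComod k C) (m : M.carrier) :
    (cotensor M.coact X.coactLeft).subtype.rTensor L.carrier ((a.unitNat.app M).1 m).1
      = (TensorProduct.assoc k M.carrier X.carrier L.carrier).symm
          (a.η.lTensor M.carrier (M.coact m)) := by
  refine (cotensorAssoc_spec M.coact X.commute L.coactLeft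
    (((cotensorRightMap a.isUnitMap.hom).app M).1 ((cotensorRegularHom M).1 m))).trans
    (congrArg (TensorProduct.assoc k M.carrier X.carrier L.carrier).symm ?_)
  exact (LinearMap.congr_fun (LinearMap.lTensor_comp M.carrier
    (cotensor X.coactRight L.coactLeft).subtype
    (a.η.codRestrict (cotensor X.coactRight L.coactLeft) a.isUnitMap.mem)) _).symm

theorem cotensorRegularIso_inv_apply (M : RightComod k C)
    (z : cotensor M.coact (Coalgebra.comul (R := k) (A := C))) :
    ((cotensorRegularIso k C).inv.app M).1 z = counitMap k C M.carrier z.1 := by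
  apply (cotensorRegularHom_bijective M).1
  have := LinearMap.congr_fun (congrArg Subtype.val ((cotensorRegularIso k C).inv_hom_id_app M)) z
  exact this.trans (Subtype.ext (coact_counitMap M z).symm)

theorem cotensorRightCompIso_inv_val {E : Type u} [AddCommGroup E] [Module k E] [Coalgebra k E]
    (X : Bicomod k C D) (Y : Bicomod k D E) (M : RightComod k C)
    (y : cotensor (M.cotensor X).coact Y.coactLeft) :
    (cotensor X.coactRight Y.coactLeft).subtype.lTensor M.carrier
      (((cotensorRightCompIso X Y).inv.app M).1 y).1
      = TensorProduct.assoc k M.carrier X.carrier Y.carrier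
          ((cotensor M.coact X.coactLeft).subtype.rTensor Y.carrier y.1) := by
  have h := LinearMap.congr_fun (congrArg Subtype.val
    ((cotensorRightCompIso X Y).inv_hom_id_app M)) y
  have h2 := cotensorAssoc_spec M.coact X.commute Y.coactLeft
    (((cotensorRightCompIso X Y).inv.app M).1 y)
  refine (LinearEquiv.symm_apply_eq _).1 (h2.symm.trans ?_)
  exact congrArg (fun v => (cotensor M.coact X.coactLeft).subtype.rTensor Y.carrier (Subtype.val v)) h

/-- The counit of `D` turns `a.counitRight` into `a.e`, so inside `(N ⊗ L) ⊗ X` the counit of the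
adjunction is contraction with `e`. -/
theorem CoDual.counitNat_apply (a : CoDual X L) (N : RightComod k D)
    (y : cotensor (N.cotensor L).coact X.coactLeft) :
    (a.counitNat.app N).1 y = contractRight N.carrier a.e
      ((cotensor N.coact L.coactLeft).subtype.rTensor X.carrier y.1) := by
  refine (cotensorRegularIso_inv_apply N _).trans ?_
  have h := cotensorRightCompIso_inv_val L X N y
  rw [contractRight, LinearMap.comp_apply, LinearMap.comp_apply, LinearEquiv.coe_coe,
    LinearEquiv.coe_coe, ← h]
  have key : ∀ v : N.carrier ⊗[k] cotensor L.coactRight X.coactLeft,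
      counitMap k D N.carrier ((a.counitRight ∘ₗ
        (cotensor L.coactRight X.coactLeft).subtype).lTensor N.carrier v)
      = TensorProduct.rid k N.carrier (a.e.lTensor N.carrier
          ((cotensor L.coactRight X.coactLeft).subtype.lTensor N.carrier v)) := by
    intro v
    induction v with
    | zero => simp
    | add a b ha hb => simp only [map_add, ha, hb]
    | tmul n z => simp [a.counit_counitRight]
  exact key _

theorem contractRight_assoc_symm {M X L C : Type u} [AddCommGroup M] [Module k M] [AddCommGroup X]
    [Module k X] [AddCommGroup L] [Module k L] [AddCommGroup C] [Module k C]
    (e : L ⊗[k] X →ₗ[k] k) (η : C →ₗ[k] X ⊗[k] L) (v : (M ⊗[k] C) ⊗[k] X) :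
    contractRight (M ⊗[k] X) e (((TensorProduct.assoc k M X L).symm.toLinearMap ∘ₗ
      η.lTensor M).rTensor X v)
      = (contractRight X e ∘ₗ η.rTensor X).lTensor M (TensorProduct.assoc k M C X v) := by
  have : contractRight (M ⊗[k] X) e ∘ₗ ((TensorProduct.assoc k M X L).symm.toLinearMap ∘ₗ
      η.lTensor M).rTensor X
      = (contractRight X e ∘ₗ η.rTensor X).lTensor M ∘ₗ (TensorProduct.assoc k M C X).toLinearMap := by
    apply TensorProduct.ext_threefold
    intro m c x
    simp only [LinearMap.comp_apply, LinearMap.rTensor_tmul, LinearMap.lTensor_tmul,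
      LinearEquiv.coe_coe, TensorProduct.assoc_tmul]
    generalize η c = y
    induction y with
    | zero => simp
    | add a b ha hb => simp only [TensorProduct.tmul_add, TensorProduct.add_tmul, map_add, ha, hb]
    | tmul x' l => simp
  exact LinearMap.congr_fun this v

theorem rTensor_comp_comp {A B E F Z : Type u} [AddCommGroup A] [Module k A] [AddCommGroup B]
    [Module k B] [AddCommGroup E] [Module k E] [AddCommGroup F] [Module k F] [AddCommGroup Z]
    [Module k Z] (f : A →ₗ[k] B) (q : B →ₗ[k] E) (p : E →ₗ[k] F) (g : A →ₗ[k] F)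
    (h : ∀ a, p (q (f a)) = g a) (z : A ⊗[k] Z) :
    p.rTensor Z (q.rTensor Z (f.rTensor Z z)) = g.rTensor Z z := by
  rw [← LinearMap.rTensor_comp_apply, ← LinearMap.rTensor_comp_apply]
  exact congrArg (fun g => LinearMap.rTensor Z g z) (LinearMap.ext h)

/-- A duality of bicomodules gives an adjunction between the cotensor functors. -/
noncomputable def CoDual.adjunction (a : CoDual X L) :
    cotensorRightFunctor X ⊣ cotensorRightFunctor L where
  unit := a.unitNat
  counit := a.counitNat
  left_triangle_components M := by
    refine RightComod.hom_ext fun z => Subtype.ext ?_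
    have h1 := a.counitNat_apply (M.cotensor X)
      (((cotensorRightFunctor X).map (a.unitNat.app M)).1 z)
    refine (congrArg Subtype.val h1).trans ?_
    -- Only the value of the unit matters. Contracting `m₀ ⊗ η(m₁) ⊗ x` after trading `m₀ ⊗ m₁ ⊗ x`
    -- for `m ⊗ x₋₁ ⊗ x₀` on `M □_C X` leaves the second triangle identity.
    have h2 : ∀ (f : M.carrier →ₗ[k] cotensor (M.cotensor X).coact L.coactLeft),
        (∀ m, (cotensor M.coact X.coactLeft).subtype.rTensor L.carrier (f m).1
          = (TensorProduct.assoc k M.carrier X.carrier L.carrier).symm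
          (a.η.lTensor M.carrier (M.coact m))) → ∀ z : cotensor M.coact X.coactLeft,
        (contractRight (cotensor M.coact X.coactLeft) a.e
          ((cotensor (M.cotensor X).coact L.coactLeft).subtype.rTensor X.carrier
            (f.rTensor X.carrier z.1))).1 = z.1 := by
      intro f hf z
      have h4 : contractRight X.carrier a.e ∘ₗ a.η.rTensor X.carrier ∘ₗ X.coactLeft = LinearMap.id :=
        LinearMap.ext a.triangle_right
      refine (contractRight_rTensor a.e (cotensor M.coact X.coactLeft).subtype _).symm.trans ?_
      refine (congrArg (contractRight (M.carrier ⊗[k] X.carrier) a.e)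
        (rTensor_comp_comp f (cotensor (M.cotensor X).coact L.coactLeft).subtype
          ((cotensor M.coact X.coactLeft).subtype.rTensor L.carrier)
          (((TensorProduct.assoc k M.carrier X.carrier L.carrier).symm.toLinearMap ∘ₗ
          a.η.lTensor M.carrier) ∘ₗ M.coact) hf z.1)).trans ?_
      rw [LinearMap.rTensor_comp]
      rw [LinearMap.comp_apply, contractRight_assoc_symm, mem_cotensor.1 z.2, ← LinearMap.comp_apply,
        ← LinearMap.lTensor_comp, LinearMap.comp_assoc, h4, LinearMap.lTensor_id, LinearMap.id_apply]
    exact h2 (a.unitNat.app M).1 (a.unitNat_val M) z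
  right_triangle_components N := by
    refine RightComod.hom_ext fun z => Subtype.ext ?_
    have h1 := a.counitNat_apply N
    have h2 := a.unitNat_val ((cotensorRightFunctor L).obj N) z
    have h3 : ∀ (g : cotensor (N.cotensor L).coact X.coactLeft →ₗ[k] N.carrier),
        (∀ y, g y = contractRight N.carrier a.e
          ((cotensor N.coact L.coactLeft).subtype.rTensor X.carrier y.1)) →
        ∀ v : cotensor (N.cotensor L).coact X.coactLeft ⊗[k] L.carrier, g.rTensor L.carrier v
          = (contractRight N.carrier a.e).rTensor L.carrier
              (((cotensor N.coact L.coactLeft).subtype.rTensor X.carrier).rTensor L.carrier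
                ((cotensor (N.cotensor L).coact X.coactLeft).subtype.rTensor L.carrier v)) := by
      intro g hg v
      exact (rTensor_comp_comp (cotensor (N.cotensor L).coact X.coactLeft).subtype
        ((cotensor N.coact L.coactLeft).subtype.rTensor X.carrier) (contractRight N.carrier a.e) g
        (fun y => (hg y).symm) v).symm
    refine (h3 (a.counitNat.app N).1 h1 _).trans ?_
    refine (congrArg (fun w => (contractRight N.carrier a.e).rTensor L.carrier
      (((cotensor N.coact L.coactLeft).subtype.rTensor X.carrier).rTensor L.carrier w)) h2).trans ?_
    have h4 : ∀ v : cotensor N.coact L.coactLeft ⊗[k] C,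
        ((cotensor N.coact L.coactLeft).subtype.rTensor X.carrier).rTensor L.carrier
          ((TensorProduct.assoc k (cotensor N.coact L.coactLeft) X.carrier L.carrier).symm
            (a.η.lTensor (cotensor N.coact L.coactLeft) v))
        = (TensorProduct.assoc k (N.carrier ⊗[k] L.carrier) X.carrier L.carrier).symm
            (a.η.lTensor (N.carrier ⊗[k] L.carrier)
              ((cotensor N.coact L.coactLeft).subtype.rTensor C v)) := by
      intro v
      rw [LinearEquiv.eq_symm_apply, assoc_rTensor_rTensor, LinearEquiv.apply_symm_apply,
        lTensor_rTensor_comm]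
    refine (congrArg ((contractRight N.carrier a.e).rTensor L.carrier) (h4 _)).trans ?_
    -- The coaction of `N □_D L` is that of `L`, so what remains is the first triangle identity
    -- tensored with `N`.
    have h5 := RightComod.cotensor_coact_val L N z
    have h6 : (contractLeft L.carrier a.e ∘ₗ a.η.lTensor L.carrier) ∘ₗ L.coactRight = LinearMap.id :=
      LinearMap.ext a.triangle_left
    refine (congrArg (fun w => (contractRight N.carrier a.e).rTensor L.carrier
      ((TensorProduct.assoc k (N.carrier ⊗[k] L.carrier) X.carrier L.carrier).symm
            (a.η.lTensor (N.carrier ⊗[k] L.carrier) w))) h5).trans ?_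
    refine (contractRight_lTensor_assoc_symm a.e a.η _).trans ?_
    exact (LinearMap.congr_fun (LinearMap.lTensor_comp N.carrier
      (contractLeft L.carrier a.e ∘ₗ a.η.lTensor L.carrier) L.coactRight) z.1).symm.trans (by
        rw [h6, LinearMap.lTensor_id]; rfl)

end Adjunction

/-! ### Linear functors and tensoring with vector spaces. -/

section LinearFunctors

variable {k : Type u} [Field k]
variable {C : Type u} [AddCommGroup C] [Module k C] [Coalgebra k C]
variable {D : Type u} [AddCommGroup D] [Module k D] [Coalgebra k D]
variable {W W' : Type u} [AddCommGroup W] [Module k W] [AddCommGroup W'] [Module k W']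

/-- The colinear map `n ↦ w ⊗ n`. -/
noncomputable def RightComod.ins (N : RightComod k C) (w : W) : N ⟶ (RightComod.tensor W).obj N :=
  ⟨TensorProduct.mk k W N.carrier w, by
    refine LinearMap.ext fun n => ?_
    change (TensorProduct.mk k W N.carrier w).rTensor C (N.coact n)
      = (TensorProduct.assoc k W N.carrier C).symm (w ⊗ₜ N.coact n)
    generalize N.coact n = y
    induction y with
    | zero => simp
    | add a b ha hb => simp only [TensorProduct.tmul_add, map_add, ha, hb]
    | tmul a b => simp⟩

theorem RightComod.ins_add (N : RightComod k C) (w w' : W) : N.ins (w + w') = N.ins w + N.ins w' :=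
  RightComod.hom_ext fun n => TensorProduct.add_tmul w w' n

theorem RightComod.ins_smul (N : RightComod k C) (a : k) (w : W) : N.ins (a • w) = a • N.ins w :=
  RightComod.hom_ext fun _ => rfl

/-- The insertions `n ↦ w ⊗ n` jointly cover `W ⊗ N`. Identities about `tensorComparison` are
thereby reduced to functoriality. -/
theorem RightComod.tensor_hom_ext {N P : RightComod k C} {f g : (RightComod.tensor W).obj N ⟶ P}
    (h : ∀ w, N.ins w ≫ f = N.ins w ≫ g) : f = g :=
  Subtype.ext (TensorProduct.ext' fun w n => LinearMap.congr_fun (congrArg Subtype.val (h w)) n)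

theorem RightComod.ins_map {N N' : RightComod k C} (f : N ⟶ N') (w : W) :
    N.ins w ≫ (RightComod.tensor W).map f = f ≫ N'.ins w := rfl

theorem RightComod.ins_tensorMap (N : RightComod k C) (f : W →ₗ[k] W') (w : W) :
    N.ins w ≫ RightComod.tensorMap f N = N.ins (f w) := rfl

theorem RightComod.ins_tmul_tensorAssoc (N : RightComod k C) (w : W) (w' : W') :
    N.ins (w ⊗ₜ[k] w') ≫ RightComod.tensorAssoc W W' N
      = N.ins w' ≫ ((RightComod.tensor W').obj N).ins w :=
  RightComod.hom_ext fun n => TensorProduct.assoc_tmul w w' n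

theorem RightComod.tensor_tensor_hom_ext {N P : RightComod k C}
    {f g : (RightComod.tensor (W ⊗[k] W')).obj N ⟶ P}
    (h : ∀ w w', N.ins (w ⊗ₜ[k] w') ≫ f = N.ins (w ⊗ₜ[k] w') ≫ g) : f = g :=
  Subtype.ext (TensorProduct.ext_threefold fun w w' n =>
    LinearMap.congr_fun (congrArg Subtype.val (h w w')) n)

variable (F : RightComod k C ⥤ RightComod k D) [F.Additive] [F.Linear k]

variable (W) in
/-- The canonical map `W ⊗ F(N) → F(W ⊗ N)` for a linear functor `F`. -/
noncomputable def tensorComparison (N : RightComod k C) :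
    (RightComod.tensor W).obj (F.obj N) ⟶ F.obj ((RightComod.tensor W).obj N) :=
  ⟨TensorProduct.lift
    { toFun := fun w => (F.map (N.ins w)).1
      map_add' := fun w w' => by rw [RightComod.ins_add, F.map_add]; rfl
      map_smul' := fun a w => by rw [RightComod.ins_smul, F.map_smul]; rfl }, by
    refine TensorProduct.ext' fun w n => ?_
    have e := RightComod.hom_coact (F.map (N.ins w)) n
    refine Eq.trans ?_ ((congrArg _ (TensorProduct.lift.tmul w n)).trans e).symm
    change LinearMap.rTensor D _ ((TensorProduct.assoc k W (F.obj N).carrier D).symm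
      (w ⊗ₜ (F.obj N).coact n)) = _
    generalize (F.obj N).coact n = y
    induction y with
    | zero => simp
    | add a b ha hb => simp only [TensorProduct.tmul_add, map_add, ha, hb]
    | tmul a b =>
      simp only [TensorProduct.assoc_symm_tmul, LinearMap.rTensor_tmul]
      rfl⟩

theorem ins_tensorComparison (N : RightComod k C) (w : W) :
    (F.obj N).ins w ≫ tensorComparison W F N = F.map (N.ins w) := rfl

theorem ins_tensorComparison_assoc (N : RightComod k C) (w : W) {Z : RightComod k D}
    (h : F.obj ((RightComod.tensor W).obj N) ⟶ Z) :
    (F.obj N).ins w ≫ tensorComparison W F N ≫ h = F.map (N.ins w) ≫ h := by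
  rw [← ins_tensorComparison, Category.assoc]

theorem tensorComparison_natural {N N' : RightComod k C} (f : N ⟶ N') :
    tensorComparison W F N ≫ F.map ((RightComod.tensor W).map f)
      = (RightComod.tensor W).map (F.map f) ≫ tensorComparison W F N' := by
  refine RightComod.tensor_hom_ext fun w => ?_
  rw [ins_tensorComparison_assoc, ← F.map_comp, RightComod.ins_map, F.map_comp,
    ← ins_tensorComparison F N', ← Category.assoc, ← Category.assoc, ← RightComod.ins_map (F.map f)]

theorem tensorComparison_natural_left (N : RightComod k C) (f : W →ₗ[k] W') :
    tensorComparison W F N ≫ F.map (RightComod.tensorMap f N)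
      = RightComod.tensorMap f (F.obj N) ≫ tensorComparison W' F N := by
  refine RightComod.tensor_hom_ext fun w => ?_
  rw [ins_tensorComparison_assoc, ← F.map_comp, RightComod.ins_tensorMap, ← Category.assoc,
    RightComod.ins_tensorMap, ins_tensorComparison]

theorem tensorComparison_natural_left_assoc (N : RightComod k C) (f : W →ₗ[k] W')
    {Z : RightComod k D} (h : F.obj ((RightComod.tensor W').obj N) ⟶ Z) :
    tensorComparison W F N ≫ F.map (RightComod.tensorMap f N) ≫ h
      = RightComod.tensorMap f (F.obj N) ≫ tensorComparison W' F N ≫ h := by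
  rw [← Category.assoc, tensorComparison_natural_left, Category.assoc]

theorem tensorComparison_unit (N : RightComod k C) :
    RightComod.tensorUnit (F.obj N) ≫ tensorComparison k F N = F.map (RightComod.tensorUnit N) :=
  ins_tensorComparison F N (1 : k)

theorem tensorComparison_assoc (N : RightComod k C) :
    tensorComparison (W ⊗[k] W') F N ≫ F.map (RightComod.tensorAssoc W W' N)
      = RightComod.tensorAssoc W W' (F.obj N) ≫
        (RightComod.tensor W).map (tensorComparison W' F N) ≫
        tensorComparison W F ((RightComod.tensor W').obj N) := by
  refine RightComod.tensor_tensor_hom_ext fun w w' => ?_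
  rw [ins_tensorComparison_assoc, ← F.map_comp, RightComod.ins_tmul_tensorAssoc, ← Category.assoc,
    RightComod.ins_tmul_tensorAssoc, F.map_comp, Category.assoc,
    ← Category.assoc _ ((RightComod.tensor W).map _), RightComod.ins_map, Category.assoc,
    ins_tensorComparison, ins_tensorComparison_assoc]

variable {F}

theorem tensorComparison_app {F' : RightComod k C ⥤ RightComod k D} [F'.Additive] [F'.Linear k]
    (T : F ⟶ F') (N : RightComod k C) :
    tensorComparison W F N ≫ T.app ((RightComod.tensor W).obj N)
      = (RightComod.tensor W).map (T.app N) ≫ tensorComparison W F' N := by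
  refine RightComod.tensor_hom_ext fun w => ?_
  rw [ins_tensorComparison_assoc, T.naturality, ← Category.assoc, RightComod.ins_map, Category.assoc,
    ins_tensorComparison]

theorem tensorComparison_cotensorRightFunctor (Y : Bicomod k C D) (N : RightComod k C) :
    tensorComparison W (cotensorRightFunctor Y) N = tensorCotensor W Y N := by
  refine RightComod.tensor_hom_ext fun w => ?_
  rw [ins_tensorComparison]
  refine RightComod.hom_ext fun z => Subtype.ext ?_
  change (TensorProduct.mk k W N.carrier w).rTensor Y.carrier z.1
    = (TensorProduct.assoc k W N.carrier Y.carrier).symm (w ⊗ₜ z.1)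
  generalize z.1 = y
  induction y with
  | zero => simp
  | add a b ha hb => simp only [TensorProduct.tmul_add, map_add, ha, hb]
  | tmul a b => simp

/-- A linear functor with a linear right adjoint commutes with tensoring by a vector space. -/
theorem isIso_tensorComparison {G : RightComod k D ⥤ RightComod k C} [G.Additive] [G.Linear k]
    (adj : F ⊣ G) (N : RightComod k C) : IsIso (tensorComparison W F N) := by
  -- The inverse is the transpose of `W ⊗ N → W ⊗ GF(N) → G(W ⊗ F(N))`; the second arrow is the
  -- comparison map of `G`, which is where linearity of `G` enters.
  refine ⟨(adj.homEquiv _ _).symm ((RightComod.tensor W).map (adj.unit.app N) ≫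
    tensorComparison W G (F.obj N)), ?_, ?_⟩
  · refine RightComod.tensor_hom_ext fun w => ?_
    have h : ((F ⋙ G).obj N).ins w ≫ tensorComparison W G (F.obj N) = G.map ((F.obj N).ins w) :=
      ins_tensorComparison G (F.obj N) w
    rw [ins_tensorComparison_assoc, ← Adjunction.homEquiv_naturality_left_symm, ← Category.assoc,
      RightComod.ins_map, Category.assoc, h, ← adj.homEquiv_unit,
      Equiv.symm_apply_apply, Category.comp_id]
  · apply (adj.homEquiv _ _).injective
    rw [Adjunction.homEquiv_naturality_right, Equiv.apply_symm_apply]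
    refine RightComod.tensor_hom_ext fun w => ?_
    have h : ((F ⋙ G).obj N).ins w ≫ tensorComparison W G (F.obj N) ≫ G.map (tensorComparison W F N)
        = G.map (F.map (N.ins w)) := by
      rw [← ins_tensorComparison, G.map_comp]
      exact ins_tensorComparison_assoc G (F.obj N) w _
    rw [Category.assoc, ← Category.assoc, RightComod.ins_map, Category.assoc, h,
      adj.homEquiv_unit, G.map_id]
    exact (adj.unit.naturality (N.ins w)).symm

end LinearFunctors

/-! ### A bicomodule is determined by its cotensor functor. -/

section NaturalTransformations

variable {k : Type u} [Field k]
variable {C : Type u} [AddCommGroup C] [Module k C] [Coalgebra k C]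
variable {D : Type u} [AddCommGroup D] [Module k D] [Coalgebra k D]

/-- Under `Y ≅ C □_C Y` and `C ⊗ Y ≅ (C ⊗ C) □_C Y`, the functor sends the comultiplication to the
left coaction of `Y`; so the left coaction can be read off the functor. -/
theorem cotensorRightFunctor_map_comulHom (Y : Bicomod k C D) (y : Y.carrier) :
    ((cotensorRightFunctor Y).map (RightComod.comulHom (k := k) (C := C))).1
        ((regularCotensorHom Y).1 y)
      = (tensorCotensor C Y (Bicomod.regular k C).toRight).1
        (LinearMap.lTensor C (regularCotensorHom Y).1 (Y.coactLeft y)) := by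
  refine Subtype.ext ?_
  change (Coalgebra.comul (R := k) (A := C)).rTensor Y.carrier (Y.coactLeft y)
    = (TensorProduct.assoc k C C Y.carrier).symm
      ((FrobeniusComod.cotensor (Coalgebra.comul (R := k) (A := C)) Y.coactLeft).subtype.lTensor C
        ((regularCotensorHom Y).1.lTensor C (Y.coactLeft y)))
  rw [LinearEquiv.eq_symm_apply]
  refine (LinearMap.congr_fun Y.isLeftCoaction.coassoc y).trans ?_
  have h : ∀ (S : Submodule k (C ⊗[k] Y.carrier)) (f : Y.carrier →ₗ[k] S),
      LinearMap.lTensor C (S.subtype ∘ₗ f) (Y.coactLeft y)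
        = S.subtype.lTensor C (f.lTensor C (Y.coactLeft y)) := fun S f =>
    LinearMap.lTensor_comp_apply ..
  exact h (FrobeniusComod.cotensor (Coalgebra.comul (R := k) (A := C)) Y.coactLeft)
    (regularCotensorHom Y).1

/-- Bicomodules with isomorphic cotensor functors are isomorphic. -/
theorem nonempty_iso_of_cotensorRightFunctor_iso {X Y : Bicomod k C D}
    (T : cotensorRightFunctor X ≅ cotensorRightFunctor Y) : Nonempty (X ≅ Y) := by
  let φ : X.toRight ≅ Y.toRight := regularCotensorIso X ≪≫
    T.app (Bicomod.regular k C).toRight ≪≫ (regularCotensorIso Y).symm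
  have hφ : φ.hom ≫ regularCotensorHom Y = regularCotensorHom X ≫
      T.hom.app (Bicomod.regular k C).toRight := by
    have := (regularCotensorIso Y).inv_hom_id
    simp only [regularCotensorIso, RightComod.isoOfBijective_hom] at this
    simp [φ, regularCotensorIso, this]
  -- Both left coactions are images of the comultiplication, and `T` commutes with the comparison
  -- maps; naturality of `T` at the comultiplication is therefore left colinearity of `φ`.
  have hleft : ∀ x, LinearMap.lTensor C φ.hom.1 (X.coactLeft x) = Y.coactLeft (φ.hom.1 x) := by
    intro x
    have h1 : tensorCotensor C X (Bicomod.regular k C).toRight ≫ T.hom.app _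
        = (RightComod.tensor C).map (T.hom.app _) ≫ tensorCotensor C Y _ := by
      rw [← tensorComparison_cotensorRightFunctor, tensorComparison_app,
        tensorComparison_cotensorRightFunctor]
    have h2 := T.hom.naturality (RightComod.comulHom (k := k) (C := C))
    have h3 : (RightComod.tensor C).map (regularCotensorHom X) ≫
          (RightComod.tensor C).map (T.hom.app _)
        = (RightComod.tensor C).map φ.hom ≫ (RightComod.tensor C).map (regularCotensorHom Y) := by
      rw [← Functor.map_comp, ← Functor.map_comp, hφ]
    apply Module.Flat.lTensor_preserves_injective_linearMap (M := C) _
      (regularCotensorHom_bijective Y).1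
    apply (tensorCotensor_bijective C Y (Bicomod.regular k C).toRight).1
    refine Eq.trans ?_ (cotensorRightFunctor_map_comulHom Y (φ.hom.1 x))
    refine Eq.trans ?_ (congrArg ((cotensorRightFunctor Y).map RightComod.comulHom).1
      (LinearMap.congr_fun (congrArg Subtype.val hφ) x)).symm
    refine Eq.trans ?_ (LinearMap.congr_fun (congrArg Subtype.val h2) _)
    refine Eq.trans ?_ (congrArg (T.hom.app _).1 (cotensorRightFunctor_map_comulHom X x)).symm
    refine Eq.trans ?_ (LinearMap.congr_fun (congrArg Subtype.val h1) _).symm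
    exact congrArg (tensorCotensor C Y (Bicomod.regular k C).toRight).1
      (LinearMap.congr_fun (congrArg Subtype.val h3) _).symm
  exact ⟨Bicomod.isoOfBijective ⟨φ.hom.1, LinearMap.ext hleft, φ.hom.2⟩ (RightComod.bijective_of_iso φ)⟩

end NaturalTransformations

/-! ### The Eilenberg–Watts theorem for comodules. -/

section EilenbergWatts

variable {k : Type u} [Field k]
variable {C : Type u} [AddCommGroup C] [Module k C] [Coalgebra k C]
variable {D : Type u} [AddCommGroup D] [Module k D] [Coalgebra k D]
variable (F : RightComod k C ⥤ RightComod k D) [F.Additive] [F.Linear k]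
variable [hF : ∀ (W : Type u) [AddCommGroup W] [Module k W] (N : RightComod k C),
  IsIso (tensorComparison W F N)]

/-- The left coaction `F(C) → F(C ⊗ C) ≅ C ⊗ F(C)`. -/
noncomputable def functorCoaction : F.obj (Bicomod.regular k C).toRight ⟶
    (RightComod.tensor C).obj (F.obj (Bicomod.regular k C).toRight) :=
  F.map RightComod.comulHom ≫ inv (tensorComparison C F _)

theorem functorCoaction_tensorComparison :
    functorCoaction F ≫ tensorComparison C F _ = F.map RightComod.comulHom := by
  simp [functorCoaction]

theorem functorCoaction_tensorComparison_assoc {Z : RightComod k D}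
    (h : F.obj ((RightComod.tensor C).obj (Bicomod.regular k C).toRight) ⟶ Z) :
    functorCoaction F ≫ tensorComparison C F _ ≫ h = F.map RightComod.comulHom ≫ h := by
  rw [← functorCoaction_tensorComparison, Category.assoc]

/-- This is the image under `F` of the counit law of `C`, transported along the comparison maps;
coassociativity is obtained in the same way. -/
theorem functorCoaction_counit :
    functorCoaction F ≫ RightComod.tensorMap Coalgebra.counit _ = RightComod.tensorUnit _ := by
  have h1 : (RightComod.comulHom (k := k) (C := C)) ≫
      RightComod.tensorMap Coalgebra.counit _ = RightComod.tensorUnit _ :=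
    Subtype.ext (Coalgebra.rTensor_counit_comp_comul (R := k) (A := C))
  rw [← cancel_mono (tensorComparison k F _), Category.assoc, ← tensorComparison_natural_left,
    functorCoaction_tensorComparison_assoc, tensorComparison_unit, ← F.map_comp, h1]

theorem functorCoaction_coassoc :
    functorCoaction F ≫ RightComod.tensorMap Coalgebra.comul _ ≫ RightComod.tensorAssoc C C _
      = functorCoaction F ≫ (RightComod.tensor C).map (functorCoaction F) := by
  have h1 : (RightComod.comulHom (k := k) (C := C)) ≫
      RightComod.tensorMap Coalgebra.comul _ ≫ RightComod.tensorAssoc C C _ =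
      RightComod.comulHom ≫ (RightComod.tensor C).map RightComod.comulHom :=
    Subtype.ext (Coalgebra.coassoc (R := k) (A := C))
  rw [← cancel_mono ((RightComod.tensor C).map (tensorComparison C F _) ≫ tensorComparison C F _)]
  simp only [Category.assoc]
  rw [← tensorComparison_assoc, ← tensorComparison_natural_left_assoc,
    functorCoaction_tensorComparison_assoc, ← Functor.map_comp_assoc (RightComod.tensor C),
    functorCoaction_tensorComparison, ← tensorComparison_natural,
    functorCoaction_tensorComparison_assoc, ← F.map_comp, ← F.map_comp, ← F.map_comp, h1]

/-- The bicomodule `F(C)`. -/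
noncomputable def functorBicomod : Bicomod k C D where
  carrier := (F.obj (Bicomod.regular k C).toRight).carrier
  coactLeft := (functorCoaction F).1
  coactRight := (F.obj (Bicomod.regular k C).toRight).coact
  isLeftCoaction := ⟨congrArg Subtype.val (functorCoaction_coassoc F),
    congrArg Subtype.val (functorCoaction_counit F)⟩
  isRightCoaction := (F.obj (Bicomod.regular k C).toRight).isCoaction
  commute := coactionsCommute_of_colinear (functorCoaction F).2

/-- The map `F(M) → F(M ⊗ C) ≅ M ⊗ F(C)`. -/
noncomputable def functorToTensor (M : RightComod k C) : F.obj M ⟶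
    (RightComod.tensor M.carrier).obj (F.obj (Bicomod.regular k C).toRight) :=
  F.map M.coactHom ≫ inv (tensorComparison M.carrier F _)

theorem functorToTensor_tensorComparison (M : RightComod k C) :
    functorToTensor F M ≫ tensorComparison M.carrier F _ = F.map M.coactHom := by
  simp [functorToTensor]

theorem functorToTensor_tensorComparison_assoc (M : RightComod k C) {Z : RightComod k D}
    (h : F.obj ((RightComod.tensor M.carrier).obj (Bicomod.regular k C).toRight) ⟶ Z) :
    functorToTensor F M ≫ tensorComparison M.carrier F _ ≫ h = F.map M.coactHom ≫ h := by
  rw [← functorToTensor_tensorComparison, Category.assoc]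

theorem functorToTensor_natural {M N : RightComod k C} (f : M ⟶ N) :
    F.map f ≫ functorToTensor F N = functorToTensor F M ≫ RightComod.tensorMap f.1 _ := by
  rw [← cancel_mono (tensorComparison N.carrier F _), Category.assoc,
    functorToTensor_tensorComparison, Category.assoc, ← tensorComparison_natural_left,
    functorToTensor_tensorComparison_assoc, ← F.map_comp, ← F.map_comp]
  congr 1
  refine RightComod.hom_ext fun m => ?_
  refine (N.coactHom_apply (f.1 m)).trans ((RightComod.hom_coact f m).trans ?_)
  exact congrArg (f.1.rTensor C) (M.coactHom_apply m).symm

theorem coactHom_coassoc (M : RightComod k C) :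
    M.coactHom ≫ RightComod.tensorMap M.coact _ ≫ RightComod.tensorAssoc M.carrier C _
      = M.coactHom ≫ (RightComod.tensor M.carrier).map RightComod.comulHom := by
  have h : M.coactHom.1 = M.coact := LinearMap.ext M.coactHom_apply
  refine Subtype.ext ?_
  refine Eq.trans ?_ (M.isCoaction.coassoc.trans ?_)
  · exact congrArg (fun g : M.carrier →ₗ[k] M.carrier ⊗[k] C =>
      (TensorProduct.assoc k M.carrier C C).toLinearMap ∘ₗ M.coact.rTensor C ∘ₗ g) h
  · exact congrArg (fun g : M.carrier →ₗ[k] M.carrier ⊗[k] C =>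
      (Coalgebra.comul (R := k) (A := C)).lTensor M.carrier ∘ₗ g) h.symm

/-- This is the image under `F` of coassociativity of `M`; it says that `F(M) → M ⊗ F(C)` lands in
`M □_C F(C)`. -/
theorem functorToTensor_equalizes (M : RightComod k C) :
    functorToTensor F M ≫ RightComod.tensorMap M.coact _ ≫ RightComod.tensorAssoc M.carrier C _
      = functorToTensor F M ≫ (RightComod.tensor M.carrier).map (functorCoaction F) := by
  rw [← cancel_mono ((RightComod.tensor M.carrier).map (tensorComparison C F _) ≫
    tensorComparison M.carrier F _)]
  simp only [Category.assoc]
  rw [← tensorComparison_assoc, ← tensorComparison_natural_left_assoc,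
    functorToTensor_tensorComparison_assoc, ← Functor.map_comp_assoc (RightComod.tensor M.carrier),
    functorCoaction_tensorComparison, ← tensorComparison_natural,
    functorToTensor_tensorComparison_assoc, ← F.map_comp, ← F.map_comp, ← F.map_comp,
    coactHom_coassoc]

/-- The comparison `F(M) → M □_C F(C)`. -/
noncomputable def functorToCotensor (M : RightComod k C) :
    F.obj M ⟶ (cotensorRightFunctor (functorBicomod F)).obj M :=
  ⟨(functorToTensor F M).1.codRestrict (cotensor M.coact (functorBicomod F).coactLeft)
    fun y => LinearMap.congr_fun (congrArg Subtype.val (functorToTensor_equalizes F M)) y,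
    rightColinear_codRestrict _ _ (functorBicomod F).commute _ _ fun y =>
      (RightComod.hom_coact (functorToTensor F M) y).symm⟩

/-- The inclusion `M □_C X → M ⊗ X`. -/
noncomputable def cotensorInclusion (X : Bicomod k C D) (M : RightComod k C) :
    (cotensorRightFunctor X).obj M ⟶ (RightComod.tensor M.carrier).obj X.toRight :=
  ⟨(cotensor M.coact X.coactLeft).subtype, cotensorRightCoaction_spec M.coact X.commute⟩

/-- `M` is the equalizer of the two maps `M ⊗ C ⇉ M ⊗ C ⊗ C`. Having a left adjoint, `F` preserves
it, and the comparison maps identify its image with the equalizer defining `M □_C F(C)`.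
Preservation is carried out by hand, by transposing along `adj`. -/
theorem functorToCotensor_bijective {H : RightComod k D ⥤ RightComod k C} (adj : H ⊣ F)
    (M : RightComod k C) : Function.Bijective (functorToCotensor F M).1 := by
  have : F.PreservesMonomorphisms := F.preservesMonomorphisms_of_adjunction adj
  constructor
  · intro x y hxy
    have hm : Mono (functorToTensor F M) := by
      have : Mono (F.map M.coactHom) := inferInstance
      unfold functorToTensor
      infer_instance
    exact RightComod.injective_of_mono (functorToTensor F M) (congrArg Subtype.val hxy)
  · let j : (cotensorRightFunctor (functorBicomod F)).obj M ⟶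
        (RightComod.tensor M.carrier).obj (F.obj (Bicomod.regular k C).toRight) :=
      cotensorInclusion (functorBicomod F) M
    have hj : j ≫ RightComod.tensorMap M.coact _ ≫ RightComod.tensorAssoc M.carrier C _
      = j ≫ (RightComod.tensor M.carrier).map (functorCoaction F) :=
      RightComod.hom_ext fun z => z.2
    -- The transpose of `M □_C F(C) → M ⊗ F(C) ≅ F(M ⊗ C)`.
    let g := (adj.homEquiv _ _).symm (j ≫ tensorComparison M.carrier F _)
    have hg : g ≫ RightComod.tensorMap M.coact _ ≫ RightComod.tensorAssoc M.carrier C _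
        = g ≫ (RightComod.tensor M.carrier).map RightComod.comulHom := by
      apply (adj.homEquiv _ _).injective
      rw [adj.homEquiv_naturality_right, adj.homEquiv_naturality_right, Equiv.apply_symm_apply,
        F.map_comp, Category.assoc, Category.assoc, tensorComparison_natural_left_assoc,
        tensorComparison_assoc, tensorComparison_natural, ← functorCoaction_tensorComparison,
        Functor.map_comp, reassoc_of% hj, Category.assoc]
    -- Since `g` equalizes the two maps, it factors through `M □_C C ≅ M`; transposing back the
    -- factor `h` gives a preimage of every element of `M □_C F(C)`.
    let g' : H.obj ((cotensorRightFunctor (functorBicomod F)).obj M) ⟶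
        (cotensorRightFunctor (Bicomod.regular k C)).obj M :=
      ⟨g.1.codRestrict (cotensor M.coact (Coalgebra.comul (R := k) (A := C)))
        fun y => LinearMap.congr_fun (congrArg Subtype.val hg) y,
        rightColinear_codRestrict _ _ (Bicomod.regular k C).commute _ _ fun y =>
          (RightComod.hom_coact g y).symm⟩
    let h := g' ≫ (cotensorRegularIso k C).inv.app M
    have hh : h ≫ M.coactHom = g := by
      refine RightComod.hom_ext fun y => ?_
      refine (M.coactHom_apply _).trans ?_
      refine (congrArg M.coact (cotensorRegularIso_inv_apply M (g'.1 y))).trans ?_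
      exact coact_counitMap M (g'.1 y)
    have hfin : (adj.homEquiv _ _) h ≫ functorToTensor F M = j := by
      rw [← cancel_mono (tensorComparison M.carrier F _), Category.assoc,
        functorToTensor_tensorComparison, ← adj.homEquiv_naturality_right, hh,
        Equiv.apply_symm_apply]
    intro z
    exact ⟨((adj.homEquiv _ _) h).1 z, Subtype.ext
      (LinearMap.congr_fun (congrArg Subtype.val hfin) z)⟩

end EilenbergWatts

/-- A linear functor between categories of comodules that has a left adjoint and a linear right
adjoint is a cotensor functor. -/
theorem exists_cotensorRightFunctor_iso {k : Type u} [Field k]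
    {C : Type u} [AddCommGroup C] [Module k C] [Coalgebra k C]
    {D : Type u} [AddCommGroup D] [Module k D] [Coalgebra k D]
    {F : RightComod k C ⥤ RightComod k D} [F.Additive] [F.Linear k]
    {G H : RightComod k D ⥤ RightComod k C} [G.Additive] [G.Linear k] (adj : F ⊣ G) (adj' : H ⊣ F) :
    ∃ X : Bicomod k C D, Nonempty (F ≅ cotensorRightFunctor X) := by
  have hF : ∀ (W : Type u) [AddCommGroup W] [Module k W] (N : RightComod k C),
    IsIso (tensorComparison W F N) := fun W _ _ N => isIso_tensorComparison adj N
  refine ⟨functorBicomod F, ⟨NatIso.ofComponents (fun M => RightComod.isoOfBijective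
    (functorToCotensor F M) (functorToCotensor_bijective F adj' M)) fun {M N} f => ?_⟩⟩
  exact RightComod.hom_ext fun y => Subtype.ext
    (LinearMap.congr_fun (congrArg Subtype.val (functorToTensor_natural F f)) y)

/-! ### The universal property of the co-hom bicomodule. -/

section CoHom

variable {k : Type u} [Field k]
variable {C : Type u} [AddCommGroup C] [Module k C] [Coalgebra k C]
variable {D : Type u} [AddCommGroup D] [Module k D] [Coalgebra k D]

/-- The unit of the adjunction at `C`, as a linear map `C → F(C) ⊗ L`. -/
noncomputable def coHomUnitTensor (L : Bicomod k D C) {F : RightComod k C ⥤ RightComod k D}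
    (adj : F ⊣ cotensorRightFunctor L) :
    C →ₗ[k] (F.obj (Bicomod.regular k C).toRight).carrier ⊗[k] L.carrier :=
  (cotensor (F.obj (Bicomod.regular k C).toRight).coact L.coactLeft).subtype ∘ₗ (coHomUnit L adj).1

theorem homEquiv_regular_val (L : Bicomod k D C) {F : RightComod k C ⥤ RightComod k D}
    (adj : F ⊣ cotensorRightFunctor L) {N : RightComod k D}
    (f : F.obj (Bicomod.regular k C).toRight ⟶ N) (c : C) :
    ((adj.homEquiv _ _ f).1 c).1 = f.1.rTensor L.carrier (coHomUnitTensor L adj c) := by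
  rw [coHomUnit_comp]
  rfl

theorem coHomUnitTensor_mem (L : Bicomod k D C) {F : RightComod k C ⥤ RightComod k D}
    (adj : F ⊣ cotensorRightFunctor L) (c : C) : coHomUnitTensor L adj c ∈
      cotensor (F.obj (Bicomod.regular k C).toRight).coact L.coactLeft :=
  ((coHomUnit L adj).1 c).2

theorem coHomUnitTensor_right (L : Bicomod k D C) {F : RightComod k C ⥤ RightComod k D}
    (adj : F ⊣ cotensorRightFunctor L) (c : C) :
    tensorRight (F.obj (Bicomod.regular k C).toRight).carrier L.coactRight
        (coHomUnitTensor L adj c)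
      = (coHomUnitTensor L adj).rTensor C (Coalgebra.comul (R := k) c) := by
  refine (RightComod.cotensor_coact_val L (F.obj (Bicomod.regular k C).toRight) _).symm.trans ?_
  refine (congrArg ((cotensor (F.obj (Bicomod.regular k C).toRight).coact
    L.coactLeft).subtype.rTensor C) (RightComod.hom_coact (coHomUnit L adj) c)).trans ?_
  exact (LinearMap.rTensor_comp_apply ..).symm

theorem coHomUnitTensor_left (L : Bicomod k D C) {F : RightComod k C ⥤ RightComod k D}
    (adj : F ⊣ cotensorRightFunctor L) (c : C) :
    tensorLeft L.carrier (coHomCoaction L adj).1 (coHomUnitTensor L adj c)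
      = (coHomUnitTensor L adj).lTensor C (Coalgebra.comul (R := k) c) := by
  have h := congrArg Subtype.val (LinearMap.congr_fun (congrArg Subtype.val
    (coHomUnit_coHomCoaction L adj)) c)
  refine (LinearEquiv.eq_symm_apply (TensorProduct.assoc k C
    (F.obj (Bicomod.regular k C).toRight).carrier L.carrier)).1 (h.trans ?_)
  refine congrArg (TensorProduct.assoc k C
    (F.obj (Bicomod.regular k C).toRight).carrier L.carrier).symm ?_
  exact (LinearMap.lTensor_comp_apply ..).symm

theorem rTensor_comp_of_mem_cotensor {M N W : Type u} [AddCommGroup M] [Module k M]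
    [AddCommGroup N] [Module k N] [AddCommGroup W] [Module k W] {r : M →ₗ[k] M ⊗[k] D}
    {l : N →ₗ[k] D ⊗[k] N} (g : M →ₗ[k] W) {z : M ⊗[k] N} (hz : z ∈ cotensor r l) :
    (g.rTensor D ∘ₗ r).rTensor N z
      = (TensorProduct.assoc k W D N).symm (l.lTensor W (g.rTensor N z)) := by
  rw [LinearEquiv.eq_symm_apply, lTensor_rTensor_comm, ← mem_cotensor.1 hz, ← assoc_rTensor_rTensor,
    ← LinearMap.rTensor_comp_apply]

/-- A linear map `F(C) → W` is the same as a colinear map `F(C) → W ⊗ D`, to which the adjunction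
applies. The transpose of the latter depends only on `(g ⊗ L)η`, because `η` takes values in the
cotensor product. -/
theorem coHomUnitTensor_unique (L : Bicomod k D C) {F : RightComod k C ⥤ RightComod k D}
    (adj : F ⊣ cotensorRightFunctor L) (W : Type u) [AddCommGroup W] [Module k W]
    (g g' : (F.obj (Bicomod.regular k C).toRight).carrier →ₗ[k] W)
    (h : ∀ c, g.rTensor L.carrier (coHomUnitTensor L adj c)
      = g'.rTensor L.carrier (coHomUnitTensor L adj c)) : g = g' := by
  have key : ∀ (g : (F.obj (Bicomod.regular k C).toRight).carrier →ₗ[k] W) (c : C),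
      (RightComod.toCofree _ g).1.rTensor L.carrier (coHomUnitTensor L adj c)
        = (TensorProduct.assoc k W D L.carrier).symm (L.coactLeft.lTensor W
          (g.rTensor L.carrier (coHomUnitTensor L adj c))) := by
    exact fun g c => rTensor_comp_of_mem_cotensor g (coHomUnitTensor_mem L adj c)
  have h2 : RightComod.toCofree _ g = RightComod.toCofree _ g' := by
    apply (adj.homEquiv _ _).injective
    refine RightComod.hom_ext fun c => Subtype.ext ?_
    refine (homEquiv_regular_val L adj _ c).trans (Eq.trans ?_ (homEquiv_regular_val L adj _ c).symm)
    refine (key g c).trans (Eq.trans ?_ (key g' c).symm)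
    exact congrArg (fun z => (TensorProduct.assoc k W D L.carrier).symm
      (L.coactLeft.lTensor W z)) (h c)
  refine LinearMap.ext fun x => ?_
  refine (RightComod.counitMap_toCofree _ g x).symm.trans
    (Eq.trans ?_ (RightComod.counitMap_toCofree _ g' x))
  rw [h2]

/-- Since `W ⊗ L ≅ (W ⊗ D) □_D L`, the map `f` has a transpose `F(C) → W ⊗ D`; composing with `W ⊗
ε` gives `g`. -/
theorem coHomUnitTensor_exists (L : Bicomod k D C) {F : RightComod k C ⥤ RightComod k D}
    (adj : F ⊣ cotensorRightFunctor L) (W : Type u) [AddCommGroup W] [Module k W]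
    (f : C →ₗ[k] W ⊗[k] L.carrier)
    (hf : ∀ c, tensorRight W L.coactRight (f c) = f.rTensor C (Coalgebra.comul (R := k) c)) :
    ∃ g : (F.obj (Bicomod.regular k C).toRight).carrier →ₗ[k] W,
      ∀ c, g.rTensor L.carrier (coHomUnitTensor L adj c) = f c := by
  let f₁ : (Bicomod.regular k C).toRight ⟶ (RightComod.tensor W).obj L.toRight :=
    ⟨f, LinearMap.ext fun c => (hf c).symm⟩
  let f₂ := f₁ ≫ (RightComod.tensor W).map (regularCotensorHom L) ≫
    tensorCotensor W L (Bicomod.regular k D).toRight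
  let g₁ := (adj.homEquiv _ _).symm f₂
  refine ⟨counitMap k D W ∘ₗ g₁.1, fun c => ?_⟩
  have h1 : g₁.1.rTensor L.carrier (coHomUnitTensor L adj c)
      = (TensorProduct.assoc k W D L.carrier).symm (L.coactLeft.lTensor W (f c)) := by
    refine (homEquiv_regular_val L adj g₁ c).symm.trans ?_
    rw [Equiv.apply_symm_apply]
    refine congrArg (TensorProduct.assoc k W D L.carrier).symm ?_
    exact (LinearMap.lTensor_comp_apply ..).symm
  refine (LinearMap.rTensor_comp_apply ..).trans ?_
  refine (congrArg _ h1).trans ?_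
  rw [← counitMapLeft_assoc, LinearEquiv.apply_symm_apply, ← LinearMap.lTensor_comp_apply]
  have : counitMapLeft k D L.carrier ∘ₗ L.coactLeft = LinearMap.id :=
    LinearMap.ext (counitMapLeft_coactLeft L)
  rw [this, LinearMap.lTensor_id, LinearMap.id_apply]

/-- The unit of `F ⊣ - □_D L` at `C` is universal. -/
theorem isCoHom_coHomOfAdjunction (L : Bicomod k D C) {F : RightComod k C ⥤ RightComod k D}
    (adj : F ⊣ cotensorRightFunctor L) :
    IsCoHom (coHomOfAdjunction L adj) L (coHomUnitTensor L adj) where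
  mem := coHomUnitTensor_mem L adj
  left := coHomUnitTensor_left L adj
  right := coHomUnitTensor_right L adj
  exists_map := coHomUnitTensor_exists L adj
  unique := coHomUnitTensor_unique L adj

end CoHom

/-! ### Injectivity and dualities; dualities from adjunctions. -/

section Injective

variable {k : Type u} [Field k]
variable {C : Type u} [AddCommGroup C] [Module k C] [Coalgebra k C]
variable {D : Type u} [AddCommGroup D] [Module k D] [Coalgebra k D]

-- `C ≅ k ⊗ C` is cofree.
variable (k C) in
instance injective_regular : Injective (Bicomod.regular k C).toRight :=
  Injective.of_iso (RightComod.isoOfBijective (RightComod.tensorUnit (Bicomod.regular k C).toRight)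
    (TensorProduct.lid k C).symm.bijective).symm (RightComod.injective_cofree k)

/-- If `- □_D L` has a left adjoint that preserves monomorphisms, `L` is injective. -/
theorem injective_of_adjunction {L : Bicomod k D C} {F : RightComod k C ⥤ RightComod k D}
    [F.PreservesMonomorphisms] (adj : F ⊣ cotensorRightFunctor L) : Injective L.toRight :=
  -- `L ≅ D □_D L` with `D` injective, and a right adjoint of a functor preserving monomorphisms
  -- preserves injectives.
  Injective.of_iso (regularCotensorIso L).symm (adj.map_injective _ (injective_regular k D))

theorem CoDual.injective {X : Bicomod k C D} {L : Bicomod k D C} (a : CoDual X L) :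
    Injective L.toRight :=
  injective_of_adjunction a.adjunction

/-- A universal unit for an injective comodule is the unit of a duality. -/
theorem IsCoHom.nonempty_coDual_of_injective {X : Bicomod k C D} {L : Bicomod k D C}
    {η : C →ₗ[k] X.carrier ⊗[k] L.carrier} (h : IsCoHom X L η) [Injective L.toRight] :
    Nonempty (CoDual X L) := by
  let r := L.toRight.retractCofree
  refine h.nonempty_coDual r.r.1 (fun z => RightComod.hom_coact r.r z) fun l => ?_
  refine (congrArg r.r.1 (L.toRight.coactHom_apply l).symm).trans ?_
  exact LinearMap.congr_fun (congrArg Subtype.val r.retract) l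

/-- Transport of a duality along isomorphisms. -/
noncomputable def CoDual.ofIso {X X' : Bicomod k C D} {L L' : Bicomod k D C} (a : CoDual X L)
    (i : X ≅ X') (j : L ≅ L') : CoDual X' L' := by
  have hi : ∀ x, i.inv.1 (i.hom.1 x) = x := fun x =>
    LinearMap.congr_fun (congrArg Subtype.val i.hom_inv_id) x
  have hj : ∀ x, j.inv.1 (j.hom.1 x) = x := fun x =>
    LinearMap.congr_fun (congrArg Subtype.val j.hom_inv_id) x
  refine ⟨TensorProduct.map i.hom.1 j.hom.1 ∘ₗ a.η, a.e ∘ₗ TensorProduct.map j.inv.1 i.inv.1,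
    IsUnitMap.of_hom (a.isUnitMap.hom ≫ Bicomod.cotensorMap i.hom j.hom), fun l => ?_, fun x => ?_⟩
  · obtain ⟨l, rfl⟩ := (Bicomod.bijective_of_iso j).2 l
    have key : ∀ w : L.carrier ⊗[k] C, contractLeft L'.carrier
        (a.e ∘ₗ TensorProduct.map j.inv.1 i.inv.1) ((TensorProduct.map i.hom.1 j.hom.1 ∘ₗ
          a.η).lTensor L'.carrier (LinearMap.rTensor C j.hom.1 w))
        = j.hom.1 (contractLeft L.carrier a.e (a.η.lTensor L.carrier w)) := by
      intro w
      induction w with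
      | zero => simp
      | add u v hu hv => simp only [map_add, hu, hv]
      | tmul l c =>
        simp only [LinearMap.rTensor_tmul, LinearMap.lTensor_tmul, LinearMap.comp_apply]
        generalize a.η c = y
        induction y with
        | zero => simp
        | add u v hu hv => simp only [TensorProduct.tmul_add, map_add, hu, hv]
        | tmul x l' => simp [hi, hj]
    have e : L'.coactRight (j.hom.1 l) = LinearMap.rTensor C j.hom.1 (L.coactRight l) :=
      (LinearMap.congr_fun j.hom.2.2 l).symm
    rw [e, key, a.triangle_left]
  · obtain ⟨x, rfl⟩ := (Bicomod.bijective_of_iso i).2 x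
    have key : ∀ w : C ⊗[k] X.carrier, contractRight X'.carrier
        (a.e ∘ₗ TensorProduct.map j.inv.1 i.inv.1) ((TensorProduct.map i.hom.1 j.hom.1 ∘ₗ
          a.η).rTensor X'.carrier (LinearMap.lTensor C i.hom.1 w))
        = i.hom.1 (contractRight X.carrier a.e (a.η.rTensor X.carrier w)) := by
      intro w
      induction w with
      | zero => simp
      | add u v hu hv => simp only [map_add, hu, hv]
      | tmul c x =>
        simp only [LinearMap.rTensor_tmul, LinearMap.lTensor_tmul, LinearMap.comp_apply]
        generalize a.η c = y
        induction y with
        | zero => simp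
        | add u v hu hv => simp only [TensorProduct.add_tmul, map_add, hu, hv]
        | tmul x l' => simp [hi, hj]
    have e : X'.coactLeft (i.hom.1 x) = LinearMap.lTensor C i.hom.1 (X.coactLeft x) :=
      (LinearMap.congr_fun i.hom.2.1 x).symm
    rw [e, key, a.triangle_right]

/-- A duality is determined by an adjunction between cotensor functors. -/
theorem nonempty_coDual_of_adjunction {X : Bicomod k C D} {L : Bicomod k D C}
    (adj : cotensorRightFunctor X ⊣ cotensorRightFunctor L) : Nonempty (CoDual X L) := by
  -- As `L` is injective, the universal unit on the co-hom bicomodule built from `adj` is a duality.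
  -- Uniqueness of left adjoints then identifies that bicomodule with `X`, left coaction included.
  have := injective_of_adjunction adj
  obtain ⟨a⟩ := (isCoHom_coHomOfAdjunction L adj).nonempty_coDual_of_injective
  obtain ⟨i⟩ := nonempty_iso_of_cotensorRightFunctor_iso (a.adjunction.leftAdjointUniq adj)
  exact ⟨a.ofIso i (Iso.refl L)⟩

end Injective

/-! ### Quasifiniteness of a bicomodule in a duality. -/

section Quasifinite

variable {k : Type u} [Field k]
variable {C : Type u} [AddCommGroup C] [Module k C] [Coalgebra k C]
variable {D : Type u} [AddCommGroup D] [Module k D] [Coalgebra k D]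

theorem contractLeft_rTensor {V L X Z : Type u} [AddCommGroup V] [Module k V] [AddCommGroup L]
    [Module k L] [AddCommGroup X] [Module k X] [AddCommGroup Z] [Module k Z]
    (e : L ⊗[k] X →ₗ[k] k) (f : V →ₗ[k] L) (z : V ⊗[k] (X ⊗[k] Z)) :
    contractLeft Z e (f.rTensor (X ⊗[k] Z) z) = TensorProduct.lid k Z
      ((e ∘ₗ f.rTensor X).rTensor Z ((TensorProduct.assoc k V X Z).symm z)) := by
  have : contractLeft Z e ∘ₗ f.rTensor (X ⊗[k] Z) = (TensorProduct.lid k Z).toLinearMap ∘ₗ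
      (e ∘ₗ f.rTensor X).rTensor Z ∘ₗ (TensorProduct.assoc k V X Z).symm.toLinearMap := by
    ext v x z; simp
  exact LinearMap.congr_fun this z

/-- By the first triangle identity, a colinear `φ : V → L` is recovered by contracting `v₀ ⊗ η(v₁)`
with the functional `e ∘ (φ ⊗ X)` on `V ⊗ X`. If `V` is finite dimensional, only the values of this
functional on a finite dimensional subspace `Y` matter, so `Hom(V, L)` embeds into the dual of `Y`.
-/
theorem CoDual.quasifinite {X : Bicomod k C D} {L : Bicomod k D C} (a : CoDual X L) :
    L.toRight.Quasifinite := by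
  intro V hV
  let t : V.carrier →ₗ[k] (V.carrier ⊗[k] X.carrier) ⊗[k] L.carrier :=
    (TensorProduct.assoc k V.carrier X.carrier L.carrier).symm.toLinearMap ∘ₗ
      a.η.lTensor V.carrier ∘ₗ V.coact
  have ht : ∀ (φ : V ⟶ L.toRight) (v : V.carrier), φ.1 v = TensorProduct.lid k L.carrier
      ((a.e ∘ₗ LinearMap.rTensor X.carrier φ.1).rTensor L.carrier (t v)) := by
    intro φ v
    refine (a.triangle_left (φ.1 v)).symm.trans ?_
    have h : L.coactRight (φ.1 v) = LinearMap.rTensor C φ.1 (V.coact v) :=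
      RightComod.hom_coact φ v
    rw [h]
    refine Eq.trans ?_ (contractLeft_rTensor a.e φ.1 _)
    exact congrArg _ (lTensor_rTensor_comm φ.1 a.η _)
  obtain ⟨ι, b⟩ : Σ ι : Type u, Module.Basis ι k V.carrier := ⟨_, Module.Basis.ofVectorSpace k V.carrier⟩
  have : Finite ι := Module.Finite.finite_basis b
  -- `Y ⊗ L` contains the tensors `v₀ ⊗ η(v₁)` for `v` in a basis of `V`.
  obtain ⟨Y, hY, hYs⟩ := TensorProduct.exists_finite_submodule_left_of_setFinite
    (Set.range fun i => t (b i)) (Set.finite_range _)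
  let Φ : (V ⟶ L.toRight) →ₗ[k] (Y →ₗ[k] k) :=
    { toFun := fun φ => (a.e ∘ₗ LinearMap.rTensor X.carrier φ.1) ∘ₗ Y.subtype
      map_add' := fun φ ψ => by
        ext y
        exact (congrArg a.e (LinearMap.congr_fun (LinearMap.rTensor_add X.carrier φ.1 ψ.1) y.1)).trans
          (map_add a.e _ _)
      map_smul' := fun r φ => by
        ext y
        exact (congrArg a.e (LinearMap.congr_fun (LinearMap.rTensor_smul X.carrier r φ.1) y.1)).trans
          (map_smul a.e _ _) }
  refine Module.Finite.of_injective Φ fun φ ψ h => Subtype.ext (b.ext fun i => ?_)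
  obtain ⟨y, hy⟩ := hYs ⟨i, rfl⟩
  refine (ht φ (b i)).trans (Eq.trans ?_ (ht ψ (b i)).symm)
  have key : ∀ φ : V ⟶ L.toRight, (a.e ∘ₗ LinearMap.rTensor X.carrier φ.1).rTensor L.carrier (t (b i))
      = (Φ φ).rTensor L.carrier y := fun φ => by
    refine (congrArg _ hy.symm).trans ?_
    exact (LinearMap.rTensor_comp_apply ..).symm
  rw [key, key, h]

end Quasifinite

/-! ### Dualities versus isomorphisms with the co-hom; zero bicomodules. -/

section CoHom

variable {k : Type u} [Field k]
variable {C : Type u} [AddCommGroup C] [Module k C] [Coalgebra k C]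
variable {D : Type u} [AddCommGroup D] [Module k D] [Coalgebra k D]

/-- The duality supplies the left adjoint, so `coHom` takes its genuine value, and universal units
are unique. -/
theorem CoDual.nonempty_iso_coHom {X : Bicomod k C D} {L : Bicomod k D C} (a : CoDual X L) :
    Nonempty (X ≅ coHom L) := by
  have h : (cotensorRightFunctor L).IsRightAdjoint := a.adjunction.isRightAdjoint
  obtain ⟨i, -⟩ := a.isCoHom.exists_iso (isCoHom_coHomOfAdjunction L (Adjunction.ofIsRightAdjoint _))
  rw [coHom, dif_pos h]
  exact ⟨i⟩

theorem nonempty_coDual_of_iso_coHom {X : Bicomod k C D} {L : Bicomod k D C}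
    (h : (cotensorRightFunctor L).IsRightAdjoint) (hL : Injective L.toRight) (i : X ≅ coHom L) :
    Nonempty (CoDual X L) := by
  rw [coHom, dif_pos h] at i
  obtain ⟨a⟩ := (isCoHom_coHomOfAdjunction L
    (Adjunction.ofIsRightAdjoint (cotensorRightFunctor L))).nonempty_coDual_of_injective
  exact ⟨a.ofIso i.symm (Iso.refl L)⟩

theorem Bicomod.subsingleton_of_iso {X Y : Bicomod k C D} (i : X ≅ Y) [Subsingleton Y.carrier] :
    Subsingleton X.carrier :=
  (Bicomod.bijective_of_iso i).1.subsingleton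

theorem Bicomod.subsingleton_cotensor_left {E : Type u} [AddCommGroup E] [Module k E] [Coalgebra k E]
    (X : Bicomod k C D) (Y : Bicomod k D E) [Subsingleton X.carrier] :
    Subsingleton (X.cotensor Y).carrier :=
  inferInstanceAs (Subsingleton (FrobeniusComod.cotensor X.coactRight Y.coactLeft))

theorem Bicomod.subsingleton_cotensor_right {E : Type u} [AddCommGroup E] [Module k E] [Coalgebra k E]
    (X : Bicomod k C D) (Y : Bicomod k D E) [Subsingleton Y.carrier] :
    Subsingleton (X.cotensor Y).carrier :=
  inferInstanceAs (Subsingleton (FrobeniusComod.cotensor X.coactRight Y.coactLeft))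

/-- If `L = 0`, the identity and zero maps of the co-hom agree on the unit and hence coincide. When
the adjoint does not exist, the value is `0` by convention. -/
theorem subsingleton_coHom (L : Bicomod k D C) [Subsingleton L.carrier] :
    Subsingleton (coHom L).carrier := by
  rw [coHom]
  split
  case isTrue h =>
    have hu := (isCoHom_coHomOfAdjunction L
      (Adjunction.ofIsRightAdjoint (cotensorRightFunctor L))).unique _ LinearMap.id 0
      fun c => Subsingleton.elim _ _
    exact subsingleton_of_forall_eq 0 fun x => LinearMap.congr_fun hu x
  case isFalse h => exact inferInstanceAs (Subsingleton PUnit)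

/-- The duality between zero bicomodules. -/
def CoDual.ofSubsingleton (X : Bicomod k C D) (L : Bicomod k D C) [Subsingleton X.carrier]
    [Subsingleton L.carrier] : CoDual X L where
  η := 0
  e := 0
  isUnitMap := ⟨fun _ => Submodule.zero_mem _, fun _ => by simp, fun _ => by simp⟩
  triangle_left _ := Subsingleton.elim _ _
  triangle_right _ := Subsingleton.elim _ _

end CoHom

/-! ### Strict Morita–Takeuchi contexts and equivalences. -/

section Contexts

variable {k : Type u} [Field k]
variable {C : Type u} [AddCommGroup C] [Module k C] [Coalgebra k C]
variable {D : Type u} [AddCommGroup D] [Module k D] [Coalgebra k D]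

/-- A linear extension to `P ⊗ Q` of the counit `P □ Q ≅ D → k`. -/
noncomputable def StrictContext.e (S : StrictContext k C D) :
    S.P.carrier ⊗[k] S.Q.carrier →ₗ[k] k :=
  (LinearMap.exists_extend (p := cotensor S.P.coactRight S.Q.coactLeft)
    ((Coalgebra.counit (R := k) (A := D)) ∘ₗ S.g.inv.1)).choose

theorem StrictContext.e_comp (S : StrictContext k C D) :
    S.e ∘ₗ Bicomod.toTensor S.g.hom = Coalgebra.counit := by
  refine LinearMap.ext fun d => ?_
  have h := LinearMap.congr_fun (LinearMap.exists_extend (p := cotensor S.P.coactRight S.Q.coactLeft)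
    ((Coalgebra.counit (R := k) (A := D)) ∘ₗ S.g.inv.1)).choose_spec (S.g.hom.1 d)
  refine h.trans (congrArg (Coalgebra.counit (R := k) (A := D)) ?_)
  exact LinearMap.congr_fun (congrArg Subtype.val S.g.hom_inv_id) d

theorem contractLeft_assoc {L X V D : Type u} [AddCommGroup V] [Module k V] [AddCommGroup L]
    [Module k L] [AddCommGroup X] [Module k X] [AddCommGroup D] [Module k D]
    (e : L ⊗[k] X →ₗ[k] k) (g : D →ₗ[k] L ⊗[k] X) (z : D ⊗[k] V) :
    contractLeft V e (TensorProduct.assoc k L X V (g.rTensor V z))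
      = TensorProduct.lid k V ((e ∘ₗ g).rTensor V z) := by
  rw [contractLeft, LinearMap.comp_apply, LinearMap.comp_apply, LinearEquiv.coe_coe,
    LinearEquiv.coe_coe, LinearEquiv.symm_apply_apply, LinearMap.rTensor_comp_apply]

/-- A strict context is a duality. -/
noncomputable def StrictContext.coDual (S : StrictContext k C D) : CoDual S.Q S.P where
  η := Bicomod.toTensor S.f.hom
  e := S.e
  isUnitMap := IsUnitMap.of_hom _
  -- Contracting `eq_P` with `e` replaces `g` by the counit of `D`; `eq_Q` gives the other identity
  -- likewise.
  triangle_left p := by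
    rw [S.eq_P, contractLeft_assoc, S.e_comp]
    exact counitMapLeft_coactLeft S.P p
  triangle_right q := by
    rw [contractRight, LinearMap.comp_apply, LinearMap.comp_apply, LinearEquiv.coe_coe,
      LinearEquiv.coe_coe, S.eq_Q, ← LinearMap.lTensor_comp_apply, S.e_comp]
    exact S.Q.toRight.counitMap_coact q

/-- The equivalence `- □_D P` given by a strict context. -/
noncomputable def StrictContext.equivalence (S : StrictContext k C D) :
    RightComod k D ≌ RightComod k C :=
  CategoryTheory.Equivalence.mk (cotensorRightFunctor S.P) (cotensorRightFunctor S.Q)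
    (cotensorRegularIso k D ≪≫ cotensorRightMapIso S.g ≪≫ cotensorRightCompIso S.P S.Q)
    (cotensorRegularIso k C ≪≫ cotensorRightMapIso S.f ≪≫ cotensorRightCompIso S.Q S.P).symm

theorem StrictContext.isEquivalence (S : StrictContext k C D) :
    (cotensorRightFunctor S.P).IsEquivalence :=
  S.equivalence.isEquivalence_functor

/-- In a strict context the map `g` is determined by `f`. -/
theorem StrictContext.eq_of_eq_P (S : StrictContext k C D)
    (g : D →ₗ[k] S.P.carrier ⊗[k] S.Q.carrier)
    (hg : ∀ p, (Bicomod.toTensor S.f.hom).lTensor S.P.carrier (S.P.coactRight p) =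
      TensorProduct.assoc k S.P.carrier S.Q.carrier S.P.carrier
        (g.rTensor S.P.carrier (S.P.coactLeft p))) : g = Bicomod.toTensor S.g.hom := by
  -- Any `g'` is recovered from `(g' ⊗ P)λ`, with `λ` the left coaction of `P`: apply it to the
  -- `P`-factor of `S.g d`. Left colinearity of `S.g` turns the result into `g'(d₁) ⊗ S.g(d₂)`, and
  -- contracting the second factor with `e` leaves `g'(d)`.
  have key : ∀ (g' : D →ₗ[k] S.P.carrier ⊗[k] S.Q.carrier) (d : D),
      g' d = TensorProduct.rid k _ (S.e.lTensor _ (TensorProduct.assoc k _ _ _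
        ((g'.rTensor S.P.carrier ∘ₗ S.P.coactLeft).rTensor S.Q.carrier
          (Bicomod.toTensor S.g.hom d)))) := by
    intro g' d
    have h1 := (IsUnitMap.of_hom S.g.hom).left d
    rw [tensorLeft, LinearMap.comp_apply, LinearEquiv.coe_coe] at h1
    rw [LinearMap.rTensor_comp_apply, assoc_rTensor_rTensor, h1, lTensor_rTensor_comm,
      ← LinearMap.lTensor_comp_apply, S.e_comp, Coalgebra.lTensor_counit_comul,
      LinearMap.rTensor_tmul, TensorProduct.rid_tmul, one_smul]
  have h : g.rTensor S.P.carrier ∘ₗ S.P.coactLeft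
      = (Bicomod.toTensor S.g.hom).rTensor S.P.carrier ∘ₗ S.P.coactLeft :=
    LinearMap.ext fun p => (TensorProduct.assoc k _ _ _).injective ((hg p).symm.trans (S.eq_P p))
  refine LinearMap.ext fun d => ?_
  refine (key g d).trans (Eq.trans ?_ (key (Bicomod.toTensor S.g.hom) d).symm)
  rw [h]

/-- A strict context is determined up to isomorphism by the bicomodule `P`. -/
theorem StrictContext.nonempty_iso {S T : StrictContext k C D} (p : S.P ≅ T.P) :
    Nonempty (S.Iso T) := by
  -- After transporting the duality of `T` along `p`, both `S.Q` and `T.Q` carry universal units for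
  -- `S.P`; this determines `q` and its compatibility with `f`.
  obtain ⟨q, hq⟩ := S.coDual.isCoHom.exists_iso
    (T.coDual.ofIso (CategoryTheory.Iso.refl T.Q) p.symm).isCoHom
  have hp : p.hom.1 ∘ₗ p.inv.1 = LinearMap.id := congrArg Subtype.val p.inv_hom_id
  have hf : ∀ c, TensorProduct.map q.hom.1 p.hom.1 (Bicomod.toTensor S.f.hom c)
      = Bicomod.toTensor T.f.hom c := by
    intro c
    have h1 : TensorProduct.map q.hom.1 p.hom.1 (Bicomod.toTensor S.f.hom c)
        = p.hom.1.lTensor T.Q.carrier (q.hom.1.rTensor S.P.carrier (Bicomod.toTensor S.f.hom c)) := by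
      rw [← LinearMap.lTensor_comp_rTensor, LinearMap.comp_apply]
    rw [h1]
    refine (congrArg _ (hq c)).trans ?_
    change p.hom.1.lTensor T.Q.carrier (p.inv.1.lTensor T.Q.carrier (Bicomod.toTensor T.f.hom c)) = _
    rw [← LinearMap.lTensor_comp_apply, hp, LinearMap.lTensor_id, LinearMap.id_apply]
  -- `S.g` transported along `p` and `q` satisfies the equation `eq_P` of `T`, which characterizes
  -- `T.g`.
  have hg := T.eq_of_eq_P (TensorProduct.map p.hom.1 q.hom.1 ∘ₗ Bicomod.toTensor S.g.hom) fun x => by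
    obtain ⟨y, rfl⟩ := (Bicomod.bijective_of_iso p).2 x
    have hr : T.P.coactRight (p.hom.1 y) = LinearMap.rTensor C p.hom.1 (S.P.coactRight y) :=
      (LinearMap.congr_fun p.hom.2.2 y).symm
    have hl : T.P.coactLeft (p.hom.1 y) = LinearMap.lTensor D p.hom.1 (S.P.coactLeft y) :=
      (LinearMap.congr_fun p.hom.2.1 y).symm
    have hfm : Bicomod.toTensor T.f.hom
        = TensorProduct.map q.hom.1 p.hom.1 ∘ₗ Bicomod.toTensor S.f.hom :=
      LinearMap.ext fun c => (hf c).symm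
    have e1 : ∀ z : S.P.carrier ⊗[k] C, (Bicomod.toTensor T.f.hom).lTensor T.P.carrier
        (LinearMap.rTensor C p.hom.1 z) = TensorProduct.map p.hom.1
          (TensorProduct.map q.hom.1 p.hom.1)
          ((Bicomod.toTensor S.f.hom).lTensor S.P.carrier z) := by
      rw [hfm]
      intro z
      induction z with
      | zero => simp
      | add a b ha hb => simp only [map_add, ha, hb]
      | tmul a b => simp
    have e2 : ∀ z : D ⊗[k] S.P.carrier, (TensorProduct.map p.hom.1 q.hom.1 ∘ₗ
        Bicomod.toTensor S.g.hom).rTensor T.P.carrier (LinearMap.lTensor D p.hom.1 z)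
        = TensorProduct.map (TensorProduct.map p.hom.1 q.hom.1) p.hom.1
          ((Bicomod.toTensor S.g.hom).rTensor S.P.carrier z) := by
      intro z
      induction z with
      | zero => simp
      | add a b ha hb => simp only [map_add, ha, hb]
      | tmul a b => simp
    rw [hr, hl, e1, e2, S.eq_P, TensorProduct.map_map_assoc]
  exact ⟨⟨p, q, Subtype.ext (LinearMap.ext fun c => Subtype.ext (hf c)),
    Subtype.ext (LinearMap.ext fun d => Subtype.ext (LinearMap.congr_fun hg d))⟩⟩

variable {X : Bicomod k C D} {L : Bicomod k D C}

theorem CoDual.counit_counit (a : CoDual X L) :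
    Coalgebra.counit (R := k) (A := D) ∘ₗ a.counit.1
      = a.e ∘ₗ (cotensor L.coactRight X.coactLeft).subtype :=
  LinearMap.ext fun z => a.counit_counitRight z.1

/-- Let `w` be the image of the coaction of `l` in `(L □ X) □ L`. The first triangle identity says
that the counit sends `w` to the left coaction of `l` in `D □_D L`; applying `g`, a left inverse of
the counit, returns `w`. -/
theorem CoDual.eq_left (a : CoDual X L)
    (g : D →ₗ[k] cotensor L.coactRight X.coactLeft) (hg : ∀ z, g (a.counit.1 z) = z) (l : L.carrier) :
    a.η.lTensor L.carrier (L.coactRight l) = TensorProduct.assoc k L.carrier X.carrier L.carrier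
      (((cotensor L.coactRight X.coactLeft).subtype ∘ₗ g).rTensor L.carrier (L.coactLeft l)) := by
  let u : C →ₗ[k] cotensor X.coactRight L.coactLeft := a.isUnitMap.hom.1
  have hu : (cotensor X.coactRight L.coactLeft).subtype ∘ₗ u = a.η := LinearMap.ext fun _ => rfl
  let ε : cotensor L.coactRight X.coactLeft →ₗ[k] D := a.counit.1
  let z : cotensor L.coactRight (cotensorLeftCoaction L.coactLeft X.commute) :=
    cotensorMap LinearMap.id u (by simp) a.isUnitMap.hom.2.1 ⟨L.coactRight l, L.toRight.coact_mem l⟩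
  have hz : z.1 = u.lTensor L.carrier (L.coactRight l) := rfl
  let w : cotensor (cotensorRightCoaction L.coactRight X.commute) L.coactLeft :=
    cotensorAssoc L.coactRight X.commute L.coactLeft z
  have hw : (cotensor L.coactRight X.coactLeft).subtype.rTensor L.carrier w.1
      = (TensorProduct.assoc k L.carrier X.carrier L.carrier).symm
        (a.η.lTensor L.carrier (L.coactRight l)) := by
    rw [← hu, LinearMap.lTensor_comp_apply, ← hz]
    exact cotensorAssoc_spec L.coactRight X.commute L.coactLeft z
  let v : cotensor (Coalgebra.comul (R := k) (A := D)) L.coactLeft :=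
    cotensorMap ε LinearMap.id a.counit.2.2 (by simp) w
  have hv : v.1 = ε.rTensor L.carrier w.1 := rfl
  -- An element of `D □_D L` is determined by its image under `ε ⊗ L`, and here `ε` composed with
  -- the counit of the duality is `e`.
  have hvl : counitMapLeft k D L.carrier v.1 = l := by
    rw [hv, counitMapLeft, LinearMap.comp_apply, ← LinearMap.rTensor_comp_apply]
    refine (congrArg (fun h : cotensor L.coactRight X.coactLeft →ₗ[k] k =>
      TensorProduct.lid k L.carrier (h.rTensor L.carrier w.1)) a.counit_counit).trans ?_
    refine Eq.trans ?_ (a.triangle_left l)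
    rw [LinearMap.rTensor_comp_apply, hw]
    rfl
  have hvl' : v.1 = L.coactLeft l := by rw [← coactLeft_counitMapLeft L v, hvl]
  have hgε : g ∘ₗ ε = LinearMap.id := LinearMap.ext hg
  rw [← hvl', hv, LinearMap.rTensor_comp_apply, ← LinearMap.rTensor_comp_apply L.carrier g, hgε,
    LinearMap.rTensor_id, LinearMap.id_apply, hw, LinearEquiv.apply_symm_apply]

/-- The argument of `CoDual.eq_left` in `X □ (L □ X)`, based on the second triangle identity. -/
theorem CoDual.eq_right (a : CoDual X L)
    (g : D →ₗ[k] cotensor L.coactRight X.coactLeft) (hg : ∀ z, g (a.counit.1 z) = z) (x : X.carrier) :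
    TensorProduct.assoc k X.carrier L.carrier X.carrier (a.η.rTensor X.carrier (X.coactLeft x)) =
      ((cotensor L.coactRight X.coactLeft).subtype ∘ₗ g).lTensor X.carrier (X.coactRight x) := by
  let u : C →ₗ[k] cotensor X.coactRight L.coactLeft := a.isUnitMap.hom.1
  have hu : (cotensor X.coactRight L.coactLeft).subtype ∘ₗ u = a.η := LinearMap.ext fun _ => rfl
  let ε : cotensor L.coactRight X.coactLeft →ₗ[k] D := a.counit.1
  let z : cotensor (cotensorRightCoaction X.coactRight L.commute) X.coactLeft :=
    cotensorMap u LinearMap.id a.isUnitMap.hom.2.2 (by simp) ⟨X.coactLeft x, X.coactLeft_mem x⟩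
  have hz : z.1 = u.rTensor X.carrier (X.coactLeft x) := rfl
  let w : cotensor X.coactRight (cotensorLeftCoaction X.coactLeft L.commute) :=
    (cotensorAssoc X.coactRight L.commute X.coactLeft).symm z
  have hw : (cotensor L.coactRight X.coactLeft).subtype.lTensor X.carrier w.1
      = TensorProduct.assoc k X.carrier L.carrier X.carrier
        (a.η.rTensor X.carrier (X.coactLeft x)) := by
    have h := cotensorAssoc_spec X.coactRight L.commute X.coactLeft w
    rw [LinearEquiv.apply_symm_apply, hz] at h
    rw [← hu, LinearMap.rTensor_comp_apply]
    exact ((LinearEquiv.eq_symm_apply (TensorProduct.assoc k X.carrier L.carrier X.carrier)).1 h).symm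
  let v : cotensor X.coactRight (Coalgebra.comul (R := k) (A := D)) :=
    cotensorMap LinearMap.id ε (by simp) a.counit.2.1 w
  have hv : v.1 = ε.lTensor X.carrier w.1 := rfl
  have hvl : counitMap k D X.carrier v.1 = x := by
    rw [hv, counitMap, LinearMap.comp_apply, ← LinearMap.lTensor_comp_apply]
    refine (congrArg (fun h : cotensor L.coactRight X.coactLeft →ₗ[k] k =>
      TensorProduct.rid k X.carrier (h.lTensor X.carrier w.1)) a.counit_counit).trans ?_
    refine Eq.trans ?_ (a.triangle_right x)
    rw [LinearMap.lTensor_comp_apply, hw]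
    rfl
  have hvl' : v.1 = X.coactRight x := by
    rw [← hvl]
    exact (coact_counitMap X.toRight v).symm
  have hgε : g ∘ₗ ε = LinearMap.id := LinearMap.ext hg
  rw [← hvl', hv, LinearMap.lTensor_comp_apply, ← LinearMap.lTensor_comp_apply X.carrier g, hgε,
    LinearMap.lTensor_id, LinearMap.id_apply, hw]

/-- The isomorphisms `X ≅ C □_C X` and `Y ≅ C □_C Y` identify `C □_C f` with `f`. -/
theorem bijective_of_isIso_cotensorRightMap {X Y : Bicomod k C D} (f : X ⟶ Y)
    (h : IsIso ((cotensorRightMap f).app (Bicomod.regular k C).toRight)) :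
    Function.Bijective f.1 := by
  let fr : X.toRight ⟶ Y.toRight := ⟨f.1, f.2.2⟩
  have e : fr ≫ (regularCotensorIso Y).hom = (regularCotensorIso X).hom ≫
      (cotensorRightMap f).app (Bicomod.regular k C).toRight :=
    RightComod.hom_ext fun x => Subtype.ext (LinearMap.congr_fun f.2.1 x).symm
  have : IsIso fr := by
    rw [(IsIso.eq_comp_inv _).2 e]
    infer_instance
  exact RightComod.bijective_of_iso (asIso fr)

/-- A duality whose functors are equivalences is a strict context. -/
theorem CoDual.exists_strictContext (a : CoDual X L)
    [(cotensorRightFunctor X).IsEquivalence] : ∃ S : StrictContext k C D, S.P = L := by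
  have : (cotensorRightFunctor L).IsEquivalence := a.adjunction.isEquivalence_right_of_isEquivalence_left
  have hu : IsIso a.unitNat := inferInstanceAs (IsIso a.adjunction.unit)
  have hc : IsIso a.counitNat := inferInstanceAs (IsIso a.adjunction.counit)
  -- Up to coherence isomorphisms, the unit of the adjunction is cotensoring with the bicolinear
  -- unit, so the latter is bijective; the counit is treated alike.
  have hu' : IsIso (cotensorRightMap a.isUnitMap.hom) := by
    have : cotensorRightMap a.isUnitMap.hom
        = (cotensorRegularIso k C).inv ≫ a.unitNat ≫ (cotensorRightCompIso X L).inv := by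
      simp [CoDual.unitNat]
    rw [this]
    infer_instance
  have hc' : IsIso (cotensorRightMap a.counit) := by
    have : cotensorRightMap a.counit
        = (cotensorRightCompIso L X).hom ≫ a.counitNat ≫ (cotensorRegularIso k D).hom := by
      simp [CoDual.counitNat]
    rw [this]
    infer_instance
  let f := Bicomod.isoOfBijective _ (bijective_of_isIso_cotensorRightMap a.isUnitMap.hom inferInstance)
  let g := (Bicomod.isoOfBijective _ (bijective_of_isIso_cotensorRightMap a.counit inferInstance)).symm
  have hg : ∀ z, g.hom.1 (a.counit.1 z) = z := fun z =>
    LinearMap.congr_fun (congrArg Subtype.val g.inv_hom_id) z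
  exact ⟨⟨L, X, f, g, a.eq_left g.hom.1 hg, a.eq_right g.hom.1 hg⟩, rfl⟩

/-- A bicomodule whose cotensor functor is an equivalence is part of a strict context. -/
theorem exists_strictContext_of_isEquivalence (P : Bicomod k D C)
    [(cotensorRightFunctor P).IsEquivalence] : ∃ S : StrictContext k C D, S.P = P := by
  let e := (cotensorRightFunctor P).asEquivalence
  have : e.functor.Additive := inferInstanceAs (cotensorRightFunctor P).Additive
  have : e.functor.Linear k := inferInstanceAs ((cotensorRightFunctor P).Linear k)
  have : e.inverse.Additive := inferInstance
  have : e.inverse.Linear k := inferInstance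
  -- The inverse equivalence is linear and has `- □_D P` as adjoint on both sides, so it is itself a
  -- cotensor functor.
  obtain ⟨Q, ⟨i⟩⟩ := exists_cotensorRightFunctor_iso (F := e.inverse) (G := e.functor)
    (H := e.functor) e.symm.toAdjunction e.toAdjunction
  have hQ : (cotensorRightFunctor Q).IsEquivalence := Functor.isEquivalence_of_iso i
  obtain ⟨a⟩ := nonempty_coDual_of_adjunction
    (e.symm.toAdjunction.ofNatIsoLeft i : cotensorRightFunctor Q ⊣ cotensorRightFunctor P)
  exact a.exists_strictContext

end Contexts

/-! ### Moving equivalences across an adjunction. -/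

section Adjunctions

universe v₁ v₂ u₁ u₂

variable {𝒜 : Type u₁} [Category.{v₁} 𝒜] {ℬ : Type u₂} [Category.{v₂} ℬ]

/-- A left adjoint `G` of `α ⋙ F ⋙ β`, for equivalences `α` and `β`, yields a left adjoint of `F`. -/
noncomputable def adjunctionOfEquivalences {F : 𝒜 ⥤ ℬ} {G : ℬ ⥤ 𝒜} (α : 𝒜 ⥤ 𝒜) (β : ℬ ⥤ ℬ)
    [α.IsEquivalence] [β.IsEquivalence] (adj : G ⊣ α ⋙ F ⋙ β) : (β ⋙ G) ⋙ α ⊣ F :=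
  -- The right adjoint of the composite is `α⁻¹ ⋙ (α ⋙ F ⋙ β) ⋙ β⁻¹`, which cancels to `F`.
  ((β.asEquivalence.toAdjunction.comp adj).comp α.asEquivalence.toAdjunction).ofNatIsoRight
    ((Functor.associator _ _ _).symm ≪≫
      Functor.isoWhiskerRight ((Functor.associator _ _ _).symm ≪≫
        Functor.isoWhiskerRight α.asEquivalence.counitIso (F ⋙ β) ≪≫ (F ⋙ β).leftUnitor) _ ≪≫
      Functor.associator _ _ _ ≪≫ Functor.isoWhiskerLeft F β.asEquivalence.unitIso.symm ≪≫
      F.rightUnitor)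

end Adjunctions

/-! ### Fourtuples and Frobenius functors between right comodules. -/

section FourTuples

variable {k : Type u} [Field k]
variable {C : Type u} [AddCommGroup C] [Module k C] [Coalgebra k C]
variable {D : Type u} [AddCommGroup D] [Module k D] [Coalgebra k D]

/-- Cotensoring with `A □ X □ B`. -/
noncomputable def cotensorRightCompIso₃ (A : Bicomod k C C) (X : Bicomod k C D) (B : Bicomod k D D) :
    cotensorRightFunctor ((A.cotensor X).cotensor B) ≅
      cotensorRightFunctor A ⋙ cotensorRightFunctor X ⋙ cotensorRightFunctor B :=
  cotensorRightCompIso (A.cotensor X) B ≪≫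
    Functor.isoWhiskerRight (cotensorRightCompIso A X) _ ≪≫ Functor.associator _ _ _

namespace FourTuple

/-- `X` is a dual of `L`, and `L` is a dual of `U □ X □ V`. -/
def IsDual (q : FourTuple k C D) : Prop :=
  Nonempty (CoDual q.X q.L) ∧ Nonempty (CoDual q.L q.UXV)

noncomputable def uxvIso (q : FourTuple k C D) : cotensorRightFunctor q.UXV ≅
    cotensorRightFunctor q.U.P ⋙ cotensorRightFunctor q.X ⋙ cotensorRightFunctor q.V.P :=
  cotensorRightCompIso₃ q.U.P q.X q.V.P

/-- The adjunction of the hypothesis has right adjoint `- □ (U □ X □ V)`. Moving the equivalences `-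
□ U` and `- □ V` to the left adjoint exhibits `- □ (V □ L □ U)` as left adjoint of `- □ X`.
Quasifiniteness and injectivity of `X` are drawn from this form. -/
theorem IsDual.exists_coDual {q : FourTuple k C D} (h : Nonempty (CoDual q.L q.UXV)) :
    Nonempty (CoDual ((q.V.P.cotensor q.L).cotensor q.U.P) q.X) := by
  obtain ⟨a⟩ := h
  have := q.U.isEquivalence
  have := q.V.isEquivalence
  exact nonempty_coDual_of_adjunction
    ((adjunctionOfEquivalences _ _ (a.adjunction.ofNatIsoRight q.uxvIso)).ofNatIsoLeft
      (cotensorRightCompIso₃ q.V.P q.L q.U.P ≪≫ (Functor.associator _ _ _).symm).symm)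

/-- `U` is injective by the duality of its context, cotensoring with the injective `X` preserves
injectives, and so does `- □ V`, being right adjoint to a cotensor functor. -/
theorem injective_uxv (q : FourTuple k C D) [Injective q.X.toRight] : Injective q.UXV.toRight := by
  have h1 : Injective q.U.P.toRight := q.U.coDual.injective
  exact q.V.coDual.adjunction.map_injective _ (injective_cotensorRightFunctor_obj q.X q.U.P.toRight)

theorem rightCondition_iff (q : FourTuple k C D) : q.RightCondition ↔ q.IsDual := by
  constructor
  · rintro ⟨-, hL, -, hX, ⟨i⟩, ⟨j⟩⟩
    have hUXV := q.injective_uxv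
    -- If both left adjoints exist, the co-homs are genuine and injectivity yields the dualities.
    -- Otherwise one co-hom is `0` by convention, the two isomorphisms force `X = 0` and `L = 0`,
    -- and zero bicomodules are trivially dual.
    by_cases h : (cotensorRightFunctor q.L).IsRightAdjoint ∧ (cotensorRightFunctor q.UXV).IsRightAdjoint
    · exact ⟨nonempty_coDual_of_iso_coHom h.1 hL i, nonempty_coDual_of_iso_coHom h.2 hUXV j⟩
    · have hzero : Subsingleton q.X.carrier ∧ Subsingleton q.L.carrier := by
        have hZ : ∀ {A B : Type u} [AddCommGroup A] [Module k A] [Coalgebra k A] [AddCommGroup B]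
            [Module k B] [Coalgebra k B] (Y : Bicomod k A B),
            ¬ (cotensorRightFunctor Y).IsRightAdjoint → Subsingleton (coHom Y).carrier := by
          intro A B _ _ _ _ _ _ Y hY
          rw [coHom, dif_neg hY]
          exact inferInstanceAs (Subsingleton PUnit)
        by_cases h1 : (cotensorRightFunctor q.L).IsRightAdjoint
        · have := hZ _ fun h2 => h ⟨h1, h2⟩
          have hL := Bicomod.subsingleton_of_iso j
          have := subsingleton_coHom q.L
          exact ⟨Bicomod.subsingleton_of_iso i, hL⟩
        · have := hZ _ h1
          have hX := Bicomod.subsingleton_of_iso i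
          have := Bicomod.subsingleton_cotensor_right q.U.P q.X
          have : Subsingleton q.UXV.carrier :=
            Bicomod.subsingleton_cotensor_left (q.U.P.cotensor q.X) q.V.P
          have := subsingleton_coHom q.UXV
          exact ⟨hX, Bicomod.subsingleton_of_iso j⟩
      obtain ⟨h1, h2⟩ := hzero
      have := Bicomod.subsingleton_cotensor_right q.U.P q.X
      have : Subsingleton q.UXV.carrier :=
        Bicomod.subsingleton_cotensor_left (q.U.P.cotensor q.X) q.V.P
      exact ⟨⟨.ofSubsingleton _ _⟩, ⟨.ofSubsingleton _ _⟩⟩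
  · rintro ⟨⟨a⟩, ⟨b⟩⟩
    -- `a` exhibits only `L` as the right adjoint side of a duality; `c` does this for `X`.
    obtain ⟨c⟩ := IsDual.exists_coDual ⟨b⟩
    exact ⟨a.quasifinite, a.injective, c.quasifinite, c.injective, a.nonempty_iso_coHom,
      b.nonempty_iso_coHom⟩

/-- The Frobenius functor of the second kind between categories of right comodules. -/
noncomputable def frobeniusRight (q : FourTuple k C D) (h : q.IsDual) :
    FrobeniusSecondKind k (RightComod k C) (RightComod k D) where
  F := cotensorRightFunctor q.X
  G := cotensorRightFunctor q.L
  α := cotensorRightFunctor q.U.P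
  β := cotensorRightFunctor q.V.P
  additive_F := inferInstance
  additive_G := inferInstance
  additive_α := inferInstance
  additive_β := inferInstance
  linear_F := inferInstance
  linear_G := inferInstance
  linear_α := inferInstance
  linear_β := inferInstance
  isEquivalence_α := q.U.isEquivalence
  isEquivalence_β := q.V.isEquivalence
  adj := h.1.map CoDual.adjunction
  adj' := h.2.map fun b => b.adjunction.ofNatIsoRight q.uxvIso

end FourTuple

/-- Bicomodules are recovered from their cotensor functors, and a strict context from its bicomodule
`P`, so remembering only `U.P` and `V.P` loses nothing. -/
theorem frobeniusRight_rel_iff {q q' : FourTuple k C D} (h : q.IsDual) (h' : q'.IsDual) :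
    FourTuple.setoid k C D q q' ↔ FrobeniusSecondKind.setoid k (RightComod k C) (RightComod k D)
      (q.frobeniusRight h) (q'.frobeniusRight h') := by
  constructor
  · rintro ⟨⟨a⟩, ⟨b⟩, ⟨c⟩, ⟨d⟩⟩
    exact ⟨⟨cotensorRightMapIso a⟩, ⟨cotensorRightMapIso b⟩, ⟨cotensorRightMapIso c.p⟩,
      ⟨cotensorRightMapIso d.p⟩⟩
  · rintro ⟨⟨a⟩, ⟨b⟩, ⟨c⟩, ⟨d⟩⟩
    obtain ⟨u⟩ := nonempty_iso_of_cotensorRightFunctor_iso c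
    obtain ⟨v⟩ := nonempty_iso_of_cotensorRightFunctor_iso d
    exact ⟨nonempty_iso_of_cotensorRightFunctor_iso a, nonempty_iso_of_cotensorRightFunctor_iso b,
      StrictContext.nonempty_iso u, StrictContext.nonempty_iso v⟩

/-- A linear equivalence has its inverse as adjoint on both sides, so it is a cotensor functor; its
bicomodule then completes to a context. -/
theorem exists_strictContext_iso (α : RightComod k C ⥤ RightComod k C) [α.Additive] [α.Linear k]
    [α.IsEquivalence] : ∃ S : StrictContext k C C, Nonempty (cotensorRightFunctor S.P ≅ α) := by
  let e := α.asEquivalence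
  have : e.functor.Additive := inferInstanceAs α.Additive
  have : e.functor.Linear k := inferInstanceAs (α.Linear k)
  obtain ⟨P, ⟨i⟩⟩ := exists_cotensorRightFunctor_iso (F := e.functor) (G := e.inverse)
    (H := e.inverse) e.toAdjunction e.symm.toAdjunction
  have : (cotensorRightFunctor P).IsEquivalence := Functor.isEquivalence_of_iso i
  obtain ⟨S, rfl⟩ := exists_strictContext_of_isEquivalence P
  exact ⟨S, ⟨i.symm⟩⟩

/-- `F` has the right adjoint `G` and the left adjoint `β ⋙ G ⋙ α`, while `G` has the left adjoint
`F` and the right adjoint `α ⋙ F ⋙ β`. The Eilenberg–Watts theorem makes both cotensor functors, and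
the two adjunctions become the dualities. -/
theorem exists_frobeniusRight_rel (S : FrobeniusSecondKind k (RightComod k C) (RightComod k D)) :
    ∃ (q : FourTuple k C D) (h : q.IsDual),
      FrobeniusSecondKind.setoid k _ _ (q.frobeniusRight h) S := by
  obtain ⟨F, G, α, β, _, _, _, _, _, _, _, _, _, _, ⟨adj⟩, ⟨adj'⟩⟩ := S
  obtain ⟨X, ⟨i⟩⟩ := exists_cotensorRightFunctor_iso adj (adjunctionOfEquivalences α β adj')
  obtain ⟨L, ⟨j⟩⟩ := exists_cotensorRightFunctor_iso adj' adj
  obtain ⟨U, ⟨a⟩⟩ := exists_strictContext_iso α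
  obtain ⟨V, ⟨b⟩⟩ := exists_strictContext_iso β
  let q : FourTuple k C D := ⟨X, L, U, V⟩
  have h : q.IsDual := ⟨nonempty_coDual_of_adjunction ((adj.ofNatIsoLeft i).ofNatIsoRight j),
    nonempty_coDual_of_adjunction ((adj'.ofNatIsoLeft j).ofNatIsoRight
      (q.uxvIso ≪≫ Functor.isoWhiskerRight a _ ≪≫ Functor.isoWhiskerLeft α
        (Functor.isoWhiskerRight i.symm _ ≪≫ Functor.isoWhiskerLeft F b)).symm)⟩
  exact ⟨q, h, ⟨i.symm⟩, ⟨j.symm⟩, ⟨a⟩, ⟨b⟩⟩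

end FourTuples

/-! ### Anti-isomorphisms of coalgebras and the coopposite coalgebra. -/

section Mirror

variable (k : Type u) [Field k]
variable (C : Type u) [AddCommGroup C] [Module k C] [Coalgebra k C]
variable (D : Type u) [AddCommGroup D] [Module k D] [Coalgebra k D]

/-- A linear isomorphism between coalgebras that reverses the comultiplication. -/
structure CoalgAntiEquiv extends C ≃ₗ[k] D where
  comul_apply : ∀ c : C, Coalgebra.comul (R := k) (toFun c) = TensorProduct.map
    toLinearEquiv.toLinearMap toLinearEquiv.toLinearMap
      (TensorProduct.comm k C C (Coalgebra.comul (R := k) c))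
  counit_apply : ∀ c : C, Coalgebra.counit (R := k) (toFun c) = Coalgebra.counit (R := k) c

variable {k C D}

/-- The underlying linear map. -/
def CoalgAntiEquiv.lin (σ : CoalgAntiEquiv k C D) : C →ₗ[k] D := σ.toLinearEquiv.toLinearMap

theorem CoalgAntiEquiv.comul_lin (σ : CoalgAntiEquiv k C D) (c : C) :
    Coalgebra.comul (R := k) (σ.lin c)
      = TensorProduct.map σ.lin σ.lin (TensorProduct.comm k C C (Coalgebra.comul (R := k) c)) :=
  σ.comul_apply c

theorem CoalgAntiEquiv.counit_lin (σ : CoalgAntiEquiv k C D) (c : C) :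
    Coalgebra.counit (R := k) (σ.lin c) = Coalgebra.counit (R := k) c :=
  σ.counit_apply c

/-- The inverse anti-isomorphism. -/
def CoalgAntiEquiv.symm (σ : CoalgAntiEquiv k C D) : CoalgAntiEquiv k D C where
  toLinearEquiv := σ.toLinearEquiv.symm
  comul_apply d := by
    obtain ⟨c, rfl⟩ := σ.toLinearEquiv.surjective d
    have h := σ.comul_apply c
    change Coalgebra.comul (R := k) (σ.toLinearEquiv.symm (σ.toLinearEquiv c)) = TensorProduct.map
      σ.toLinearEquiv.symm.toLinearMap σ.toLinearEquiv.symm.toLinearMap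
        (TensorProduct.comm k D D (Coalgebra.comul (R := k) (σ.toLinearEquiv c)))
    refine Eq.trans ?_ (congrArg (fun z => TensorProduct.map σ.toLinearEquiv.symm.toLinearMap
      σ.toLinearEquiv.symm.toLinearMap (TensorProduct.comm k D D z)) h).symm
    rw [LinearEquiv.symm_apply_apply]
    generalize Coalgebra.comul (R := k) c = y
    induction y with
    | zero => simp
    | add a b ha hb => simpa only [map_add] using congrArg₂ (· + ·) ha hb
    | tmul a b => simp
  counit_apply d := by
    obtain ⟨c, rfl⟩ := σ.toLinearEquiv.surjective d
    refine Eq.trans ?_ (σ.counit_apply c).symm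
    exact congrArg _ (σ.toLinearEquiv.symm_apply_apply c)

@[simp] theorem CoalgAntiEquiv.symm_lin_lin (σ : CoalgAntiEquiv k C D) (c : C) :
    σ.symm.lin (σ.lin c) = c := σ.toLinearEquiv.symm_apply_apply c

@[simp] theorem CoalgAntiEquiv.lin_symm_lin (σ : CoalgAntiEquiv k C D) (d : D) :
    σ.lin (σ.symm.lin d) = d := σ.toLinearEquiv.apply_symm_apply d

/-- The coopposite coalgebra. -/
def Coop (C : Type u) : Type u := C

instance : AddCommGroup (Coop C) := inferInstanceAs (AddCommGroup C)

instance : Module k (Coop C) := inferInstanceAs (Module k C)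

variable (k C) in
/-- The identity map to the coopposite coalgebra. -/
def Coop.equiv : C ≃ₗ[k] Coop C := LinearEquiv.refl k C

/-- The map `θ` reverses three tensor factors and carries one iterated comultiplication of `C` to
each side, so the claim is coassociativity of `C`. -/
theorem comul_comm_coassoc (c : C) :
    TensorProduct.assoc k C C C (LinearMap.rTensor C ((TensorProduct.comm k C C).toLinearMap ∘ₗ
      Coalgebra.comul) (TensorProduct.comm k C C (Coalgebra.comul (R := k) c)))
      = LinearMap.lTensor C ((TensorProduct.comm k C C).toLinearMap ∘ₗ
      Coalgebra.comul) (TensorProduct.comm k C C (Coalgebra.comul (R := k) c)) := by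
  let θ : C ⊗[k] (C ⊗[k] C) →ₗ[k] C ⊗[k] (C ⊗[k] C) :=
    (TensorProduct.assoc k C C C).toLinearMap ∘ₗ (TensorProduct.comm k C C).toLinearMap.rTensor C ∘ₗ
      (TensorProduct.comm k C (C ⊗[k] C)).toLinearMap
  have h1 : ∀ z : C ⊗[k] C, TensorProduct.assoc k C C C (LinearMap.rTensor C
      ((TensorProduct.comm k C C).toLinearMap ∘ₗ Coalgebra.comul) (TensorProduct.comm k C C z))
      = θ ((Coalgebra.comul (R := k)).lTensor C z) := by
    intro z
    induction z with
    | zero => simp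
    | add a b ha hb => simp only [map_add, ha, hb]
    | tmul a b => simp [θ]
  have h2 : ∀ z : C ⊗[k] C, LinearMap.lTensor C
      ((TensorProduct.comm k C C).toLinearMap ∘ₗ Coalgebra.comul) (TensorProduct.comm k C C z)
      = θ (TensorProduct.assoc k C C C ((Coalgebra.comul (R := k)).rTensor C z)) := by
    intro z
    induction z with
    | zero => simp
    | add a b ha hb => simp only [map_add, ha, hb]
    | tmul a b =>
      simp only [TensorProduct.comm_tmul, LinearMap.lTensor_tmul, LinearMap.rTensor_tmul,
        LinearMap.comp_apply, LinearEquiv.coe_coe]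
      generalize Coalgebra.comul (R := k) a = y
      induction y with
      | zero => simp
      | add a b ha hb => simp only [TensorProduct.add_tmul, TensorProduct.tmul_add, map_add, ha, hb]
      | tmul a b => simp [θ]
  rw [h1, h2, Coalgebra.coassoc_apply]

instance : Coalgebra k (Coop C) where
  comul := ((TensorProduct.comm k C C).toLinearMap ∘ₗ Coalgebra.comul : C →ₗ[k] C ⊗[k] C)
  counit := (Coalgebra.counit : C →ₗ[k] k)
  coassoc := LinearMap.ext fun c : C => comul_comm_coassoc (k := k) (C := C) c
  rTensor_counit_comp_comul := by
    have h : ∀ z : C ⊗[k] C, (Coalgebra.counit (R := k) (A := C)).rTensor C (TensorProduct.comm k C C z)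
        = TensorProduct.comm k C k ((Coalgebra.counit (R := k) (A := C)).lTensor C z) := by
      intro z
      induction z with
      | zero => simp
      | add a b ha hb => simp only [map_add, ha, hb]
      | tmul a b => simp
    exact LinearMap.ext fun c : C => (h _).trans (by rw [Coalgebra.lTensor_counit_comul]; rfl)
  lTensor_counit_comp_comul := by
    have h : ∀ z : C ⊗[k] C, (Coalgebra.counit (R := k) (A := C)).lTensor C (TensorProduct.comm k C C z)
        = TensorProduct.comm k k C ((Coalgebra.counit (R := k) (A := C)).rTensor C z) := by
      intro z
      induction z with
      | zero => simp
      | add a b ha hb => simp only [map_add, ha, hb]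
      | tmul a b => simp
    exact LinearMap.ext fun c : C => (h _).trans (by rw [Coalgebra.rTensor_counit_comul]; rfl)

variable (k C) in
/-- The identity map to the coopposite coalgebra, as an anti-isomorphism. -/
def Coop.antiEquiv : CoalgAntiEquiv k C (Coop C) where
  toLinearEquiv := Coop.equiv k C
  comul_apply c := (LinearMap.congr_fun (TensorProduct.map_id (R := k) (M := C) (N := C))
    (TensorProduct.comm k C C (Coalgebra.comul (R := k) c))).symm
  counit_apply _ := rfl

end Mirror

/-! ### Coactions and cotensor products under an anti-isomorphism. -/

section MirrorCoactions

variable {k : Type u} [Field k]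
variable {C C' : Type u} [AddCommGroup C] [Module k C] [Coalgebra k C]
  [AddCommGroup C'] [Module k C'] [Coalgebra k C']
variable {D D' : Type u} [AddCommGroup D] [Module k D] [Coalgebra k D]
  [AddCommGroup D'] [Module k D'] [Coalgebra k D']
variable {M N : Type u} [AddCommGroup M] [Module k M] [AddCommGroup N] [Module k N]

variable (M) in
/-- The map `c ⊗ m ↦ m ⊗ σ c`. -/
noncomputable def flipLeft (σ : CoalgAntiEquiv k C C') : C ⊗[k] M →ₗ[k] M ⊗[k] C' :=
  (TensorProduct.comm k C' M).toLinearMap ∘ₗ σ.lin.rTensor M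

variable (M) in
/-- The map `m ⊗ c ↦ σ c ⊗ m`. -/
noncomputable def flipRight (σ : CoalgAntiEquiv k C C') : M ⊗[k] C →ₗ[k] C' ⊗[k] M :=
  (TensorProduct.comm k M C').toLinearMap ∘ₗ σ.lin.lTensor M

@[simp] theorem flipLeft_tmul (σ : CoalgAntiEquiv k C C') (c : C) (m : M) :
    flipLeft M σ (c ⊗ₜ m) = m ⊗ₜ σ.lin c := by
  simp [flipLeft]

@[simp] theorem flipRight_tmul (σ : CoalgAntiEquiv k C C') (c : C) (m : M) :
    flipRight M σ (m ⊗ₜ c) = σ.lin c ⊗ₜ m := by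
  simp [flipRight]

@[simp] theorem flipRight_symm_flipLeft (σ : CoalgAntiEquiv k C C') (z : C ⊗[k] M) :
    flipRight M σ.symm (flipLeft M σ z) = z := by
  have : flipRight M σ.symm ∘ₗ flipLeft M σ = LinearMap.id := by
    ext; simp
  exact LinearMap.congr_fun this z

@[simp] theorem flipLeft_symm_flipRight (σ : CoalgAntiEquiv k C C') (z : M ⊗[k] C) :
    flipLeft M σ.symm (flipRight M σ z) = z := by
  have : flipLeft M σ.symm ∘ₗ flipRight M σ = LinearMap.id := by
    ext; simp
  exact LinearMap.congr_fun this z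

@[simp] theorem flipLeft_flipRight_symm (σ : CoalgAntiEquiv k C C') (z : M ⊗[k] C') :
    flipLeft M σ (flipRight M σ.symm z) = z := by
  have : flipLeft M σ ∘ₗ flipRight M σ.symm = LinearMap.id := by
    ext; simp
  exact LinearMap.congr_fun this z

theorem flipLeft_injective (σ : CoalgAntiEquiv k C C') : Function.Injective (flipLeft M σ) :=
  Function.LeftInverse.injective (flipRight_symm_flipLeft σ)

theorem flipRight_injective (σ : CoalgAntiEquiv k C C') : Function.Injective (flipRight M σ) :=
  Function.LeftInverse.injective (flipLeft_symm_flipRight σ)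

theorem flipLeft_lTensor (σ : CoalgAntiEquiv k C C') (f : M →ₗ[k] N) (z : C ⊗[k] M) :
    flipLeft N σ (f.lTensor C z) = f.rTensor C' (flipLeft M σ z) := by
  have : flipLeft N σ ∘ₗ f.lTensor C = f.rTensor C' ∘ₗ flipLeft M σ := by
    ext; simp
  exact LinearMap.congr_fun this z

theorem flipRight_rTensor (σ : CoalgAntiEquiv k C C') (f : M →ₗ[k] N) (z : M ⊗[k] C) :
    flipRight N σ (f.rTensor C z) = f.lTensor C' (flipRight M σ z) := by
  have : flipRight N σ ∘ₗ f.rTensor C = f.lTensor C' ∘ₗ flipRight M σ := by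
    ext; simp
  exact LinearMap.congr_fun this z

/-- `θ` reverses three tensor factors and applies `σ` to those in `C`. As `σ` reverses the
comultiplication, `θ` carries each side of the left axiom to a side of the right one. The other flip
lemmas and `comm_mem_cotensor` use the same device. -/
theorem IsLeftCoaction.flip (σ : CoalgAntiEquiv k C C') {l : M →ₗ[k] C ⊗[k] M}
    (h : IsLeftCoaction l) : IsRightCoaction (flipLeft M σ ∘ₗ l) := by
  let θ : C ⊗[k] (C ⊗[k] M) →ₗ[k] M ⊗[k] (C' ⊗[k] C') :=
    (TensorProduct.assoc k M C' C').toLinearMap ∘ₗ (flipLeft M σ).rTensor C' ∘ₗ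
      flipLeft (C ⊗[k] M) σ
  have h1 : ∀ z : C ⊗[k] M, TensorProduct.assoc k M C' C'
      ((flipLeft M σ ∘ₗ l).rTensor C' (flipLeft M σ z)) = θ (l.lTensor C z) := by
    intro z
    simp only [θ, LinearMap.comp_apply, LinearEquiv.coe_coe, flipLeft_lTensor,
      LinearMap.rTensor_comp_apply]
  have h2 : ∀ z : C ⊗[k] M, (Coalgebra.comul (R := k) (A := C')).lTensor M (flipLeft M σ z)
      = θ (TensorProduct.assoc k C C M ((Coalgebra.comul (R := k) (A := C)).rTensor M z)) := by
    intro z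
    induction z with
    | zero => simp
    | add a b ha hb => simp only [map_add, ha, hb]
    | tmul c m =>
      simp only [flipLeft_tmul, LinearMap.lTensor_tmul, LinearMap.rTensor_tmul, σ.comul_lin]
      generalize Coalgebra.comul (R := k) c = y
      induction y with
      | zero => simp
      | add a b ha hb => simp only [TensorProduct.add_tmul, TensorProduct.tmul_add, map_add, ha, hb]
      | tmul a b => simp [θ]
  have h3 : ∀ z : C ⊗[k] M, (Coalgebra.counit (R := k) (A := C')).lTensor M (flipLeft M σ z)
      = TensorProduct.comm k k M ((Coalgebra.counit (R := k) (A := C)).rTensor M z) := by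
    intro z
    induction z with
    | zero => simp
    | add a b ha hb => simp only [map_add, ha, hb]
    | tmul c m => simp [σ.counit_lin]
  constructor
  · refine LinearMap.ext fun m => (h1 _).trans (Eq.trans ?_ (h2 _).symm)
    exact congrArg θ (LinearMap.congr_fun h.coassoc m).symm
  · refine LinearMap.ext fun m => (h3 _).trans ?_
    exact congrArg (TensorProduct.comm k k M) (LinearMap.congr_fun h.counit m)

theorem IsRightCoaction.flip (σ : CoalgAntiEquiv k C C') {r : M →ₗ[k] M ⊗[k] C}
    (h : IsRightCoaction r) : IsLeftCoaction (flipRight M σ ∘ₗ r) := by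
  let θ : (M ⊗[k] C) ⊗[k] C →ₗ[k] C' ⊗[k] (C' ⊗[k] M) :=
    (flipRight M σ).lTensor C' ∘ₗ flipRight (M ⊗[k] C) σ
  have h1 : ∀ z : M ⊗[k] C, (flipRight M σ ∘ₗ r).lTensor C' (flipRight M σ z)
      = θ (r.rTensor C z) := by
    intro z
    simp only [θ, LinearMap.comp_apply, flipRight_rTensor, LinearMap.lTensor_comp_apply]
  have h2 : ∀ z : M ⊗[k] C, TensorProduct.assoc k C' C' M
      ((Coalgebra.comul (R := k) (A := C')).rTensor M (flipRight M σ z))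
      = θ ((TensorProduct.assoc k M C C).symm ((Coalgebra.comul (R := k) (A := C)).lTensor M z)) := by
    intro z
    induction z with
    | zero => simp
    | add a b ha hb => simp only [map_add, ha, hb]
    | tmul m c =>
      simp only [flipRight_tmul, LinearMap.lTensor_tmul, LinearMap.rTensor_tmul, σ.comul_lin]
      generalize Coalgebra.comul (R := k) c = y
      induction y with
      | zero => simp
      | add a b ha hb => simp only [TensorProduct.add_tmul, TensorProduct.tmul_add, map_add, ha, hb]
      | tmul a b => simp [θ]
  have h3 : ∀ z : M ⊗[k] C, (Coalgebra.counit (R := k) (A := C')).rTensor M (flipRight M σ z)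
      = TensorProduct.comm k M k ((Coalgebra.counit (R := k) (A := C)).lTensor M z) := by
    intro z
    induction z with
    | zero => simp
    | add a b ha hb => simp only [map_add, ha, hb]
    | tmul m c => simp [σ.counit_lin]
  constructor
  · refine LinearMap.ext fun m => (h2 _).trans (Eq.trans ?_ (h1 _).symm)
    exact congrArg θ ((LinearEquiv.symm_apply_eq _).2 (LinearMap.congr_fun h.coassoc m).symm)
  · refine LinearMap.ext fun m => (h3 _).trans ?_
    exact congrArg (TensorProduct.comm k M k) (LinearMap.congr_fun h.counit m)

theorem CoactionsCommute.flip (σ : CoalgAntiEquiv k C C') (τ : CoalgAntiEquiv k D D')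
    {l : M →ₗ[k] C ⊗[k] M} {r : M →ₗ[k] M ⊗[k] D} (h : CoactionsCommute l r) :
    CoactionsCommute (flipRight M τ ∘ₗ r) (flipLeft M σ ∘ₗ l) := by
  let θ : C ⊗[k] (M ⊗[k] D) →ₗ[k] D' ⊗[k] (M ⊗[k] C') :=
    (TensorProduct.assoc k D' M C').toLinearMap ∘ₗ (flipRight M τ).rTensor C' ∘ₗ
      flipLeft (M ⊗[k] D) σ
  have h1 : ∀ z : C ⊗[k] M, TensorProduct.assoc k D' M C'
      ((flipRight M τ ∘ₗ r).rTensor C' (flipLeft M σ z)) = θ (r.lTensor C z) := by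
    intro z
    simp only [θ, LinearMap.comp_apply, LinearEquiv.coe_coe, flipLeft_lTensor,
      LinearMap.rTensor_comp_apply]
  have h2 : ∀ z : M ⊗[k] D, (flipLeft M σ ∘ₗ l).lTensor D' (flipRight M τ z)
      = θ (TensorProduct.assoc k C M D (l.rTensor D z)) := by
    intro z
    induction z with
    | zero => simp
    | add a b ha hb => simp only [map_add, ha, hb]
    | tmul m d =>
      simp only [flipRight_tmul, LinearMap.lTensor_tmul, LinearMap.rTensor_tmul, LinearMap.comp_apply]
      generalize l m = y
      induction y with
      | zero => simp
      | add a b ha hb => simp only [TensorProduct.add_tmul, TensorProduct.tmul_add, map_add, ha, hb]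
      | tmul a b => simp [θ]
  refine LinearMap.ext fun m => (h1 _).trans (Eq.trans ?_ (h2 _).symm)
  exact congrArg θ (LinearMap.congr_fun h m).symm

theorem comm_mem_cotensor (σ : CoalgAntiEquiv k C C') {r : M →ₗ[k] M ⊗[k] C}
    {l : N →ₗ[k] C ⊗[k] N} {z : M ⊗[k] N} (hz : z ∈ cotensor r l) :
    TensorProduct.comm k M N z ∈ cotensor (flipLeft N σ ∘ₗ l) (flipRight M σ ∘ₗ r) := by
  let θ : M ⊗[k] (C ⊗[k] N) →ₗ[k] N ⊗[k] (C' ⊗[k] M) :=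
    (TensorProduct.assoc k N C' M).toLinearMap ∘ₗ (flipLeft N σ).rTensor M ∘ₗ
      (TensorProduct.comm k M (C ⊗[k] N)).toLinearMap
  have h1 : ∀ z : M ⊗[k] N, TensorProduct.assoc k N C' M
      ((flipLeft N σ ∘ₗ l).rTensor M (TensorProduct.comm k M N z)) = θ (l.lTensor M z) := by
    intro z
    induction z with
    | zero => simp
    | add a b ha hb => simp only [map_add, ha, hb]
    | tmul m n => simp [θ]
  have h2 : ∀ z : M ⊗[k] N, (flipRight M σ ∘ₗ r).lTensor N (TensorProduct.comm k M N z)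
      = θ (TensorProduct.assoc k M C N (r.rTensor N z)) := by
    intro z
    induction z with
    | zero => simp
    | add a b ha hb => simp only [map_add, ha, hb]
    | tmul m n =>
      simp only [TensorProduct.comm_tmul, LinearMap.lTensor_tmul, LinearMap.rTensor_tmul,
        LinearMap.comp_apply]
      generalize r m = y
      induction y with
      | zero => simp
      | add a b ha hb => simp only [TensorProduct.add_tmul, TensorProduct.tmul_add, map_add, ha, hb]
      | tmul a b => simp [θ]
  rw [mem_cotensor, h1, h2, mem_cotensor.1 hz]

theorem flipRight_symm_comp (σ : CoalgAntiEquiv k C C') (l : M →ₗ[k] C ⊗[k] M) :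
    flipRight M σ.symm ∘ₗ flipLeft M σ ∘ₗ l = l :=
  LinearMap.ext fun _ => flipRight_symm_flipLeft σ _

theorem flipLeft_symm_comp (σ : CoalgAntiEquiv k C C') (r : M →ₗ[k] M ⊗[k] C) :
    flipLeft M σ.symm ∘ₗ flipRight M σ ∘ₗ r = r :=
  LinearMap.ext fun _ => flipLeft_symm_flipRight σ _

/-- The flip `M □ N → N □ M`. -/
noncomputable def cotensorComm (σ : CoalgAntiEquiv k C C') (r : M →ₗ[k] M ⊗[k] C)
    (l : N →ₗ[k] C ⊗[k] N) :
    cotensor r l →ₗ[k] cotensor (flipLeft N σ ∘ₗ l) (flipRight M σ ∘ₗ r) :=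
  ((TensorProduct.comm k M N).toLinearMap ∘ₗ (cotensor r l).subtype).codRestrict _
    fun z => comm_mem_cotensor σ z.2

theorem cotensorComm_bijective (σ : CoalgAntiEquiv k C C') (r : M →ₗ[k] M ⊗[k] C)
    (l : N →ₗ[k] C ⊗[k] N) : Function.Bijective (cotensorComm σ r l) := by
  refine ⟨fun x y h => Subtype.ext ((TensorProduct.comm k M N).injective (congrArg Subtype.val h)),
    fun z => ?_⟩
  have h := comm_mem_cotensor σ.symm z.2
  rw [flipLeft_symm_comp, flipRight_symm_comp] at h
  exact ⟨⟨_, h⟩, Subtype.ext ((TensorProduct.comm k N M).symm_apply_apply z.1)⟩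

theorem leftColinear_codRestrict {A : Type u} [AddCommGroup A] [Module k A]
    {r : M →ₗ[k] M ⊗[k] D} (l : N →ₗ[k] D ⊗[k] N)
    {q : M →ₗ[k] C ⊗[k] M} (t : A →ₗ[k] C ⊗[k] A) (h : CoactionsCommute q r) (g : A →ₗ[k] M ⊗[k] N)
    (hg : ∀ a, g a ∈ cotensor r l) (hc : ∀ a, g.lTensor C (t a) = tensorLeft N q (g a)) :
    (g.codRestrict (cotensor r l) hg).lTensor C ∘ₗ t
      = cotensorLeftCoaction l h ∘ₗ g.codRestrict (cotensor r l) hg := by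
  refine LinearMap.ext fun a => Module.Flat.lTensor_preserves_injective_linearMap (M := C) _
    (Submodule.injective_subtype (cotensor r l)) ?_
  refine (LinearMap.lTensor_comp_apply ..).symm.trans ((hc a).trans ?_)
  exact (LinearMap.congr_fun (cotensorLeftCoaction_spec l h) ⟨g a, hg a⟩).symm

theorem cotensorComm_rightColinear (σ : CoalgAntiEquiv k C C') (τ : CoalgAntiEquiv k D D')
    {r : M →ₗ[k] M ⊗[k] D} (l : N →ₗ[k] D ⊗[k] N) {q : M →ₗ[k] C ⊗[k] M}
    (h : CoactionsCommute q r) :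
    (cotensorComm τ r l).rTensor C' ∘ₗ (flipLeft _ σ ∘ₗ cotensorLeftCoaction l h)
      = cotensorRightCoaction (flipLeft N τ ∘ₗ l) (h.flip σ τ) ∘ₗ cotensorComm τ r l := by
  refine rightColinear_codRestrict _ _ (h.flip σ τ) _ _ fun a => ?_
  have e := LinearMap.congr_fun (cotensorLeftCoaction_spec l h) a
  simp only [LinearMap.comp_apply] at e ⊢
  rw [← flipLeft_lTensor, LinearMap.lTensor_comp_apply, e]
  change flipLeft _ σ ((TensorProduct.comm k M N).toLinearMap.lTensor C (tensorLeft N q a.1)) =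
    tensorRight N (flipLeft M σ ∘ₗ q) (TensorProduct.comm k M N a.1)
  generalize a.1 = y
  induction y with
  | zero => simp
  | add a b ha hb => simp only [map_add, ha, hb]
  | tmul m n =>
    simp only [tensorLeft, tensorRight, LinearMap.comp_apply, LinearMap.rTensor_tmul,
      LinearEquiv.coe_coe, TensorProduct.comm_tmul, LinearMap.lTensor_tmul]
    generalize q m = y
    induction y with
    | zero => simp
    | add a b ha hb => simp only [TensorProduct.add_tmul, TensorProduct.tmul_add, map_add, ha, hb]
    | tmul a b => simp

theorem cotensorComm_leftColinear (σ : CoalgAntiEquiv k C C') (τ : CoalgAntiEquiv k D D')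
    (r : M →ₗ[k] M ⊗[k] C) {l : N →ₗ[k] C ⊗[k] N} {s : N →ₗ[k] N ⊗[k] D}
    (h : CoactionsCommute l s) :
    (cotensorComm σ r l).lTensor D' ∘ₗ (flipRight _ τ ∘ₗ cotensorRightCoaction r h)
      = cotensorLeftCoaction (flipRight M σ ∘ₗ r) (h.flip σ τ) ∘ₗ cotensorComm σ r l := by
  refine leftColinear_codRestrict _ _ (h.flip σ τ) _ _ fun a => ?_
  have e := LinearMap.congr_fun (cotensorRightCoaction_spec r h) a
  simp only [LinearMap.comp_apply] at e ⊢
  rw [← flipRight_rTensor, LinearMap.rTensor_comp_apply, e]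
  change flipRight _ τ ((TensorProduct.comm k M N).toLinearMap.rTensor D (tensorRight M s a.1)) =
    tensorLeft M (flipRight N τ ∘ₗ s) (TensorProduct.comm k M N a.1)
  generalize a.1 = y
  induction y with
  | zero => simp
  | add a b ha hb => simp only [map_add, ha, hb]
  | tmul m n =>
    simp only [tensorLeft, tensorRight, LinearMap.comp_apply, LinearMap.rTensor_tmul,
      LinearEquiv.coe_coe, TensorProduct.comm_tmul, LinearMap.lTensor_tmul]
    generalize s n = y
    induction y with
    | zero => simp
    | add a b ha hb => simp only [TensorProduct.add_tmul, TensorProduct.tmul_add, map_add, ha, hb]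
    | tmul a b => simp

end MirrorCoactions

/-! ### Mirroring comodules, bicomodules and dualities. -/

section MirrorCategories

variable {k : Type u} [Field k]
variable {C C' : Type u} [AddCommGroup C] [Module k C] [Coalgebra k C]
  [AddCommGroup C'] [Module k C'] [Coalgebra k C']
variable {D D' : Type u} [AddCommGroup D] [Module k D] [Coalgebra k D]
  [AddCommGroup D'] [Module k D'] [Coalgebra k D']
variable {E E' : Type u} [AddCommGroup E] [Module k E] [Coalgebra k E]
  [AddCommGroup E'] [Module k E'] [Coalgebra k E']

/-- Left comodules as right comodules over an anti-isomorphic coalgebra. -/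
noncomputable def LeftComod.mirrorObj (σ : CoalgAntiEquiv k C C') (M : LeftComod k C) :
    RightComod k C' where
  carrier := M.carrier
  coact := flipLeft M.carrier σ ∘ₗ M.coact
  isCoaction := M.isCoaction.flip σ

/-- `flipLeft` is natural and injective. This makes `LeftComod.mirror` full, and lets bicolinear
maps be mirrored and unmirrored. -/
theorem flipLeft_colinear (σ : CoalgAntiEquiv k C C') {M N : Type u} [AddCommGroup M] [Module k M]
    [AddCommGroup N] [Module k N] {l : M →ₗ[k] C ⊗[k] M} {l' : N →ₗ[k] C ⊗[k] N} {f : M →ₗ[k] N} :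
    f.rTensor C' ∘ₗ flipLeft M σ ∘ₗ l = (flipLeft N σ ∘ₗ l') ∘ₗ f ↔ f.lTensor C ∘ₗ l = l' ∘ₗ f := by
  have h : f.rTensor C' ∘ₗ flipLeft M σ ∘ₗ l = flipLeft N σ ∘ₗ f.lTensor C ∘ₗ l :=
    LinearMap.ext fun m => (flipLeft_lTensor σ f (l m)).symm
  rw [h, LinearMap.comp_assoc]
  refine ⟨fun e => LinearMap.ext fun m => flipLeft_injective σ (LinearMap.congr_fun e m), fun e => ?_⟩
  rw [e]

theorem flipRight_colinear (σ : CoalgAntiEquiv k C C') {M N : Type u} [AddCommGroup M] [Module k M]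
    [AddCommGroup N] [Module k N] {r : M →ₗ[k] M ⊗[k] C} {r' : N →ₗ[k] N ⊗[k] C} {f : M →ₗ[k] N} :
    f.lTensor C' ∘ₗ flipRight M σ ∘ₗ r = (flipRight N σ ∘ₗ r') ∘ₗ f ↔ f.rTensor C ∘ₗ r = r' ∘ₗ f := by
  have h : f.lTensor C' ∘ₗ flipRight M σ ∘ₗ r = flipRight N σ ∘ₗ f.rTensor C ∘ₗ r :=
    LinearMap.ext fun m => (flipRight_rTensor σ f (r m)).symm
  rw [h, LinearMap.comp_assoc]
  refine ⟨fun e => LinearMap.ext fun m => flipRight_injective σ (LinearMap.congr_fun e m), fun e => ?_⟩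
  rw [e]

/-- Left comodules as right comodules over an anti-isomorphic coalgebra. -/
noncomputable def LeftComod.mirror (σ : CoalgAntiEquiv k C C') :
    LeftComod k C ⥤ RightComod k C' where
  obj M := M.mirrorObj σ
  map f := ⟨f.1, (flipLeft_colinear σ).2 f.2⟩

instance (σ : CoalgAntiEquiv k C C') : (LeftComod.mirror σ).Additive where

instance (σ : CoalgAntiEquiv k C C') : (LeftComod.mirror σ).Linear k where

instance (σ : CoalgAntiEquiv k C C') : (LeftComod.mirror σ).Faithful where
  map_injective {M N f g} h := by
    have e : ((LeftComod.mirror σ).map f).1 = ((LeftComod.mirror σ).map g).1 := congrArg Subtype.val h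
    exact Subtype.ext e

instance (σ : CoalgAntiEquiv k C C') : (LeftComod.mirror σ).Full where
  map_surjective f := ⟨⟨f.1, (flipLeft_colinear σ).1 f.2⟩, rfl⟩

instance (σ : CoalgAntiEquiv k C C') : (LeftComod.mirror σ).EssSurj where
  mem_essImage N := by
    let M : LeftComod k C := ⟨N.carrier, flipRight N.carrier σ.symm ∘ₗ N.coact,
      N.isCoaction.flip σ.symm⟩
    refine ⟨M, ⟨RightComod.isoOfBijective ⟨LinearMap.id, ?_⟩ Function.bijective_id⟩⟩
    change LinearMap.rTensor C' LinearMap.id ∘ₗ (flipLeft N.carrier σ ∘ₗ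
      flipRight N.carrier σ.symm ∘ₗ N.coact) = N.coact ∘ₗ LinearMap.id
    refine LinearMap.ext fun n => ?_
    simp

instance (σ : CoalgAntiEquiv k C C') : (LeftComod.mirror σ).IsEquivalence where

/-- The bicomodule over anti-isomorphic coalgebras, with the two sides exchanged. -/
noncomputable def Bicomod.mirror (σ : CoalgAntiEquiv k C C') (τ : CoalgAntiEquiv k D D')
    (X : Bicomod k C D) : Bicomod k D' C' where
  carrier := X.carrier
  coactLeft := flipRight X.carrier τ ∘ₗ X.coactRight
  coactRight := flipLeft X.carrier σ ∘ₗ X.coactLeft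
  isLeftCoaction := X.isRightCoaction.flip τ
  isRightCoaction := X.isLeftCoaction.flip σ
  commute := X.commute.flip σ τ

/-- Mirrored maps. -/
noncomputable def Bicomod.mirrorMap (σ : CoalgAntiEquiv k C C') (τ : CoalgAntiEquiv k D D')
    {X Y : Bicomod k C D} (f : X ⟶ Y) : X.mirror σ τ ⟶ Y.mirror σ τ :=
  ⟨f.1, (flipRight_colinear τ).2 f.2.2, (flipLeft_colinear σ).2 f.2.1⟩

/-- Mirrored isomorphisms. -/
noncomputable def Bicomod.mirrorIso (σ : CoalgAntiEquiv k C C') (τ : CoalgAntiEquiv k D D')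
    {X Y : Bicomod k C D} (i : X ≅ Y) : X.mirror σ τ ≅ Y.mirror σ τ :=
  Bicomod.isoOfBijective (Bicomod.mirrorMap σ τ i.hom) (Bicomod.bijective_of_iso i)

/-- Isomorphisms of mirrored bicomodules are mirrored. -/
noncomputable def Bicomod.isoOfMirror (σ : CoalgAntiEquiv k C C') (τ : CoalgAntiEquiv k D D')
    {X Y : Bicomod k C D} (i : X.mirror σ τ ≅ Y.mirror σ τ) : X ≅ Y :=
  Bicomod.isoOfBijective ⟨i.hom.1, (flipLeft_colinear σ).1 i.hom.2.2,
    (flipRight_colinear τ).1 i.hom.2.1⟩ (Bicomod.bijective_of_iso i)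

/-- Mirroring twice. -/
noncomputable def Bicomod.mirrorMirror (σ : CoalgAntiEquiv k C C') (τ : CoalgAntiEquiv k D D')
    (X : Bicomod k C D) : (X.mirror σ τ).mirror τ.symm σ.symm ≅ X :=
  Bicomod.isoOfBijective ⟨LinearMap.id, by
    change LinearMap.lTensor C LinearMap.id ∘ₗ (flipRight X.carrier σ.symm ∘ₗ flipLeft X.carrier σ ∘ₗ
      X.coactLeft) = X.coactLeft ∘ₗ LinearMap.id
    refine LinearMap.ext fun n => ?_
    simp, by
    change LinearMap.rTensor D LinearMap.id ∘ₗ (flipLeft X.carrier τ.symm ∘ₗ flipRight X.carrier τ ∘ₗ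
      X.coactRight) = X.coactRight ∘ₗ LinearMap.id
    refine LinearMap.ext fun n => ?_
    simp⟩ Function.bijective_id

theorem Bicomod.exists_mirror_iso (σ : CoalgAntiEquiv k C C') (τ : CoalgAntiEquiv k D D')
    (Y : Bicomod k D' C') : ∃ X : Bicomod k C D, Nonempty (X.mirror σ τ ≅ Y) := by
  refine ⟨Y.mirror τ.symm σ.symm, ⟨Bicomod.mirrorMirror τ.symm σ.symm Y⟩⟩

set_option maxHeartbeats 2000000 in
theorem Bicomod.mirrorCotensor_right (σ : CoalgAntiEquiv k C C') (τ : CoalgAntiEquiv k D D')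
    (ρ : CoalgAntiEquiv k E E') (X : Bicomod k C D) (Y : Bicomod k D E) :
    (cotensorComm τ X.coactRight Y.coactLeft).rTensor C' ∘ₗ ((X.cotensor Y).mirror σ ρ).coactRight
      = ((Y.mirror τ ρ).cotensor (X.mirror σ τ)).coactRight ∘ₗ
        cotensorComm τ X.coactRight Y.coactLeft := by
  refine LinearMap.ext fun z => ?_
  exact LinearMap.congr_fun (cotensorComm_rightColinear σ τ Y.coactLeft X.commute) z

set_option maxHeartbeats 2000000 in
theorem Bicomod.mirrorCotensor_left (σ : CoalgAntiEquiv k C C') (τ : CoalgAntiEquiv k D D')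
    (ρ : CoalgAntiEquiv k E E') (X : Bicomod k C D) (Y : Bicomod k D E) :
    (cotensorComm τ X.coactRight Y.coactLeft).lTensor E' ∘ₗ ((X.cotensor Y).mirror σ ρ).coactLeft
      = ((Y.mirror τ ρ).cotensor (X.mirror σ τ)).coactLeft ∘ₗ
        cotensorComm τ X.coactRight Y.coactLeft := by
  refine LinearMap.ext fun z => ?_
  exact LinearMap.congr_fun (cotensorComm_leftColinear τ ρ X.coactRight Y.commute) z

set_option maxHeartbeats 2000000 in
/-- The flip, as a map of bicomodules. -/
noncomputable def Bicomod.mirrorCotensorHom (σ : CoalgAntiEquiv k C C') (τ : CoalgAntiEquiv k D D')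
    (ρ : CoalgAntiEquiv k E E') (X : Bicomod k C D) (Y : Bicomod k D E) :
    (X.cotensor Y).mirror σ ρ ⟶ (Y.mirror τ ρ).cotensor (X.mirror σ τ) :=
  ⟨cotensorComm τ X.coactRight Y.coactLeft, Bicomod.mirrorCotensor_left σ τ ρ X Y,
    Bicomod.mirrorCotensor_right σ τ ρ X Y⟩

/-- The mirror of a cotensor product. -/
noncomputable def Bicomod.mirrorCotensor (σ : CoalgAntiEquiv k C C') (τ : CoalgAntiEquiv k D D')
    (ρ : CoalgAntiEquiv k E E') (X : Bicomod k C D) (Y : Bicomod k D E) :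
    (X.cotensor Y).mirror σ ρ ≅ (Y.mirror τ ρ).cotensor (X.mirror σ τ) :=
  Bicomod.isoOfBijective (Bicomod.mirrorCotensorHom σ τ ρ X Y)
    (cotensorComm_bijective τ X.coactRight Y.coactLeft)

theorem lTensor_flipRight_comul (σ : CoalgAntiEquiv k C C') (c : C) :
    LinearMap.lTensor C' σ.lin (flipRight C σ (Coalgebra.comul (R := k) c))
      = Coalgebra.comul (R := k) (σ.lin c) := by
  rw [σ.comul_lin]
  generalize Coalgebra.comul (R := k) c = y
  induction y with
  | zero => simp
  | add a b ha hb => simp only [map_add, ha, hb]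
  | tmul a b => simp

theorem rTensor_flipLeft_comul (σ : CoalgAntiEquiv k C C') (c : C) :
    LinearMap.rTensor C' σ.lin (flipLeft C σ (Coalgebra.comul (R := k) c))
      = Coalgebra.comul (R := k) (σ.lin c) := by
  rw [σ.comul_lin]
  generalize Coalgebra.comul (R := k) c = y
  induction y with
  | zero => simp
  | add a b ha hb => simp only [map_add, ha, hb]
  | tmul a b => simp

/-- The mirror of the regular bicomodule. -/
noncomputable def Bicomod.mirrorRegular (σ : CoalgAntiEquiv k C C') :
    (Bicomod.regular k C).mirror σ σ ≅ Bicomod.regular k C' :=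
  Bicomod.isoOfBijective ⟨σ.lin, LinearMap.ext fun c => lTensor_flipRight_comul σ c,
    LinearMap.ext fun c => rTensor_flipLeft_comul σ c⟩ σ.toLinearEquiv.bijective

/-- The mirror of the functor `X □ -` is the functor `- □ X` for the mirrored bicomodule. -/
noncomputable def cotensorLeftMirrorIso (σ : CoalgAntiEquiv k C C') (τ : CoalgAntiEquiv k D D')
    (X : Bicomod k C D) : cotensorLeftFunctor X ⋙ LeftComod.mirror σ ≅
      LeftComod.mirror τ ⋙ cotensorRightFunctor (X.mirror σ τ) :=
  NatIso.ofComponents (fun M => RightComod.isoOfBijective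
    ⟨cotensorComm τ X.coactRight M.coact, cotensorComm_rightColinear σ τ M.coact X.commute⟩
    (cotensorComm_bijective τ X.coactRight M.coact)) fun f => RightComod.hom_ext fun z =>
      Subtype.ext (by
        have h : ∀ {M N : Type u} [AddCommGroup M] [Module k M] [AddCommGroup N] [Module k N]
            (g : M →ₗ[k] N) (y : X.carrier ⊗[k] M), TensorProduct.comm k X.carrier N
            (TensorProduct.map LinearMap.id g y)
            = TensorProduct.map g LinearMap.id (TensorProduct.comm k X.carrier M y) := by
          intro M N _ _ _ _ g y
          induction y with
          | zero => simp
          | add a b ha hb => simp only [map_add, ha, hb]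
          | tmul a b => simp
        exact h f.1 z.1)

/-- The mirrored unit is a composite of bicolinear maps: the regular bicomodule of `C'` to the
mirror of that of `C`, then to the mirror of `X □ L`, then to the reversed cotensor product of the
mirrors. No axiom has to be checked again. -/
theorem IsUnitMap.mirror {X : Bicomod k C D} {L : Bicomod k D C} (σ : CoalgAntiEquiv k C C')
    (τ : CoalgAntiEquiv k D D') {η : C →ₗ[k] X.carrier ⊗[k] L.carrier} (h : IsUnitMap X L η) :
    IsUnitMap (L.mirror τ σ) (X.mirror σ τ)
      ((TensorProduct.comm k X.carrier L.carrier).toLinearMap ∘ₗ η ∘ₗ σ.symm.lin) := by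
  let f := (Bicomod.mirrorRegular σ).inv ≫ Bicomod.mirrorMap σ σ h.hom ≫
    (Bicomod.mirrorCotensor σ τ σ X L).hom
  have hf : Bicomod.toTensor f
      = (TensorProduct.comm k X.carrier L.carrier).toLinearMap ∘ₗ η ∘ₗ σ.symm.lin := by
    refine LinearMap.ext fun c => ?_
    obtain ⟨c, rfl⟩ := σ.toLinearEquiv.surjective c
    have h1 : (Bicomod.mirrorRegular σ).inv.1 (σ.lin c) = c :=
      LinearMap.congr_fun (congrArg Subtype.val (Bicomod.mirrorRegular σ).hom_inv_id) c
    refine (congrArg (fun c : C => TensorProduct.comm k X.carrier L.carrier (η c)) h1).trans ?_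
    exact (congrArg (fun c : C => TensorProduct.comm k X.carrier L.carrier (η c))
      (σ.symm_lin_lin c)).symm
  exact hf ▸ IsUnitMap.of_hom f

/-- The mirror of a duality. -/
noncomputable def CoDual.mirror {X : Bicomod k C D} {L : Bicomod k D C} (σ : CoalgAntiEquiv k C C')
    (τ : CoalgAntiEquiv k D D') (a : CoDual X L) : CoDual (L.mirror τ σ) (X.mirror σ τ) where
  η := (TensorProduct.comm k X.carrier L.carrier).toLinearMap ∘ₗ a.η ∘ₗ σ.symm.lin
  e := a.e ∘ₗ (TensorProduct.comm k X.carrier L.carrier).toLinearMap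
  isUnitMap := a.isUnitMap.mirror σ τ
  -- Mirroring interchanges the two triangle identities.
  triangle_left x := by
    have key : ∀ z : C ⊗[k] X.carrier, contractLeft X.carrier
        (a.e ∘ₗ (TensorProduct.comm k X.carrier L.carrier).toLinearMap)
        (((TensorProduct.comm k X.carrier L.carrier).toLinearMap ∘ₗ a.η ∘ₗ σ.symm.lin).lTensor
          X.carrier (flipLeft X.carrier σ z))
        = contractRight X.carrier a.e (a.η.rTensor X.carrier z) := by
      intro z
      induction z with
      | zero => simp
      | add a b ha hb => simp only [map_add, ha, hb]
      | tmul c x =>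
        simp only [flipLeft_tmul, LinearMap.lTensor_tmul, LinearMap.rTensor_tmul,
          LinearMap.comp_apply, CoalgAntiEquiv.symm_lin_lin]
        generalize a.η c = y
        induction y with
        | zero => simp
        | add a b ha hb => simp only [TensorProduct.add_tmul, TensorProduct.tmul_add, map_add, ha, hb]
        | tmul x l => simp
    exact (key _).trans (a.triangle_right x)
  triangle_right l := by
    have key : ∀ z : L.carrier ⊗[k] C, contractRight L.carrier
        (a.e ∘ₗ (TensorProduct.comm k X.carrier L.carrier).toLinearMap)
        (((TensorProduct.comm k X.carrier L.carrier).toLinearMap ∘ₗ a.η ∘ₗ σ.symm.lin).rTensor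
          L.carrier (flipRight L.carrier σ z))
        = contractLeft L.carrier a.e (a.η.lTensor L.carrier z) := by
      intro z
      induction z with
      | zero => simp
      | add a b ha hb => simp only [map_add, ha, hb]
      | tmul l c =>
        simp only [flipRight_tmul, LinearMap.lTensor_tmul, LinearMap.rTensor_tmul,
          LinearMap.comp_apply, CoalgAntiEquiv.symm_lin_lin]
        generalize a.η c = y
        induction y with
        | zero => simp
        | add a b ha hb => simp only [TensorProduct.add_tmul, TensorProduct.tmul_add, map_add, ha, hb]
        | tmul x l => simp
    exact (key _).trans (a.triangle_left l)

theorem nonempty_coDual_mirror_iff {X : Bicomod k C D} {L : Bicomod k D C}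
    (σ : CoalgAntiEquiv k C C') (τ : CoalgAntiEquiv k D D') :
    Nonempty (CoDual (L.mirror τ σ) (X.mirror σ τ)) ↔ Nonempty (CoDual X L) :=
  ⟨fun ⟨a⟩ => ⟨(a.mirror σ.symm τ.symm).ofIso (Bicomod.mirrorMirror σ τ X)
    (Bicomod.mirrorMirror τ σ L)⟩, fun ⟨a⟩ => ⟨a.mirror σ τ⟩⟩

end MirrorCategories

/-! ### Conjugating functors between left comodules to right comodules. -/

section MirrorFunctors

variable {k : Type u} [Field k]
variable {C C' : Type u} [AddCommGroup C] [Module k C] [Coalgebra k C]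
  [AddCommGroup C'] [Module k C'] [Coalgebra k C']
variable {D D' : Type u} [AddCommGroup D] [Module k D] [Coalgebra k D]
  [AddCommGroup D'] [Module k D'] [Coalgebra k D']

/-- Left comodules as right comodules over an anti-isomorphic coalgebra. -/
noncomputable def LeftComod.mirrorEquiv (σ : CoalgAntiEquiv k C C') :
    LeftComod k C ≌ RightComod k C' := (LeftComod.mirror σ).asEquivalence

instance (σ : CoalgAntiEquiv k C C') : (LeftComod.mirrorEquiv σ).functor.Additive :=
  inferInstanceAs (LeftComod.mirror σ).Additive

instance (σ : CoalgAntiEquiv k C C') : (LeftComod.mirrorEquiv σ).functor.Linear k :=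
  inferInstanceAs ((LeftComod.mirror σ).Linear k)

instance (σ : CoalgAntiEquiv k C C') : (LeftComod.mirrorEquiv σ).inverse.Additive :=
  inferInstance

instance (σ : CoalgAntiEquiv k C C') : (LeftComod.mirrorEquiv σ).inverse.Linear k :=
  inferInstance

instance (X : Bicomod k C D) : (cotensorLeftFunctor X).Additive where
  map_add {M N f g} := Subtype.ext (LinearMap.ext fun x => Subtype.ext
    (LinearMap.congr_fun (TensorProduct.map_add_right LinearMap.id f.1 g.1) x.1))

instance (X : Bicomod k C D) : (cotensorLeftFunctor X).Linear k where
  map_smul {M N} f a := Subtype.ext (LinearMap.ext fun x => Subtype.ext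
    (LinearMap.congr_fun (TensorProduct.map_smul_right a LinearMap.id f.1) x.1))

variable (σ : CoalgAntiEquiv k C C') (τ : CoalgAntiEquiv k D D')

/-- A functor between categories of left comodules, as a functor between categories of right
comodules. -/
noncomputable def conj (F : LeftComod k C ⥤ LeftComod k D) : RightComod k C' ⥤ RightComod k D' :=
  (LeftComod.mirrorEquiv σ).inverse ⋙ F ⋙ (LeftComod.mirrorEquiv τ).functor

instance (F : LeftComod k C ⥤ LeftComod k D) [F.Additive] : (conj σ τ F).Additive :=
  inferInstanceAs (_ ⋙ F ⋙ _).Additive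

instance (F : LeftComod k C ⥤ LeftComod k D) [F.Additive] [F.Linear k] : (conj σ τ F).Linear k :=
  inferInstanceAs ((_ ⋙ F ⋙ _).Linear k)

instance (F : LeftComod k C ⥤ LeftComod k D) [F.IsEquivalence] : (conj σ τ F).IsEquivalence :=
  inferInstanceAs (_ ⋙ F ⋙ _).IsEquivalence

/-- A functor is recovered from its conjugate. -/
noncomputable def unconjIso (F : LeftComod k C ⥤ LeftComod k D) :
    (LeftComod.mirrorEquiv σ).functor ⋙ conj σ τ F ⋙ (LeftComod.mirrorEquiv τ).inverse ≅ F :=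
  (Functor.associator _ _ _).symm ≪≫ Functor.isoWhiskerRight ((Functor.associator _ _ _).symm ≪≫
    Functor.isoWhiskerRight (LeftComod.mirrorEquiv σ).unitIso.symm _ ≪≫ Functor.leftUnitor _) _ ≪≫
    Functor.associator _ _ _ ≪≫ Functor.isoWhiskerLeft F (LeftComod.mirrorEquiv τ).unitIso.symm ≪≫
    F.rightUnitor

variable {σ τ}

noncomputable def conjIso {F F' : LeftComod k C ⥤ LeftComod k D} (i : F ≅ F') :
    conj σ τ F ≅ conj σ τ F' :=
  Functor.isoWhiskerLeft _ (Functor.isoWhiskerRight i _)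

noncomputable def isoOfConj {F F' : LeftComod k C ⥤ LeftComod k D} (i : conj σ τ F ≅ conj σ τ F') :
    F ≅ F' :=
  (unconjIso σ τ F).symm ≪≫ Functor.isoWhiskerLeft _ (Functor.isoWhiskerRight i _) ≪≫
    unconjIso σ τ F'

noncomputable def conjAdjunction {F : LeftComod k C ⥤ LeftComod k D}
    {G : LeftComod k D ⥤ LeftComod k C} (adj : F ⊣ G) : conj σ τ F ⊣ conj τ σ G :=
  (((LeftComod.mirrorEquiv σ).symm.toAdjunction.comp adj).comp
    (LeftComod.mirrorEquiv τ).toAdjunction)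

noncomputable def adjunctionOfConj {F : LeftComod k C ⥤ LeftComod k D}
    {G : LeftComod k D ⥤ LeftComod k C} (adj : conj σ τ F ⊣ conj τ σ G) : F ⊣ G :=
  ((((LeftComod.mirrorEquiv σ).toAdjunction.comp adj).comp
    (LeftComod.mirrorEquiv τ).symm.toAdjunction).ofNatIsoLeft
      (Functor.associator _ _ _ ≪≫ unconjIso σ τ F)).ofNatIsoRight (unconjIso τ σ G)

theorem isEquivalence_of_conj {F : LeftComod k C ⥤ LeftComod k D} [(conj σ τ F).IsEquivalence] :
    F.IsEquivalence :=
  Functor.isEquivalence_of_iso (unconjIso σ τ F)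

noncomputable def conjCompIso {E E' : Type u} [AddCommGroup E] [Module k E] [Coalgebra k E]
    [AddCommGroup E'] [Module k E'] [Coalgebra k E'] (σ : CoalgAntiEquiv k C C')
    (τ : CoalgAntiEquiv k D D') (ρ : CoalgAntiEquiv k E E')
    (F : LeftComod k C ⥤ LeftComod k D) (G : LeftComod k D ⥤ LeftComod k E) :
    conj σ ρ (F ⋙ G) ≅ conj σ τ F ⋙ conj τ ρ G :=
  Functor.isoWhiskerLeft _ (Functor.isoWhiskerRight (Functor.isoWhiskerLeft F
      (Functor.leftUnitor G).symm ≪≫ Functor.isoWhiskerLeft F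
        (Functor.isoWhiskerRight (LeftComod.mirrorEquiv τ).unitIso G)) _)

variable (σ τ) in
/-- The conjugate of `X □ -` is `- □ X` for the mirrored bicomodule. -/
noncomputable def conjCotensorIso (X : Bicomod k C D) :
    conj τ σ (cotensorLeftFunctor X) ≅ cotensorRightFunctor (X.mirror σ τ) :=
  Functor.isoWhiskerLeft _ (cotensorLeftMirrorIso σ τ X) ≪≫ (Functor.associator _ _ _).symm ≪≫
    Functor.isoWhiskerRight (LeftComod.mirrorEquiv τ).counitIso _ ≪≫ Functor.leftUnitor _

end MirrorFunctors

/-! ### Moving equivalences across an adjunction, in the other direction. -/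

section Adjunctions

universe v₁ v₂ u₁ u₂

variable {𝒜 : Type u₁} [Category.{v₁} 𝒜] {ℬ : Type u₂} [Category.{v₂} ℬ]

/-- A right adjoint of `β ⋙ G ⋙ α`, for equivalences `α` and `β`, yields a right adjoint of `G`. -/
noncomputable def adjunctionOfEquivalencesLeft {F : 𝒜 ⥤ ℬ} {G : ℬ ⥤ 𝒜} (α : 𝒜 ⥤ 𝒜) (β : ℬ ⥤ ℬ)
    [α.IsEquivalence] [β.IsEquivalence] (adj : β ⋙ G ⋙ α ⊣ F) : G ⊣ α ⋙ F ⋙ β :=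
  ((β.asEquivalence.symm.toAdjunction.comp adj).comp α.asEquivalence.symm.toAdjunction).ofNatIsoLeft
    (Functor.isoWhiskerRight ((Functor.associator _ _ _).symm ≪≫
        Functor.isoWhiskerRight β.asEquivalence.counitIso (G ⋙ α) ≪≫ (G ⋙ α).leftUnitor) _ ≪≫
      Functor.associator _ _ _ ≪≫ Functor.isoWhiskerLeft G α.asEquivalence.unitIso.symm ≪≫
      G.rightUnitor)

end Adjunctions

/-! ### Fourtuples and Frobenius functors between left comodules. -/

section LeftFunctors

variable {k : Type u} [Field k]
variable {C C' : Type u} [AddCommGroup C] [Module k C] [Coalgebra k C]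
  [AddCommGroup C'] [Module k C'] [Coalgebra k C']
variable {D D' : Type u} [AddCommGroup D] [Module k D] [Coalgebra k D]
  [AddCommGroup D'] [Module k D'] [Coalgebra k D']

/-- The regular bicomodule as a cotensor product of mirrored bicomodules. -/
noncomputable def mirrorRegularIso {P : Bicomod k D C} {Q : Bicomod k C D}
    (σ : CoalgAntiEquiv k C C') (τ : CoalgAntiEquiv k D D')
    (f : Bicomod.regular k C ≅ Q.cotensor P) :
    Bicomod.regular k C' ≅ (P.mirror τ σ).cotensor (Q.mirror σ τ) :=
  (Bicomod.mirrorRegular σ).symm ≪≫ Bicomod.mirrorIso σ σ f ≪≫ Bicomod.mirrorCotensor σ τ σ Q P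

/-- Only the isomorphisms `f` and `g` have to be mirrored for an equivalence. The two equations of a
mirrored context are then restored by `exists_strictContext_of_isEquivalence`. -/
theorem StrictContext.isEquivalence_mirror (S : StrictContext k C D)
    (σ : CoalgAntiEquiv k C C') (τ : CoalgAntiEquiv k D D') :
    (cotensorRightFunctor (S.P.mirror τ σ)).IsEquivalence :=
  (CategoryTheory.Equivalence.mk (cotensorRightFunctor (S.P.mirror τ σ))
    (cotensorRightFunctor (S.Q.mirror σ τ))
    (cotensorRegularIso k C' ≪≫ cotensorRightMapIso (mirrorRegularIso σ τ S.f) ≪≫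
      cotensorRightCompIso _ _)
    (cotensorRegularIso k D' ≪≫ cotensorRightMapIso (mirrorRegularIso τ σ S.g) ≪≫
      cotensorRightCompIso _ _).symm).isEquivalence_functor

theorem StrictContext.exists_mirror (S : StrictContext k C C) (σ : CoalgAntiEquiv k C C') :
    ∃ T : StrictContext k C' C', T.P = S.P.mirror σ σ :=
  have := S.isEquivalence_mirror σ σ
  exists_strictContext_of_isEquivalence _

theorem StrictContext.exists_mirror_iso (T : StrictContext k C' C') (σ : CoalgAntiEquiv k C C') :
    ∃ S : StrictContext k C C, Nonempty (S.P.mirror σ σ ≅ T.P) := by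
  obtain ⟨S, hS⟩ := T.exists_mirror σ.symm
  exact ⟨S, ⟨Bicomod.mirrorIso σ σ (eqToIso hS) ≪≫ Bicomod.mirrorMirror σ.symm σ.symm T.P⟩⟩

theorem StrictContext.isEquivalence_left (S : StrictContext k C C) :
    (cotensorLeftFunctor S.P).IsEquivalence := by
  let σ := Coop.antiEquiv k C
  have := S.isEquivalence_mirror σ σ
  have : (conj σ σ (cotensorLeftFunctor S.P)).IsEquivalence :=
    Functor.isEquivalence_of_iso (conjCotensorIso σ σ S.P).symm
  exact isEquivalence_of_conj (σ := σ) (τ := σ)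

/-- Conjugation turns `X □ -` into cotensoring on the right with the mirror of `X`, where the
statement is known. -/
theorem nonempty_iso_iff_cotensorLeftFunctor {X X' : Bicomod k C D} :
    Nonempty (cotensorLeftFunctor X ≅ cotensorLeftFunctor X') ↔ Nonempty (X ≅ X') := by
  let σ := Coop.antiEquiv k C
  let τ := Coop.antiEquiv k D
  constructor
  · rintro ⟨i⟩
    obtain ⟨j⟩ := nonempty_iso_of_cotensorRightFunctor_iso
      ((conjCotensorIso σ τ X).symm ≪≫ conjIso i ≪≫ conjCotensorIso σ τ X')
    exact ⟨Bicomod.isoOfMirror σ τ j⟩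
  · rintro ⟨i⟩
    exact ⟨isoOfConj (conjCotensorIso σ τ X ≪≫ cotensorRightMapIso (Bicomod.mirrorIso σ τ i) ≪≫
      (conjCotensorIso σ τ X').symm)⟩

/-- Conjugates of triple composites of cotensor functors. -/
noncomputable def conjCotensorIso₃ (σ : CoalgAntiEquiv k C C') (τ : CoalgAntiEquiv k D D')
    (A : Bicomod k C C) (L : Bicomod k D C) (B : Bicomod k D D) :
    conj σ τ (cotensorLeftFunctor A ⋙ cotensorLeftFunctor L ⋙ cotensorLeftFunctor B) ≅
      cotensorRightFunctor (A.mirror σ σ) ⋙ cotensorRightFunctor (L.mirror τ σ) ⋙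
        cotensorRightFunctor (B.mirror τ τ) :=
  conjCompIso σ σ τ _ _ ≪≫ Functor.isoWhiskerRight (conjCotensorIso σ σ A) _ ≪≫
    Functor.isoWhiskerLeft _ (conjCompIso σ τ τ _ _ ≪≫
      Functor.isoWhiskerRight (conjCotensorIso τ σ L) _ ≪≫
      Functor.isoWhiskerLeft _ (conjCotensorIso τ τ B))

/-- Mirroring reverses the factors and produces the bracketing `B □ (X □ A)`. Rebracketing is done
on cotensor functors, since isomorphic functors come from isomorphic bicomodules; this spares a
bicolinear associator. -/
theorem nonempty_mirror_cotensor₃ (σ : CoalgAntiEquiv k C C') (τ : CoalgAntiEquiv k D D')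
    (A : Bicomod k C C) (X : Bicomod k C D) (B : Bicomod k D D) :
    Nonempty (((A.cotensor X).cotensor B).mirror σ τ ≅
      ((B.mirror τ τ).cotensor (X.mirror σ τ)).cotensor (A.mirror σ σ)) := by
  obtain ⟨i⟩ := nonempty_iso_of_cotensorRightFunctor_iso
    (cotensorRightCompIso (B.mirror τ τ) ((X.mirror σ τ).cotensor (A.mirror σ σ)) ≪≫
      Functor.isoWhiskerLeft _ (cotensorRightCompIso (X.mirror σ τ) (A.mirror σ σ)) ≪≫
      (cotensorRightCompIso₃ (B.mirror τ τ) (X.mirror σ τ) (A.mirror σ σ)).symm)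
  let j := Bicomod.mirrorCotensor σ σ τ A X
  let j' : (B.mirror τ τ).cotensor ((A.cotensor X).mirror σ τ) ≅
      (B.mirror τ τ).cotensor ((X.mirror σ τ).cotensor (A.mirror σ σ)) :=
    ⟨Bicomod.cotensorMap (𝟙 _) j.hom, Bicomod.cotensorMap (𝟙 _) j.inv, by
      rw [← Bicomod.cotensorMap_comp, j.hom_inv_id, Category.comp_id, Bicomod.cotensorMap_id], by
      rw [← Bicomod.cotensorMap_comp, j.inv_hom_id, Category.comp_id, Bicomod.cotensorMap_id]⟩
  exact ⟨Bicomod.mirrorCotensor σ τ τ (A.cotensor X) B ≪≫ j' ≪≫ i⟩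

/-- A duality yields an adjunction between categories of left comodules. -/
noncomputable def CoDual.leftAdjunction {X : Bicomod k C D} {L : Bicomod k D C} (a : CoDual X L) :
    cotensorLeftFunctor L ⊣ cotensorLeftFunctor X :=
  adjunctionOfConj (((a.mirror (Coop.antiEquiv k C) (Coop.antiEquiv k D)).adjunction.ofNatIsoLeft
    (conjCotensorIso _ _ L).symm).ofNatIsoRight (conjCotensorIso _ _ X).symm)

namespace FourTuple

/-- For the converse, the equivalences are moved from the left adjoint back to the right one. -/
theorem exists_coDual_iff {q : FourTuple k C D} : Nonempty (CoDual q.L q.UXV) ↔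
    Nonempty (CoDual ((q.V.P.cotensor q.L).cotensor q.U.P) q.X) := by
  refine ⟨IsDual.exists_coDual, fun ⟨a⟩ => ?_⟩
  have := q.U.isEquivalence
  have := q.V.isEquivalence
  exact nonempty_coDual_of_adjunction ((adjunctionOfEquivalencesLeft _ _
    (a.adjunction.ofNatIsoLeft (cotensorRightCompIso₃ q.V.P q.L q.U.P))).ofNatIsoRight
      q.uxvIso.symm)

/-- Triple cotensor products of isomorphic bicomodules are isomorphic. -/
theorem nonempty_cotensor₃ {A A' : Bicomod k C C} {X X' : Bicomod k C D} {B B' : Bicomod k D D}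
    (a : A ≅ A') (x : X ≅ X') (b : B ≅ B') :
    Nonempty ((A.cotensor X).cotensor B ≅ (A'.cotensor X').cotensor B') :=
  nonempty_iso_of_cotensorRightFunctor_iso (cotensorRightCompIso₃ A X B ≪≫
    Functor.isoWhiskerRight (cotensorRightMapIso a) _ ≪≫ Functor.isoWhiskerLeft _
      (Functor.isoWhiskerRight (cotensorRightMapIso x) _ ≪≫
        Functor.isoWhiskerLeft _ (cotensorRightMapIso b)) ≪≫ (cotensorRightCompIso₃ A' X' B').symm)

/-- Mirroring exchanges the roles of `X` and `L`. The first duality mirrors to the first; the second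
must be rewritten by `exists_coDual_iff` as a duality between `V □ L □ U` and `X`, whose mirror is
the second duality of `q'`. -/
theorem isDual_mirror_iff (σ : CoalgAntiEquiv k C C') (τ : CoalgAntiEquiv k D D')
    {q : FourTuple k C D} {q' : FourTuple k C' D'} (x : q.L.mirror τ σ ≅ q'.X)
    (l : q.X.mirror σ τ ≅ q'.L) (a : q.U.P.mirror σ σ ≅ q'.U.P) (b : q.V.P.mirror τ τ ≅ q'.V.P) :
    q'.IsDual ↔ q.IsDual := by
  refine and_congr ?_ ?_
  · rw [← nonempty_coDual_mirror_iff σ τ]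
    exact ⟨fun ⟨c⟩ => ⟨c.ofIso x.symm l.symm⟩, fun ⟨c⟩ => ⟨c.ofIso x l⟩⟩
  · rw [exists_coDual_iff (q := q), ← nonempty_coDual_mirror_iff τ σ]
    obtain ⟨i⟩ := nonempty_mirror_cotensor₃ τ σ q.V.P q.L q.U.P
    obtain ⟨j⟩ := nonempty_cotensor₃ a x b
    exact ⟨fun ⟨c⟩ => ⟨c.ofIso l.symm (i ≪≫ j).symm⟩, fun ⟨c⟩ => ⟨c.ofIso l (i ≪≫ j)⟩⟩

/-- The duality between `V □ L □ U` and `X` gives, once mirrored, an adjunction whose left adjoint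
comes from `X`. Its right adjoint applies the factors in the order `U`, `L`, `V`, as required. -/
theorem IsDual.nonempty_adjunction_left {q : FourTuple k C D} (h : q.IsDual) :
    Nonempty (cotensorLeftFunctor q.X ⊣ cotensorLeftFunctor q.U.P ⋙ cotensorLeftFunctor q.L ⋙
      cotensorLeftFunctor q.V.P) := by
  let σ := Coop.antiEquiv k C
  let τ := Coop.antiEquiv k D
  obtain ⟨a⟩ := exists_coDual_iff.1 h.2
  obtain ⟨i⟩ := nonempty_mirror_cotensor₃ τ σ q.V.P q.L q.U.P
  exact ⟨adjunctionOfConj (((a.mirror τ σ).adjunction.ofNatIsoLeft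
    (conjCotensorIso σ τ q.X).symm).ofNatIsoRight (cotensorRightMapIso i ≪≫
      cotensorRightCompIso₃ _ _ _ ≪≫ (conjCotensorIso₃ σ τ q.U.P q.L q.V.P).symm))⟩

/-- The Frobenius functor of the second kind between categories of left comodules. -/
noncomputable def frobeniusLeft (q : FourTuple k C D) (h : q.IsDual) :
    FrobeniusSecondKind k (LeftComod k C) (LeftComod k D) where
  F := cotensorLeftFunctor q.L
  G := cotensorLeftFunctor q.X
  α := cotensorLeftFunctor q.U.P
  β := cotensorLeftFunctor q.V.P
  additive_F := inferInstance
  additive_G := inferInstance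
  additive_α := inferInstance
  additive_β := inferInstance
  linear_F := inferInstance
  linear_G := inferInstance
  linear_α := inferInstance
  linear_β := inferInstance
  isEquivalence_α := q.U.isEquivalence_left
  isEquivalence_β := q.V.isEquivalence_left
  adj := h.1.map CoDual.leftAdjunction
  adj' := h.nonempty_adjunction_left

end FourTuple

theorem frobeniusLeft_rel_iff {q q' : FourTuple k C D} (h : q.IsDual) (h' : q'.IsDual) :
    FourTuple.setoid k C D q q' ↔ FrobeniusSecondKind.setoid k (LeftComod k C) (LeftComod k D)
      (q.frobeniusLeft h) (q'.frobeniusLeft h') := by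
  constructor
  · rintro ⟨a, b, ⟨c⟩, ⟨d⟩⟩
    exact ⟨nonempty_iso_iff_cotensorLeftFunctor.2 b, nonempty_iso_iff_cotensorLeftFunctor.2 a,
      nonempty_iso_iff_cotensorLeftFunctor.2 ⟨c.p⟩, nonempty_iso_iff_cotensorLeftFunctor.2 ⟨d.p⟩⟩
  · rintro ⟨a, b, c, d⟩
    obtain ⟨u⟩ := nonempty_iso_iff_cotensorLeftFunctor.1 c
    obtain ⟨v⟩ := nonempty_iso_iff_cotensorLeftFunctor.1 d
    exact ⟨nonempty_iso_iff_cotensorLeftFunctor.1 b, nonempty_iso_iff_cotensorLeftFunctor.1 a,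
      StrictContext.nonempty_iso u, StrictContext.nonempty_iso v⟩

/-- The conjugate of a Frobenius functor of the second kind. -/
noncomputable def FrobeniusSecondKind.conj (σ : CoalgAntiEquiv k C C') (τ : CoalgAntiEquiv k D D')
    (S : FrobeniusSecondKind k (LeftComod k C) (LeftComod k D)) :
    FrobeniusSecondKind k (RightComod k C') (RightComod k D') := by
  obtain ⟨F, G, α, β, _, _, _, _, _, _, _, _, _, _, adj, adj'⟩ := S
  exact {
    F := FrobeniusComod.conj σ τ F
    G := FrobeniusComod.conj τ σ G
    α := FrobeniusComod.conj σ σ α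
    β := FrobeniusComod.conj τ τ β
    additive_F := inferInstance
    additive_G := inferInstance
    additive_α := inferInstance
    additive_β := inferInstance
    linear_F := inferInstance
    linear_G := inferInstance
    linear_α := inferInstance
    linear_β := inferInstance
    isEquivalence_α := inferInstance
    isEquivalence_β := inferInstance
    adj := adj.map conjAdjunction
    adj' := adj'.map fun adj => (conjAdjunction adj).ofNatIsoRight
      (conjCompIso σ σ τ _ _ ≪≫ Functor.isoWhiskerLeft _ (conjCompIso σ τ τ _ _)) }

theorem nonempty_cotensorLeftFunctor_iso (σ : CoalgAntiEquiv k C C') (τ : CoalgAntiEquiv k D D')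
    {X : Bicomod k C D} {X' : Bicomod k D' C'} (i : X.mirror σ τ ≅ X')
    {F : LeftComod k D ⥤ LeftComod k C} (j : cotensorRightFunctor X' ≅ conj τ σ F) :
    Nonempty (cotensorLeftFunctor X ≅ F) :=
  ⟨isoOfConj (conjCotensorIso σ τ X ≪≫ cotensorRightMapIso i ≪≫ j)⟩

/-- The functor is conjugated to right comodules over the coopposite coalgebras, where it comes from
a fourtuple; bicomodules and contexts are then mirrored back. -/
theorem exists_frobeniusLeft_rel (S : FrobeniusSecondKind k (LeftComod k C) (LeftComod k D)) :
    ∃ (q : FourTuple k C D) (h : q.IsDual),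
      FrobeniusSecondKind.setoid k _ _ (q.frobeniusLeft h) S := by
  let σ := Coop.antiEquiv k C
  let τ := Coop.antiEquiv k D
  obtain ⟨q', h', ⟨f⟩, ⟨g⟩, ⟨α⟩, ⟨β⟩⟩ := exists_frobeniusRight_rel (S.conj σ τ)
  -- On the left side `F` is given by `Λ` and `G` by `X`, so `X` comes from `q'.L` and `Λ` from
  -- `q'.X`.
  obtain ⟨X, ⟨l⟩⟩ := Bicomod.exists_mirror_iso σ τ q'.L
  obtain ⟨L, ⟨x⟩⟩ := Bicomod.exists_mirror_iso τ σ q'.X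
  obtain ⟨U, ⟨a⟩⟩ := q'.U.exists_mirror_iso σ
  obtain ⟨V, ⟨b⟩⟩ := q'.V.exists_mirror_iso τ
  exact ⟨⟨X, L, U, V⟩, (FourTuple.isDual_mirror_iff σ τ x l a b).1 h',
    nonempty_cotensorLeftFunctor_iso τ σ x f, nonempty_cotensorLeftFunctor_iso σ τ l g,
    nonempty_cotensorLeftFunctor_iso σ σ a α, nonempty_cotensorLeftFunctor_iso τ τ b β⟩

end LeftFunctors

/-! ### The universal property of the left co-hom bicomodule. -/

section LeftCoHom

variable {k : Type u} [Field k]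
variable {C C' : Type u} [AddCommGroup C] [Module k C] [Coalgebra k C]
  [AddCommGroup C'] [Module k C'] [Coalgebra k C']
variable {D D' : Type u} [AddCommGroup D] [Module k D] [Coalgebra k D]
  [AddCommGroup D'] [Module k D'] [Coalgebra k D']

theorem lTensor_comp_of_mem_cotensor {M N W : Type u} [AddCommGroup M] [Module k M]
    [AddCommGroup N] [Module k N] [AddCommGroup W] [Module k W] {r : M →ₗ[k] M ⊗[k] D}
    {l : N →ₗ[k] D ⊗[k] N} (g : N →ₗ[k] W) {z : M ⊗[k] N} (hz : z ∈ cotensor r l) :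
    (g.lTensor D ∘ₗ l).lTensor M z = TensorProduct.assoc k M D W (r.rTensor W (g.lTensor M z)) := by
  have h : (g.lTensor D).lTensor M ∘ₗ (TensorProduct.assoc k M D N).toLinearMap
      = (TensorProduct.assoc k M D W).toLinearMap ∘ₗ g.lTensor (M ⊗[k] D) := by
    ext; simp
  rw [LinearMap.lTensor_comp_apply, ← mem_cotensor.1 hz, ← lTensor_rTensor_comm]
  exact LinearMap.congr_fun h (r.rTensor N z)

theorem LeftComod.counitMapLeft_coact (M : LeftComod k C) (m : M.carrier) :
    counitMapLeft k C M.carrier (M.coact m) = m := by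
  have := LinearMap.congr_fun M.isCoaction.counit m
  simp only [LinearMap.comp_apply, TensorProduct.mk_apply] at this
  simp [counitMapLeft, this]

theorem IsLeftCoaction.colinear_lTensor {M W : Type u} [AddCommGroup M] [Module k M]
    [AddCommGroup W] [Module k W] {l : M →ₗ[k] C ⊗[k] M} (h : IsLeftCoaction l) (f : M →ₗ[k] W) :
    (f.lTensor C ∘ₗ l).lTensor C ∘ₗ l
      = tensorLeft W (Coalgebra.comul (R := k) (A := C)) ∘ₗ f.lTensor C ∘ₗ l :=
  LinearMap.ext fun m => lTensor_comp_of_mem_cotensor f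
    (LinearMap.congr_fun h.coassoc m : l m ∈ cotensor (Coalgebra.comul (R := k) (A := C)) l)

/-- The colinear map to a cofree left comodule that corresponds to a linear map. -/
noncomputable def LeftComod.toCofree (M : LeftComod k C) {W : Type u} [AddCommGroup W] [Module k W]
    (f : M.carrier →ₗ[k] W) : M ⟶ (LeftComod.tensor W).obj (Bicomod.regular k C).toLeft :=
  ⟨f.lTensor C ∘ₗ M.coact, M.isCoaction.colinear_lTensor f⟩

theorem LeftComod.counitMapLeft_toCofree (M : LeftComod k C) {W : Type u} [AddCommGroup W]
    [Module k W] (f : M.carrier →ₗ[k] W) (m : M.carrier) :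
    counitMapLeft k C W ((M.toCofree f).1 m) = f m :=
  (counitMapLeft_lTensor f (M.coact m)).trans (congrArg f (M.counitMapLeft_coact m))

/-- The colinear map `Y → Y □_D D` given by the coaction. -/
noncomputable def cotensorRegularLeftHom (Y : Bicomod k C D) :
    Y.toLeft ⟶ (cotensorLeftFunctor Y).obj (Bicomod.regular k D).toLeft :=
  ⟨Y.coactRight.codRestrict (cotensor Y.coactRight (Coalgebra.comul (R := k) (A := D)))
      fun y => LinearMap.congr_fun Y.isRightCoaction.coassoc y,
    leftColinear_codRestrict _ _ Y.commute _ _ fun y => (LinearMap.congr_fun Y.commute y).symm⟩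

/-- The unit of the adjunction at `C`, as a linear map `C → Y ⊗ F(C)`. -/
noncomputable def leftCoHomUnitTensor (Y : Bicomod k C D) {F : LeftComod k C ⥤ LeftComod k D}
    (adj : F ⊣ cotensorLeftFunctor Y) :
    C →ₗ[k] Y.carrier ⊗[k] (F.obj (Bicomod.regular k C).toLeft).carrier :=
  (cotensor Y.coactRight (F.obj (Bicomod.regular k C).toLeft).coact).subtype ∘ₗ
    (leftCoHomUnit Y adj).1

theorem homEquiv_regular_left_val (Y : Bicomod k C D) {F : LeftComod k C ⥤ LeftComod k D}
    (adj : F ⊣ cotensorLeftFunctor Y) {N : LeftComod k D}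
    (f : F.obj (Bicomod.regular k C).toLeft ⟶ N) (c : C) :
    ((adj.homEquiv _ _ f).1 c).1 = f.1.lTensor Y.carrier (leftCoHomUnitTensor Y adj c) := by
  rw [leftCoHomUnit_comp]
  rfl

theorem leftCoHomUnitTensor_mem (Y : Bicomod k C D) {F : LeftComod k C ⥤ LeftComod k D}
    (adj : F ⊣ cotensorLeftFunctor Y) (c : C) : leftCoHomUnitTensor Y adj c ∈
      cotensor Y.coactRight (F.obj (Bicomod.regular k C).toLeft).coact :=
  ((leftCoHomUnit Y adj).1 c).2

theorem LeftComod.cotensor_coact_val (X : Bicomod k C D) (M : LeftComod k D)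
    (z : FrobeniusComod.cotensor X.coactRight M.coact) :
    (FrobeniusComod.cotensor X.coactRight M.coact).subtype.lTensor C
      ((LeftComod.cotensor X M).coact z) = tensorLeft M.carrier X.coactLeft z.1 :=
  LinearMap.congr_fun (cotensorLeftCoaction_spec M.coact X.commute) z

theorem leftCoHomUnitTensor_left (Y : Bicomod k C D) {F : LeftComod k C ⥤ LeftComod k D}
    (adj : F ⊣ cotensorLeftFunctor Y) (c : C) :
    tensorLeft (F.obj (Bicomod.regular k C).toLeft).carrier Y.coactLeft
        (leftCoHomUnitTensor Y adj c)
      = (leftCoHomUnitTensor Y adj).lTensor C (Coalgebra.comul (R := k) c) := by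
  refine (LeftComod.cotensor_coact_val Y (F.obj (Bicomod.regular k C).toLeft) _).symm.trans ?_
  refine (congrArg ((cotensor Y.coactRight (F.obj
    (Bicomod.regular k C).toLeft).coact).subtype.lTensor C)
      (LinearMap.congr_fun (leftCoHomUnit Y adj).2 c).symm).trans ?_
  exact (LinearMap.lTensor_comp_apply ..).symm

theorem leftCoHomUnitTensor_right (Y : Bicomod k C D) {F : LeftComod k C ⥤ LeftComod k D}
    (adj : F ⊣ cotensorLeftFunctor Y) (c : C) :
    tensorRight Y.carrier (leftCoHomCoaction Y adj).1 (leftCoHomUnitTensor Y adj c)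
      = (leftCoHomUnitTensor Y adj).rTensor C (Coalgebra.comul (R := k) c) := by
  have h := congrArg Subtype.val (LinearMap.congr_fun (congrArg Subtype.val
    (leftCoHomUnit_leftCoHomCoaction Y adj)) c)
  refine (LinearEquiv.symm_apply_eq (TensorProduct.assoc k Y.carrier
    (F.obj (Bicomod.regular k C).toLeft).carrier C)).2 (h.trans ?_)
  refine congrArg (TensorProduct.assoc k Y.carrier
    (F.obj (Bicomod.regular k C).toLeft).carrier C) ?_
  exact (LinearMap.rTensor_comp_apply ..).symm

theorem isUnitMap_leftCoHomOfAdjunction (Y : Bicomod k C D) {F : LeftComod k C ⥤ LeftComod k D}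
    (adj : F ⊣ cotensorLeftFunctor Y) :
    IsUnitMap Y (leftCoHomOfAdjunction Y adj) (leftCoHomUnitTensor Y adj) where
  mem := leftCoHomUnitTensor_mem Y adj
  left := leftCoHomUnitTensor_left Y adj
  right := leftCoHomUnitTensor_right Y adj

/-- As for right comodules, the adjunction is applied to maps into the cofree left comodule `D ⊗ W`.
-/
theorem leftCoHomUnitTensor_unique (Y : Bicomod k C D) {F : LeftComod k C ⥤ LeftComod k D}
    (adj : F ⊣ cotensorLeftFunctor Y) (W : Type u) [AddCommGroup W] [Module k W]
    (g g' : (F.obj (Bicomod.regular k C).toLeft).carrier →ₗ[k] W)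
    (h : ∀ c, g.lTensor Y.carrier (leftCoHomUnitTensor Y adj c)
      = g'.lTensor Y.carrier (leftCoHomUnitTensor Y adj c)) : g = g' := by
  have key : ∀ (g : (F.obj (Bicomod.regular k C).toLeft).carrier →ₗ[k] W) (c : C),
      (LeftComod.toCofree _ g).1.lTensor Y.carrier (leftCoHomUnitTensor Y adj c)
        = TensorProduct.assoc k Y.carrier D W (Y.coactRight.rTensor W
          (g.lTensor Y.carrier (leftCoHomUnitTensor Y adj c))) :=
    fun g c => lTensor_comp_of_mem_cotensor g (leftCoHomUnitTensor_mem Y adj c)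
  have h2 : LeftComod.toCofree _ g = LeftComod.toCofree _ g' := by
    apply (adj.homEquiv _ _).injective
    refine LeftComod.hom_ext fun c => Subtype.ext ?_
    refine (homEquiv_regular_left_val Y adj _ c).trans
      (Eq.trans ?_ (homEquiv_regular_left_val Y adj _ c).symm)
    refine (key g c).trans (Eq.trans ?_ (key g' c).symm)
    exact congrArg (fun z => TensorProduct.assoc k Y.carrier D W (Y.coactRight.rTensor W z)) (h c)
  refine LinearMap.ext fun x => ?_
  refine (LeftComod.counitMapLeft_toCofree _ g x).symm.trans
    (Eq.trans ?_ (LeftComod.counitMapLeft_toCofree _ g' x))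
  rw [h2]

theorem leftCoHomUnitTensor_exists (Y : Bicomod k C D) {F : LeftComod k C ⥤ LeftComod k D}
    (adj : F ⊣ cotensorLeftFunctor Y) (W : Type u) [AddCommGroup W] [Module k W]
    (f : C →ₗ[k] Y.carrier ⊗[k] W)
    (hf : ∀ c, tensorLeft W Y.coactLeft (f c) = f.lTensor C (Coalgebra.comul (R := k) c)) :
    ∃ g : (F.obj (Bicomod.regular k C).toLeft).carrier →ₗ[k] W,
      ∀ c, g.lTensor Y.carrier (leftCoHomUnitTensor Y adj c) = f c := by
  let f₁ : (Bicomod.regular k C).toLeft ⟶ (LeftComod.tensor W).obj Y.toLeft :=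
    ⟨f, LinearMap.ext fun c => (hf c).symm⟩
  let f₂ := f₁ ≫ (LeftComod.tensor W).map (cotensorRegularLeftHom Y) ≫
    cotensorTensor W Y (Bicomod.regular k D).toLeft
  let g₁ := (adj.homEquiv _ _).symm f₂
  refine ⟨counitMapLeft k D W ∘ₗ g₁.1, fun c => ?_⟩
  have h1 : g₁.1.lTensor Y.carrier (leftCoHomUnitTensor Y adj c)
      = TensorProduct.assoc k Y.carrier D W (Y.coactRight.rTensor W (f c)) := by
    refine (homEquiv_regular_left_val Y adj g₁ c).symm.trans ?_
    rw [Equiv.apply_symm_apply]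
    refine congrArg (TensorProduct.assoc k Y.carrier D W) ?_
    exact (LinearMap.rTensor_comp_apply ..).symm
  refine (LinearMap.lTensor_comp_apply ..).trans ?_
  refine (congrArg _ h1).trans ?_
  rw [counitMapLeft_assoc, ← LinearMap.rTensor_comp_apply]
  have : counitMap k D Y.carrier ∘ₗ Y.coactRight = LinearMap.id :=
    LinearMap.ext (RightComod.counitMap_coact Y.toRight)
  rw [this, LinearMap.rTensor_id, LinearMap.id_apply]

theorem comm_lTensor {A B W : Type u} [AddCommGroup A] [Module k A] [AddCommGroup B] [Module k B]
    [AddCommGroup W] [Module k W] (g : B →ₗ[k] W) (z : A ⊗[k] B) :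
    g.rTensor A (TensorProduct.comm k A B z) = TensorProduct.comm k A W (g.lTensor A z) := by
  have : g.rTensor A ∘ₗ (TensorProduct.comm k A B).toLinearMap
      = (TensorProduct.comm k A W).toLinearMap ∘ₗ g.lTensor A := by
    ext; simp
  exact LinearMap.congr_fun this z

theorem flipLeft_tensorLeft_comm (σ : CoalgAntiEquiv k C C') {Y W : Type u} [AddCommGroup Y]
    [Module k Y] [AddCommGroup W] [Module k W] (l : Y →ₗ[k] C ⊗[k] Y) (z : W ⊗[k] Y) :
    flipLeft (Y ⊗[k] W) σ (tensorLeft W l (TensorProduct.comm k W Y z))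
      = (TensorProduct.comm k W Y).toLinearMap.rTensor C'
        (tensorRight W (flipLeft Y σ ∘ₗ l) z) := by
  induction z with
  | zero => simp
  | add a b ha hb => simp only [map_add, ha, hb]
  | tmul w y =>
    simp only [tensorLeft, tensorRight, TensorProduct.comm_tmul, LinearMap.comp_apply,
      LinearMap.rTensor_tmul, LinearMap.lTensor_tmul, LinearEquiv.coe_coe]
    generalize l y = z
    induction z with
    | zero => simp
    | add a b ha hb => simp only [map_add, TensorProduct.add_tmul, TensorProduct.tmul_add, ha, hb]
    | tmul c y => simp

/-- Translates the colinearity assumed in `IsCoHom` over the mirrored coalgebra into the one assumed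
in `leftCoHomUnitTensor_exists`. -/
theorem tensorLeft_comm_of_tensorRight (σ : CoalgAntiEquiv k C C') {Y W : Type u} [AddCommGroup Y]
    [Module k Y] [AddCommGroup W] [Module k W] (l : Y →ₗ[k] C ⊗[k] Y) (f : C' →ₗ[k] W ⊗[k] Y)
    (hf : ∀ c, tensorRight W (flipLeft Y σ ∘ₗ l) (f c) = f.rTensor C' (Coalgebra.comul (R := k) c))
    (c : C) :
    tensorLeft W l (((TensorProduct.comm k W Y).toLinearMap ∘ₗ f ∘ₗ σ.lin) c)
      = ((TensorProduct.comm k W Y).toLinearMap ∘ₗ f ∘ₗ σ.lin).lTensor C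
        (Coalgebra.comul (R := k) c) := by
  refine flipLeft_injective σ ((flipLeft_tensorLeft_comm σ l (f (σ.lin c))).trans ?_)
  rw [flipLeft_lTensor, LinearMap.rTensor_comp_apply, LinearMap.rTensor_comp_apply,
    rTensor_flipLeft_comul, hf]

/-- The unit of `F ⊣ Y □_D -` at `C` is universal. -/
theorem isCoHom_mirror_leftCoHomOfAdjunction (σ : CoalgAntiEquiv k C C')
    (τ : CoalgAntiEquiv k D D') (Y : Bicomod k C D) {F : LeftComod k C ⥤ LeftComod k D}
    (adj : F ⊣ cotensorLeftFunctor Y) :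
    IsCoHom ((leftCoHomOfAdjunction Y adj).mirror τ σ) (Y.mirror σ τ)
      ((TensorProduct.comm k Y.carrier (leftCoHomOfAdjunction Y adj).carrier).toLinearMap ∘ₗ
        leftCoHomUnitTensor Y adj ∘ₗ σ.symm.lin) where
  toIsUnitMap := (isUnitMap_leftCoHomOfAdjunction Y adj).mirror σ τ
  exists_map W _ _ f hf := by
    obtain ⟨g, hg⟩ := leftCoHomUnitTensor_exists Y adj W
      ((TensorProduct.comm k W Y.carrier).toLinearMap ∘ₗ f ∘ₗ σ.lin)
      (tensorLeft_comm_of_tensorRight σ Y.coactLeft f hf)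
    refine ⟨g, fun c => ?_⟩
    refine (comm_lTensor g (leftCoHomUnitTensor Y adj (σ.symm.lin c))).trans ?_
    refine (congrArg (TensorProduct.comm k Y.carrier W) (hg _)).trans ?_
    refine ((TensorProduct.comm k W Y.carrier).symm_apply_apply _).trans ?_
    exact congrArg f (σ.lin_symm_lin c)
  unique W _ _ g g' h := by
    refine leftCoHomUnitTensor_unique Y adj W g g' fun c => ?_
    have h' := (comm_lTensor g (leftCoHomUnitTensor Y adj (σ.symm.lin (σ.lin c)))).symm.trans
      ((h (σ.lin c)).trans (comm_lTensor g' (leftCoHomUnitTensor Y adj (σ.symm.lin (σ.lin c)))))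
    rw [σ.symm_lin_lin] at h'
    exact (TensorProduct.comm k _ _).injective h'

end LeftCoHom

/-! ### The condition on left comodules. -/

section LeftConditions

variable {k : Type u} [Field k]
variable {C C' : Type u} [AddCommGroup C] [Module k C] [Coalgebra k C]
  [AddCommGroup C'] [Module k C'] [Coalgebra k C']
variable {D : Type u} [AddCommGroup D] [Module k D] [Coalgebra k D]

theorem LeftComod.quasifinite_of_mirror (σ : CoalgAntiEquiv k C C') {M : LeftComod k C}
    (h : (M.mirrorObj σ).Quasifinite) : M.Quasifinite := by
  intro V hV
  have : Module.Finite k ((LeftComod.mirror σ).obj V ⟶ (LeftComod.mirror σ).obj M) :=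
    h (V.mirrorObj σ) hV
  exact Module.Finite.of_injective ((LeftComod.mirror σ).mapLinearMap k (X := V) (Y := M))
    (LeftComod.mirror σ).map_injective

theorem LeftComod.injective_mirror_iff (σ : CoalgAntiEquiv k C C') {M : LeftComod k C} :
    Injective (M.mirrorObj σ) ↔ Injective M :=
  (LeftComod.mirrorEquiv σ).map_injective_iff M

variable {X : Bicomod k C D} {L : Bicomod k D C}

theorem CoDual.left_quasifinite (a : CoDual X L) : X.toLeft.Quasifinite :=
  LeftComod.quasifinite_of_mirror (Coop.antiEquiv k C)
    (a.mirror (Coop.antiEquiv k C) (Coop.antiEquiv k D)).quasifinite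

theorem CoDual.left_injective (a : CoDual X L) : Injective X.toLeft :=
  (LeftComod.injective_mirror_iff (Coop.antiEquiv k C)).1
    (a.mirror (Coop.antiEquiv k C) (Coop.antiEquiv k D)).injective

/-- After mirroring, both bicomodules carry universal units for the mirror of `X`. -/
theorem CoDual.nonempty_iso_leftCoHom (a : CoDual X L) : Nonempty (L ≅ leftCoHom X) := by
  have h : (cotensorLeftFunctor X).IsRightAdjoint := a.leftAdjunction.isRightAdjoint
  let σ := Coop.antiEquiv k C
  let τ := Coop.antiEquiv k D
  obtain ⟨i, -⟩ := (a.mirror σ τ).isCoHom.exists_iso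
    (isCoHom_mirror_leftCoHomOfAdjunction σ τ X (Adjunction.ofIsRightAdjoint _))
  rw [leftCoHom, dif_pos h]
  exact ⟨Bicomod.isoOfMirror τ σ i⟩

theorem nonempty_coDual_of_iso_leftCoHom (h : (cotensorLeftFunctor X).IsRightAdjoint)
    (hX : Injective X.toLeft) (i : L ≅ leftCoHom X) : Nonempty (CoDual X L) := by
  rw [leftCoHom, dif_pos h] at i
  let σ := Coop.antiEquiv k C
  let τ := Coop.antiEquiv k D
  have : Injective (X.mirror σ τ).toRight := (LeftComod.injective_mirror_iff σ).2 hX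
  obtain ⟨a⟩ := (nonempty_coDual_mirror_iff σ τ).1 (isCoHom_mirror_leftCoHomOfAdjunction σ τ X
    (Adjunction.ofIsRightAdjoint (cotensorLeftFunctor X))).nonempty_coDual_of_injective
  exact ⟨a.ofIso (Iso.refl X) i.symm⟩

theorem subsingleton_leftCoHom (X : Bicomod k C D) [Subsingleton X.carrier] :
    Subsingleton (leftCoHom X).carrier := by
  rw [leftCoHom]
  split
  case isTrue h =>
    have hu := leftCoHomUnitTensor_unique X
      (Adjunction.ofIsRightAdjoint (cotensorLeftFunctor X)) _ LinearMap.id 0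
      fun c => Subsingleton.elim _ _
    exact subsingleton_of_forall_eq 0 fun x => LinearMap.congr_fun hu x
  case isFalse h => exact inferInstanceAs (Subsingleton PUnit)

theorem subsingleton_leftCoHom_of_not_isRightAdjoint
    (h : ¬ (cotensorLeftFunctor X).IsRightAdjoint) : Subsingleton (leftCoHom X).carrier := by
  rw [leftCoHom, dif_neg h]
  exact inferInstanceAs (Subsingleton PUnit)

/-- The first triangle identity recovers `l` from `η`, which has values in `X ⊗ L = 0`. -/
theorem CoDual.subsingleton (a : CoDual X L) [Subsingleton X.carrier] : Subsingleton L.carrier :=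
  subsingleton_of_forall_eq 0 fun l => (a.triangle_left l).symm.trans (by
    rw [show a.η = 0 from LinearMap.ext fun _ => Subsingleton.elim _ _]
    simp)

namespace FourTuple

theorem subsingleton_uxv (q : FourTuple k C D) [Subsingleton q.X.carrier] :
    Subsingleton q.UXV.carrier :=
  have := Bicomod.subsingleton_cotensor_right q.U.P q.X
  Bicomod.subsingleton_cotensor_left (q.U.P.cotensor q.X) q.V.P

/-- If `U □ X □ V = 0`, then `0` is trivially a dual of it. Moving `U` and `V` to the other side
makes `V □ 0 □ U = 0` a dual of `X`, so `X = 0`. -/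
theorem subsingleton_of_uxv (q : FourTuple k C D) [Subsingleton q.UXV.carrier] :
    Subsingleton q.X.carrier := by
  let q' : FourTuple k C D := { q with L := Bicomod.zero k D C }
  have h0 : Subsingleton q'.L.carrier := inferInstanceAs (Subsingleton PUnit)
  have h1 : Subsingleton q'.UXV.carrier := inferInstanceAs (Subsingleton q.UXV.carrier)
  obtain ⟨a⟩ := exists_coDual_iff.1 ⟨CoDual.ofSubsingleton q'.L q'.UXV⟩
  have := Bicomod.subsingleton_cotensor_right q'.V.P q'.L
  have := Bicomod.subsingleton_cotensor_left (q'.V.P.cotensor q'.L) q'.U.P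
  exact a.subsingleton

theorem isDual_of_subsingleton (q : FourTuple k C D) [Subsingleton q.X.carrier]
    [Subsingleton q.L.carrier] : q.IsDual :=
  have := q.subsingleton_uxv
  ⟨⟨.ofSubsingleton _ _⟩, ⟨.ofSubsingleton _ _⟩⟩

theorem leftCondition_iff (q : FourTuple k C D) : q.LeftCondition ↔ q.IsDual := by
  constructor
  · rintro ⟨-, hL, -, hX, ⟨i⟩, ⟨j⟩⟩
    -- As on the right, a missing adjoint makes a co-hom zero by convention, and the two
    -- isomorphisms then force `X = 0` and `L = 0`.
    by_cases h1 : (cotensorLeftFunctor q.X).IsRightAdjoint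
    · by_cases h2 : (cotensorLeftFunctor q.L).IsRightAdjoint
      · exact ⟨nonempty_coDual_of_iso_leftCoHom h1 hX i, nonempty_coDual_of_iso_leftCoHom h2 hL j⟩
      · have := subsingleton_leftCoHom_of_not_isRightAdjoint h2
        have := Bicomod.subsingleton_of_iso j
        have := q.subsingleton_of_uxv
        have := subsingleton_leftCoHom q.X
        have := Bicomod.subsingleton_of_iso i
        exact q.isDual_of_subsingleton
    · have := subsingleton_leftCoHom_of_not_isRightAdjoint h1
      have := Bicomod.subsingleton_of_iso i
      have := subsingleton_leftCoHom q.L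
      have := Bicomod.subsingleton_of_iso j
      have := q.subsingleton_of_uxv
      exact q.isDual_of_subsingleton
  · rintro ⟨⟨a⟩, ⟨b⟩⟩
    exact ⟨b.left_quasifinite, b.left_injective, a.left_quasifinite, a.left_injective,
      a.nonempty_iso_leftCoHom, b.nonempty_iso_leftCoHom⟩

end FourTuple

end LeftConditions

/-! ### Passage to isomorphism classes. -/

section Correspondence

universe v₁ v₂ u₁ u₂

variable {k : Type u} [Field k]
variable {C : Type u} [AddCommGroup C] [Module k C] [Coalgebra k C]
variable {D : Type u} [AddCommGroup D] [Module k D] [Coalgebra k D]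
variable {𝒜 : Type u₁} [Category.{v₁} 𝒜] [Preadditive 𝒜] [Linear k 𝒜]
variable {ℬ : Type u₂} [Category.{v₂} ℬ] [Preadditive ℬ] [Linear k ℬ]

/-- An assignment that reflects and preserves isomorphism, and is essentially surjective, is a
bijection between isomorphism classes. -/
theorem FrobeniusFourTuple.exists_equiv
    (T : (q : FourTuple k C D) → q.IsDual → FrobeniusSecondKind k 𝒜 ℬ)
    (hT : ∀ {q q' : FourTuple k C D} (h : q.IsDual) (h' : q'.IsDual),
      FourTuple.setoid k C D q q' ↔ FrobeniusSecondKind.setoid k 𝒜 ℬ (T q h) (T q' h'))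
    (hs : ∀ S, ∃ (q : FourTuple k C D) (h : q.IsDual), FrobeniusSecondKind.setoid k 𝒜 ℬ (T q h) S) :
    ∃ Φ : FrobeniusFourTuple.Classes k C D ≃ FrobeniusSecondKind.Classes k 𝒜 ℬ,
      ∀ q : FrobeniusFourTuple k C D, Φ q.cls = (T q.1 (q.1.rightCondition_iff.1 q.2)).cls := by
  let φ : FrobeniusFourTuple.Classes k C D → FrobeniusSecondKind.Classes k 𝒜 ℬ :=
    Quotient.lift (fun q => (T q.1 (q.1.rightCondition_iff.1 q.2)).cls) fun q q' r =>
      Quotient.sound ((hT _ _).1 r)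
  have hφ : Function.Bijective φ := by
    constructor
    · rintro ⟨q⟩ ⟨q'⟩ e
      exact Quotient.sound ((hT _ _).2 (Quotient.exact e))
    · rintro ⟨S⟩
      obtain ⟨q, h, r⟩ := hs S
      exact ⟨FrobeniusFourTuple.cls ⟨q, q.rightCondition_iff.2 h⟩, Quotient.sound r⟩
  exact ⟨Equiv.ofBijective φ hφ, fun q => rfl⟩

end Correspondence

end FrobeniusComod

/-! ### The theorem. -/

open FrobeniusComod in
theorem theorem4p3 {k : Type u} [Field k]
    {C : Type u} [AddCommGroup C] [Module k C] [Coalgebra k C]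
    {D : Type u} [AddCommGroup D] [Module k D] [Coalgebra k D] :
    (∀ q : FourTuple k C D, q.RightCondition ↔ q.LeftCondition) ∧
    (∃ Φ : FrobeniusFourTuple.Classes k C D ≃
        FrobeniusSecondKind.Classes k (RightComod k C) (RightComod k D),
      ∀ q : FrobeniusFourTuple k C D, ∃ S : FrobeniusSecondKind k (RightComod k C) (RightComod k D),
        S.F = cotensorRightFunctor q.1.X ∧ S.G = cotensorRightFunctor q.1.L ∧
        S.α = cotensorRightFunctor q.1.U.P ∧ S.β = cotensorRightFunctor q.1.V.P ∧
        Φ q.cls = S.cls) ∧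
    (∃ Ψ : FrobeniusFourTuple.Classes k C D ≃
        FrobeniusSecondKind.Classes k (LeftComod k C) (LeftComod k D),
      ∀ q : FrobeniusFourTuple k C D, ∃ S : FrobeniusSecondKind k (LeftComod k C) (LeftComod k D),
        S.F = cotensorLeftFunctor q.1.L ∧ S.G = cotensorLeftFunctor q.1.X ∧
        S.α = cotensorLeftFunctor q.1.U.P ∧ S.β = cotensorLeftFunctor q.1.V.P ∧
        Ψ q.cls = S.cls) := by
  refine ⟨fun q => q.rightCondition_iff.trans q.leftCondition_iff.symm, ?_, ?_⟩
  · obtain ⟨Φ, hΦ⟩ := FrobeniusFourTuple.exists_equiv (k := k) (C := C) (D := D)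
      FourTuple.frobeniusRight frobeniusRight_rel_iff exists_frobeniusRight_rel
    exact ⟨Φ, fun q => ⟨_, rfl, rfl, rfl, rfl, hΦ q⟩⟩
  · obtain ⟨Ψ, hΨ⟩ := FrobeniusFourTuple.exists_equiv (k := k) (C := C) (D := D)
      FourTuple.frobeniusLeft frobeniusLeft_rel_iff exists_frobeniusLeft_rel
    exact ⟨Ψ, fun q => ⟨_, rfl, rfl, rfl, rfl, hΨ q⟩⟩
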